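/- **Setting.** Let $\mathbb M=\{2^p:p\ge 0\}$; all limits in $n$ are along $n\in\mathbb M$. Put $S^n=\{1,\dots,n\}^2\subset\mathbb Z^2$ and, for $s=(i,j)\in S^n$, $I^n_s=[\frac{i-1}n,\frac in)\times[\frac{j-1}n,\frac jn)$. For $g$ on $[0,1)^2$ let $\delta^n g=(n^2\int_{I^n_s}g)_{s\in S^n}$, and for $z\in\mathbb R^{S^n}$ let $\iota^n z=\sum_{s}z_s\mathbf 1_{I^n_s}$. *Wedges.* For $\vartheta\in(-\pi/4,3\pi/4]$ let $d(\vartheta)=\max\{|\cos\vartheta|,|\sin\vartheta|\}$, let $v(\vartheta)=(-\sin\vartheta,\cos\vartheta)$ if $|\cos\vartheta|\ge|\sin\vartheta|$ and $v(\vartheta)=(\sin\vartheta,-\cos\vartheta)$ otherwise, and for $r\in\mathbb Z$ let $$L^r_\vartheta=\{s\in\mathbb Z^2:(r-\tfrac12)d(\vartheta)<\langle s,v(\vartheta)\rangle\le(r+\tfrac12)d(\vartheta)\}$$ be the digital (Bresenham) lines. If $Q\subset\mathbb Z^2$ is a square that meets both $L^r_\vartheta$ and $L^{r+1}_\vartheta$,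 the wedge split of $Q$ is its partition into $\bigcup_{k\le r}L^k_\vartheta\cap Q$ and $\bigcup_{k>r}L^k_\vartheta\cap Q$. For each $n\in\mathbb M$ let a set $\Theta^n\subset(-\pi/4,3\pi/4]$ of angles be given such that, for some constant $c$ independent of $n$, every $\vartheta\in(-\pi/4,3\pi/4]$ is within distance $c/n$ of some element of $\Theta^n$ (for instance, all angles). The dyadic squares of $S^n$, $n=2^p$, are the sets $\{(i-1)2^q+1,\dots,i2^q\}\times\{(j-1)2^q+1,\dots,j2^q\}$ with $0\le q\le p$, $1\le i,j\le 2^{p-q}$. The (finite) set $\mathscr R^n$ of fragments consists of the dyadic squares and of all wedges from wedge splits of dyadic squares with angles in $\Theta^n$. A dyadic wedge partition of $S^n$ arises from a partition of $S^n$ into dyadic squares by replacing some of the squares by the two wedges of a wedge split with an angle in $\Theta^n$. *Estimator.* For $P\subset S^n$ let $\mathscr F_P=\{\mathbf 1_P\cdot\delta^n g: g \text{ a polynomial in two variables of degree}\le1\}$, and let $\mathfrak S^n$ be the set of pairs $(\mathscr P,h)$ with $\mathscr P$ a dyadic wedge partition of $S^n$ and $h\in\operatorname{span}\bigcup_{P\in\mathscr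 P}\mathscr F_P$. The data are $Y^n=\delta^nf+\xi^n$ with random variables $\xi^n_s$, $s\in S^n$, on a common probability space. The wedgelet-platelet estimator is, for every outcome $\omega$, a pair $(\hat{\mathscr P}^n,\hat f^n)$ that minimises $$\gamma_n|\mathscr P|+\frac1{n^2}\sum_{s\in S^n}(Y^n_s-h_s)^2\qquad\text{over }(\mathscr P,h)\in\mathfrak S^n .$$ *Horizon functions.* For $1<\alpha<2$, $\mathscr C^\alpha(U)$ is the set of bounded differentiable functions on $U$ with bounded derivative that is Hölder continuous of exponent $\alpha-1$ on $U$. $Hor_1^\alpha([0,1]^2)$ is the set of functions $f$ for which there is $h\in\mathscr C^\alpha([0,1])$ such that $f|_{S^+}\in\mathscr C^\alpha(S^+)$ and $f|_{S^-}\in\mathscr C^\alpha(S^-)$, where $S^+=\{(x,y)\in(0,1)^2:y>h(x)\}$ and $S^-=\{(x,y)\in(0,1)^2:y<h(x)\}$. **Theorem.** Let $1<\alpha<2$ and $f\in Hor_1^\alpha([0,1]^2)$. Assume: * there is $\beta>0$ such that, for all $n\in\mathbb M$, all real $\mu_s$ ($s\in S^n$) and all $c\ge0$, $$\mathbb P\Bigl(\bigl|\sum_{s\in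 S^n}\mu_s\xi^n_s\bigr|\ge c\Bigr)\le2\exp\Bigl(-\frac{c^2}{\beta\sum_{s\in S^n}\mu_s^2}\Bigr);$$ * $\kappa>0$ is such that $|\mathscr R^n|\ge Cn^\kappa$ eventually for some $C>0$, and $D\in\mathbb N$ is such that $\dim\mathscr F_P\le D$ for all $n\in\mathbb M$, $P\in\mathscr R^n$; * $\gamma_n>0$, $\gamma_n\to0$, and eventually $\gamma_n>\beta D\,\frac{\kappa+1}{\kappa}\,\frac{\ln|\mathscr R^n|}{n^2}$. Then $f\in L^2([0,1)^2)$ and, for almost all $\omega$, as $n\to\infty$ in $\mathbb M$, $$\|\iota^n\hat f^n(\omega)-f\|^2_{L^2([0,1)^2)}=O\bigl(\gamma_n^{\alpha/(\alpha+1)}\bigr)+O\bigl(n^{-\alpha/(\alpha+1)}\bigr).$$ -/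

import Mathlib

noncomputable section

namespace Wedgelet

/-! ### Discrete and continuous image domains -/

/-- The set of dyadic resolutions `n = 2 ^ p`, `p ≥ 0`. -/
def dyadicLevels : Set ℕ := {n | ∃ p : ℕ, n = 2 ^ p}

/-- The filter "`n → ∞` along the dyadic resolutions". -/
def levels : Filter ℕ := Filter.atTop ⊓ Filter.principal dyadicLevels

/-- The discrete image domain `{1, …, n}²`, inside `ℤ²`. -/
def grid (n : ℕ) : Finset (ℤ × ℤ) := Finset.Icc (1 : ℤ) n ×ˢ Finset.Icc (1 : ℤ) n

/-- The continuous image domain `[0, 1)²`. -/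
def unitSquare : Set (ℝ × ℝ) := Set.Ico (0 : ℝ) 1 ×ˢ Set.Ico (0 : ℝ) 1

/-- The cell `[(i - 1) / n, i / n) × [(j - 1) / n, j / n)` belonging to the pixel `(i, j)`. -/
def cell (n : ℕ) (s : ℤ × ℤ) : Set (ℝ × ℝ) :=
  Set.Ico (((s.1 : ℝ) - 1) / n) ((s.1 : ℝ) / n) ×ˢ Set.Ico (((s.2 : ℝ) - 1) / n) ((s.2 : ℝ) / n)

/-- The discretisation by local means, `n² ∫_{cell s} g`. -/
def localMean (n : ℕ) (g : ℝ × ℝ → ℝ) (s : ℤ × ℤ) : ℝ :=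
  (n : ℝ) ^ 2 * ∫ u in cell n s, g u

/-- The embedding of pixel images as step functions. -/
def embed (n : ℕ) (z : ℤ × ℤ → ℝ) (u : ℝ × ℝ) : ℝ :=
  ∑ s ∈ grid n, (cell n s).indicator (fun _ => z s) u

/-- The squared distance `‖g - f‖²` in `L²([0, 1)²)`. -/
def sqDist (g f : ℝ × ℝ → ℝ) : ℝ := ∫ u in unitSquare, (g u - f u) ^ 2

/-! ### Digital lines and wedges -/

/-- `d(ϑ) = max {|cos ϑ|, |sin ϑ|}`. -/
def lineWidth (ϑ : ℝ) : ℝ := max |Real.cos ϑ| |Real.sin ϑ|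

open Classical in
/-- The vector `v(ϑ)`, orthogonal to the direction `ϑ`. -/
def lineNormal (ϑ : ℝ) : ℝ × ℝ :=
  if |Real.sin ϑ| ≤ |Real.cos ϑ| then (-Real.sin ϑ, Real.cos ϑ) else (Real.sin ϑ, -Real.cos ϑ)

/-- The inner product `⟨s, v(ϑ)⟩`. -/
def lineHeight (ϑ : ℝ) (s : ℤ × ℤ) : ℝ :=
  (s.1 : ℝ) * (lineNormal ϑ).1 + (s.2 : ℝ) * (lineNormal ϑ).2

/-- The digital line with angle `ϑ` and line number `r`. -/
def digitalLine (ϑ : ℝ) (r : ℤ) : Set (ℤ × ℤ) :=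
  {s | ((r : ℝ) - 1 / 2) * lineWidth ϑ < lineHeight ϑ s ∧
    lineHeight ϑ s ≤ ((r : ℝ) + 1 / 2) * lineWidth ϑ}

/-- The dyadic squares contained in `{1, …, n}²`, `n = 2 ^ p`. -/
def IsDyadicSquare (n : ℕ) (Q : Finset (ℤ × ℤ)) : Prop :=
  ∃ p q : ℕ, n = 2 ^ p ∧ q ≤ p ∧ ∃ i j : ℤ,
    (1 ≤ i ∧ i ≤ 2 ^ (p - q)) ∧ (1 ≤ j ∧ j ≤ 2 ^ (p - q)) ∧
    Q = Finset.Icc ((i - 1) * 2 ^ q + 1) (i * 2 ^ q) ×ˢ Finset.Icc ((j - 1) * 2 ^ q + 1) (j * 2 ^ q)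

open Classical in
/-- The lower wedge of `Q`: the part of `Q` on the lines with numbers `k ≤ r`. -/
def lowerWedge (ϑ : ℝ) (r : ℤ) (Q : Finset (ℤ × ℤ)) : Finset (ℤ × ℤ) :=
  Q.filter fun s => ∃ k : ℤ, k ≤ r ∧ s ∈ digitalLine ϑ k

open Classical in
/-- The upper wedge of `Q`: the part of `Q` on the lines with numbers `k > r`. -/
def upperWedge (ϑ : ℝ) (r : ℤ) (Q : Finset (ℤ × ℤ)) : Finset (ℤ × ℤ) :=
  Q.filter fun s => ∃ k : ℤ, r < k ∧ s ∈ digitalLine ϑ k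

/-- `(ϑ, r)` defines a wedge split of `Q`: the lines `r` and `r + 1` both meet `Q`. -/
def Splits (ϑ : ℝ) (r : ℤ) (Q : Finset (ℤ × ℤ)) : Prop :=
  (∃ s ∈ Q, s ∈ digitalLine ϑ r) ∧ (∃ s ∈ Q, s ∈ digitalLine ϑ (r + 1))

open Classical in
/-- The admissible fragments: dyadic squares and the wedges obtained from wedge splits of dyadic
squares with angles in `Θ`. -/
def fragments (Θ : Set ℝ) (n : ℕ) : Finset (Finset (ℤ × ℤ)) :=
  (grid n).powerset.filter fun P =>
    IsDyadicSquare n P ∨ ∃ Q : Finset (ℤ × ℤ), IsDyadicSquare n Q ∧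
      ∃ ϑ ∈ Θ, ∃ r : ℤ, Splits ϑ r Q ∧ (P = lowerWedge ϑ r Q ∨ P = upperWedge ϑ r Q)

/-- A partition of `{1, …, n}²` into dyadic squares. -/
def IsDyadicPartition (n : ℕ) (𝒬 : Finset (Finset (ℤ × ℤ))) : Prop :=
  (∀ Q ∈ 𝒬, IsDyadicSquare n Q) ∧ (𝒬 : Set (Finset (ℤ × ℤ))).PairwiseDisjoint id ∧
    𝒬.biUnion id = grid n

/-- A dyadic wedge partition: some squares of a dyadic partition are replaced by the two wedges of
a wedge split with an angle in `Θ`. -/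
def IsWedgePartition (Θ : Set ℝ) (n : ℕ) (𝔓 : Finset (Finset (ℤ × ℤ))) : Prop :=
  ∃ (𝒬 : Finset (Finset (ℤ × ℤ))) (σ : Finset (ℤ × ℤ) → Finset (Finset (ℤ × ℤ))),
    IsDyadicPartition n 𝒬 ∧
    (∀ Q ∈ 𝒬, σ Q = {Q} ∨
      ∃ ϑ ∈ Θ, ∃ r : ℤ, Splits ϑ r Q ∧ σ Q = {lowerWedge ϑ r Q, upperWedge ϑ r Q}) ∧
    𝔓 = 𝒬.biUnion σ

/-! ### Piecewise linear segmentations and the penalised least squares functional -/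

/-- The polynomials of degree at most one in two variables. -/
def affineFunctions : Submodule ℝ (ℝ × ℝ → ℝ) :=
  Submodule.span ℝ {(fun _ => 1), (fun u => u.1), (fun u => u.2)}

/-- The functions on the grid that are discretised polynomials of degree at most one on `P` and
vanish off `P`. -/
def fragmentSpace (n : ℕ) (P : Finset (ℤ × ℤ)) : Submodule ℝ (ℤ × ℤ → ℝ) :=
  Submodule.span ℝ
    {w | ∃ g ∈ affineFunctions, w = (P : Set (ℤ × ℤ)).indicator (localMean n g)}

/-- The linear span of the spaces of all the fragments of a partition. -/
def partitionSpace (n : ℕ) (𝔓 : Finset (Finset (ℤ × ℤ))) : Submodule ℝ (ℤ × ℤ → ℝ) :=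
  ⨆ P ∈ 𝔓, fragmentSpace n P

/-- The segmentation class: dyadic wedge partitions with piecewise linear functions on them. -/
def segmentations (Θ : Set ℝ) (n : ℕ) : Set (Finset (Finset (ℤ × ℤ)) × (ℤ × ℤ → ℝ)) :=
  {S | IsWedgePartition Θ n S.1 ∧ S.2 ∈ partitionSpace n S.1}

/-- The functional `γ |𝔓| + ‖z - g‖² / n²`. -/
def potts (n : ℕ) (γ : ℝ) (z : ℤ × ℤ → ℝ)
    (S : Finset (Finset (ℤ × ℤ)) × (ℤ × ℤ → ℝ)) : ℝ :=
  γ * (S.1.card : ℝ) + (∑ s ∈ grid n, (z s - S.2 s) ^ 2) / (n : ℝ) ^ 2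

/-- `S` is a minimal point of the functional over the segmentation class. -/
def IsMinimizer (Θ : Set ℝ) (n : ℕ) (γ : ℝ) (z : ℤ × ℤ → ℝ)
    (S : Finset (Finset (ℤ × ℤ)) × (ℤ × ℤ → ℝ)) : Prop :=
  S ∈ segmentations Θ n ∧ ∀ T ∈ segmentations Θ n, potts n γ z S ≤ potts n γ z T

/-! ### Horizon functions -/

/-- The Hölder class `C^α(U)` for `1 < α ≤ 2`, where `U` has unique derivatives (an open set or a
nondegenerate interval): bounded functions with a bounded derivative that is Hölder continuous of
exponent `α - 1`. -/
def HolderClass {E : Type*} [NormedAddCommGroup E] [NormedSpace ℝ E] (α : ℝ) (U : Set E)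
    (f : E → ℝ) : Prop :=
  DifferentiableOn ℝ f U ∧ ∃ C : ℝ, ∀ z ∈ U, |f z| ≤ C ∧ ‖fderivWithin ℝ f U z‖ ≤ C ∧
    ∀ w ∈ U, ‖fderivWithin ℝ f U z - fderivWithin ℝ f U w‖ ≤ C * ‖z - w‖ ^ (α - 1)

/-- The part of the open unit square above the graph of `h`. -/
def aboveGraph (h : ℝ → ℝ) : Set (ℝ × ℝ) :=
  {u | (0 < u.1 ∧ u.1 < 1) ∧ (0 < u.2 ∧ u.2 < 1) ∧ h u.1 < u.2}

/-- The part of the open unit square below the graph of `h`. -/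
def belowGraph (h : ℝ → ℝ) : Set (ℝ × ℝ) :=
  {u | (0 < u.1 ∧ u.1 < 1) ∧ (0 < u.2 ∧ u.2 < 1) ∧ u.2 < h u.1}

/-- The generalised horizon functions: only the values of `f` on the unit square matter, and those
on the graph of the horizon boundary `h` are arbitrary. -/
def IsHorizonFunction (α : ℝ) (f : ℝ × ℝ → ℝ) : Prop :=
  ∃ h : ℝ → ℝ, HolderClass α (Set.Icc (0 : ℝ) 1) h ∧
    HolderClass α (aboveGraph h) f ∧ HolderClass α (belowGraph h) f

/-! ### Noise -/

/-- The sub-Gaussian tail estimate with scale factor `β`, at all dyadic resolutions. -/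
def TailEstimate {Ω : Type*} [MeasurableSpace Ω] (ℙ : MeasureTheory.Measure Ω) (β : ℝ)
    (ξ : ℕ → ℤ × ℤ → Ω → ℝ) : Prop :=
  ∀ n ∈ dyadicLevels, ∀ (μ : ℤ × ℤ → ℝ) (c : ℝ), 0 ≤ c →
    ℙ.real {ω | c ≤ |∑ s ∈ grid n, μ s * ξ n s ω|} ≤
      2 * Real.exp (-(c ^ 2 / (β * ∑ s ∈ grid n, μ s ^ 2)))

end Wedgelet

end

/-! By `sqDist_embed_le` the loss splits into the discretisation error of `f` and the error of the
estimator against the local means on the pixels. The first is O(1/n): only O(n) cells lie near the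
boundary, and elsewhere `f` is Lipschitz (`sum_setIntegral_cell_le`).

Noise. Let g be the discretised `f`, f' the estimate, a the projection of g onto the space of the
estimated partition, and h the image of a deterministic competitor. Comparing the two values of the
functional leaves the noise along f' - a and along a - h. The vector f' - a is an orthogonal sum
over fragments, so it is enough to control the noise on each fragment space; as dimensions are
bounded by D, boundedly many test vectors per fragment do this (`exists_net`). The vector a - h
depends on the outcome only through the partition, so it provides one fixed direction for every
family of fragments. With a threshold proportional to the number k of pieces the failure probability
is at most 2q^k, and summing over all nonempty families gives 2((1+q)^|R| - 1), of order q|R|. For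
the level X = β(κ+1)/κ · ln|R| one has q|R| = |R|^(-1/κ) = O(1/n), which is summable over n = 2^p,
and Borel–Cantelli applies (`eventually_noise_control`). The penalty pays for both noise terms as
soon as n²γ ≥ 3X; this follows from the hypothesis on γ because D ≥ 3, as the grid of four pixels
shows. The result is `oracle_inequality`.

Approximation. Dyadic squares are refined towards the boundary from side 2^(-j) down to 4^(-j). A
curve with bounded slope meets O(1/side) squares of each side, so N = 4^j pieces suffice up to a
constant. Away from the boundary linear Taylor polynomials have squared error (2^(-j))^(2α) =
N^(-α). The O(N) smallest squares at the boundary are cut along an available digital line close to a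
tangent; the misclassified strip has area of order N^(-1)(N^(-α) + 1/n) in each, hence N^(-α) + 1/n
altogether (`HorizonBounds.exists_segmentation`). Balancing γN against N^(-α) gives the rate
(`exists_scale`). -/

namespace Wedgelet

open MeasureTheory Filter Topology

/-! ### The Euclidean structure of pixel images -/

/-- The Euclidean inner product of two images over the grid. -/
noncomputable def gridDot (n : ℕ) (a b : ℤ × ℤ → ℝ) : ℝ := ∑ s ∈ grid n, a s * b s

/-- Restriction to the grid, as a linear map to a Euclidean space. -/
noncomputable def toGrid (n : ℕ) : (ℤ × ℤ → ℝ) →ₗ[ℝ] EuclideanSpace ℝ (grid n) :=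
  (WithLp.linearEquiv 2 ℝ (grid n → ℝ)).symm.toLinearMap ∘ₗ LinearMap.funLeft ℝ ℝ Subtype.val

lemma toGrid_apply (n : ℕ) (a : ℤ × ℤ → ℝ) (s : grid n) : toGrid n a s = a s := rfl

lemma inner_toGrid (n : ℕ) (a b : ℤ × ℤ → ℝ) :
    inner ℝ (toGrid n a) (toGrid n b) = gridDot n a b := by
  rw [PiLp.inner_apply, gridDot, ← Finset.sum_coe_sort (grid n)]
  exact Finset.sum_congr rfl fun s _ => by simp [toGrid_apply, mul_comm]

lemma gridDot_comm (n : ℕ) (a b : ℤ × ℤ → ℝ) : gridDot n a b = gridDot n b a := by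
  simp only [gridDot, mul_comm]

lemma gridDot_self_nonneg (n : ℕ) (a : ℤ × ℤ → ℝ) : 0 ≤ gridDot n a a :=
  Finset.sum_nonneg fun _ _ => mul_self_nonneg _

lemma gridDot_sub_left (n : ℕ) (a b c : ℤ × ℤ → ℝ) :
    gridDot n (a - b) c = gridDot n a c - gridDot n b c := by
  simp [gridDot, sub_mul, Finset.sum_sub_distrib]

lemma gridDot_sub_right (n : ℕ) (a b c : ℤ × ℤ → ℝ) :
    gridDot n a (b - c) = gridDot n a b - gridDot n a c := by
  simp [gridDot, mul_sub, Finset.sum_sub_distrib]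

lemma gridDot_sq_le (n : ℕ) (a b : ℤ × ℤ → ℝ) :
    gridDot n a b ^ 2 ≤ gridDot n a a * gridDot n b b := by
  have := Finset.sum_mul_sq_le_sq_mul_sq (grid n) a b
  simpa only [gridDot, ← sq] using this

lemma gridDot_sum_left {ι : Type*} (n : ℕ) (S : Finset ι) (a : ι → ℤ × ℤ → ℝ) (c : ℤ × ℤ → ℝ) :
    gridDot n (∑ i ∈ S, a i) c = ∑ i ∈ S, gridDot n (a i) c := by
  simp only [gridDot, Finset.sum_apply, Finset.sum_mul]
  exact Finset.sum_comm

/-- Best approximations from a subspace exist. -/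
lemma exists_best_approx (n : ℕ) (V : Submodule ℝ (ℤ × ℤ → ℝ)) (g : ℤ × ℤ → ℝ) :
    ∃ a ∈ V, ∀ w ∈ V, gridDot n (g - a) w = 0 := by
  set V' := V.map (toGrid n)
  obtain ⟨a, ha, hax⟩ := (V'.starProjection_apply_mem (toGrid n g))
  refine ⟨a, ha, fun w hw => ?_⟩
  rw [← inner_toGrid, map_sub, hax, real_inner_comm]
  exact V'.starProjection_inner_eq_zero _ _ (Submodule.mem_map_of_mem hw) |> fun h => by
    rwa [real_inner_comm] at h

/-- Compactness of the sphere. The mesh 1/10 makes the loss in passing from the net to all vectors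
(10/9)² = 100/81, which is below the factor 5/4 in `exists_net`. -/
lemma exists_sphere_net (d : ℕ) : ∃ T : Finset (EuclideanSpace ℝ (Fin d)),
    (∀ e ∈ T, ‖e‖ = 1) ∧ ∀ v : EuclideanSpace ℝ (Fin d), ‖v‖ = 1 → ∃ e ∈ T, ‖v - e‖ ≤ 1 / 10 := by
  obtain ⟨t, hts, htf, hcov⟩ := finite_cover_balls_of_compact
    (isCompact_sphere (0 : EuclideanSpace ℝ (Fin d)) 1) (e := 1 / 10) (by norm_num)
  refine ⟨htf.toFinset, fun e he => by simpa using hts (htf.mem_toFinset.1 he), fun v hv => ?_⟩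
  have := hcov (show v ∈ Metric.sphere 0 1 by simpa using hv)
  simp only [Set.mem_iUnion, Metric.mem_ball, exists_prop] at this
  obtain ⟨e, he, hd⟩ := this
  exact ⟨e, htf.mem_toFinset.2 he, by rw [← dist_eq_norm]; exact hd.le⟩

/-- Linear functionals on spaces of bounded dimension are controlled by their values on a number of
vectors that depends on the dimension only. -/
lemma exists_net (D : ℕ) : ∃ M : ℕ, ∀ (n : ℕ) (V : Submodule ℝ (ℤ × ℤ → ℝ))
    [FiniteDimensional ℝ V], Module.finrank ℝ V ≤ D →
    ∃ T : Finset (ℤ × ℤ → ℝ), T.card ≤ M ∧ ∀ (x : ℤ × ℤ → ℝ) (X : ℝ), 0 ≤ X →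
      (∀ μ ∈ T, gridDot n μ x ^ 2 ≤ X * gridDot n μ μ) →
      ∀ w ∈ V, gridDot n w x ^ 2 ≤ 5 / 4 * X * gridDot n w w := by
  classical
  choose T hT1 hT2 using exists_sphere_net
  refine ⟨∑ d ∈ Finset.range (D + 1), (T d).card, fun n V _ hV => ?_⟩
  set V' := V.map (toGrid n) with hV'
  set d := Module.finrank ℝ V' with hd
  have hdD : d ≤ D := (Submodule.finrank_map_le _ _).trans hV
  let b := (stdOrthonormalBasis ℝ V').repr
  have hex : ∀ e : EuclideanSpace ℝ (Fin d), ∃ a ∈ V, toGrid n a = (b.symm e : V') := fun e =>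
    (b.symm e).2
  choose lift hliftV hlift using hex
  refine ⟨(T d).image lift, Finset.card_image_le.trans
    (Finset.single_le_sum (f := fun d => (T d).card) (fun _ _ => Nat.zero_le _)
      (Finset.mem_range.2 (Nat.lt_succ_of_le hdD))), fun x X hX0 hX w hw => ?_⟩
  have hwV : toGrid n w ∈ V' := Submodule.mem_map_of_mem hw
  -- The Riesz representer of the functional on `V'`. Only its direction matters: a net vector
  -- within 1/10 of z/‖z‖ already sees at least 9/10 of ‖z‖.
  set z : V' := V'.orthogonalProjectionOnto (toGrid n x) with hz
  have hinner : ∀ u : V', inner ℝ (u : EuclideanSpace ℝ (grid n)) (toGrid n x) = inner ℝ u z := by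
    intro u
    rw [hz, real_inner_comm, ← Submodule.inner_orthogonalProjectionOnto_eq_of_mem_right,
      real_inner_comm]
  by_cases hz0 : z = 0
  · have h0 : gridDot n w x = 0 := by
      rw [← inner_toGrid, hinner ⟨_, hwV⟩, hz0, inner_zero_right]
    have := mul_nonneg hX0 (gridDot_self_nonneg n w)
    rw [h0]; nlinarith
  · have hbz : ‖b ((‖z‖⁻¹) • z)‖ = 1 := by
      rw [LinearIsometryEquiv.norm_map, norm_smul, norm_inv, norm_norm,
        inv_mul_cancel₀ (norm_ne_zero_iff.2 hz0)]
    obtain ⟨e, he, hclose⟩ := hT2 d _ hbz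
    have hXe := hX _ (Finset.mem_image_of_mem lift he)
    have h1 : gridDot n (lift e) (lift e) = 1 := by
      rw [← inner_toGrid, hlift, real_inner_self_eq_norm_sq]
      have : ‖((b.symm e : V') : EuclideanSpace ℝ (grid n))‖ = ‖e‖ := b.symm.norm_map e
      rw [this, hT1 d e he]; norm_num
    rw [h1, mul_one, ← inner_toGrid, hlift, hinner] at hXe
    have hzpos : 0 < ‖z‖ := norm_pos_iff.2 hz0
    have hlow : 9 / 10 * ‖z‖ ≤ inner ℝ (b.symm e) z := by
      have e1 : inner ℝ (b.symm e) z
          = inner ℝ ((‖z‖⁻¹) • z) z - inner ℝ ((‖z‖⁻¹) • z - b.symm e) z := by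
        rw [inner_sub_left]; ring
      have e2 : inner ℝ ((‖z‖⁻¹) • z) z = ‖z‖ := by
        have : inner ℝ ((‖z‖⁻¹) • z) z = ‖z‖⁻¹ * inner ℝ z z :=
          real_inner_smul_left (z : EuclideanSpace ℝ (grid n)) z _
        rw [this, real_inner_self_eq_norm_sq]; field_simp
      have e3 : ‖(‖z‖⁻¹) • z - b.symm e‖ ≤ 1 / 10 := by
        rw [← LinearIsometryEquiv.norm_map b, map_sub, b.apply_symm_apply]; exact hclose
      have e4 := real_inner_le_norm ((‖z‖⁻¹) • z - b.symm e) z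
      have e5 := mul_le_mul_of_nonneg_right e3 hzpos.le
      rw [e1, e2]; linarith
    have hzX : 81 / 100 * ‖z‖ ^ 2 ≤ X := by
      refine le_trans ?_ hXe
      have := pow_le_pow_left₀ (by positivity) hlow 2
      nlinarith
    have hfin : gridDot n w x ^ 2 ≤ gridDot n w w * ‖z‖ ^ 2 := by
      rw [← inner_toGrid n w x, hinner ⟨_, hwV⟩, ← inner_toGrid n w w,
        real_inner_self_eq_norm_sq, ← mul_pow]
      have := abs_real_inner_le_norm (⟨_, hwV⟩ : V') z
      rw [← sq_abs]
      exact pow_le_pow_left₀ (abs_nonneg _) this 2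
    have := gridDot_self_nonneg n w
    nlinarith [mul_le_mul_of_nonneg_left hzX this]

/-! ### Wedge partitions and their approximation spaces -/

lemma lineWidth_pos (ϑ : ℝ) : 0 < lineWidth ϑ := by
  by_contra h
  have h' := not_lt.1 h
  have h1 : |Real.cos ϑ| ≤ 0 := (le_max_left _ _).trans h'
  have h2 : |Real.sin ϑ| ≤ 0 := (le_max_right _ _).trans h'
  have := Real.sin_sq_add_cos_sq ϑ
  rw [abs_nonpos_iff.1 h1, abs_nonpos_iff.1 h2] at this
  norm_num at this

/-- The number of the digital line through a pixel. -/
noncomputable def lineNumber (ϑ : ℝ) (s : ℤ × ℤ) : ℤ := ⌈lineHeight ϑ s / lineWidth ϑ - 1 / 2⌉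

/-- The half-open strips of width `lineWidth ϑ` tile the plane, so every pixel lies on exactly one
line, and wedges become sub- and superlevel sets of a single integer-valued function. -/
lemma mem_digitalLine {ϑ : ℝ} {r : ℤ} {s : ℤ × ℤ} :
    s ∈ digitalLine ϑ r ↔ lineNumber ϑ s = r := by
  have hd := lineWidth_pos ϑ
  rw [lineNumber, Int.ceil_eq_iff, digitalLine, Set.mem_ofPred_eq, ← lt_div_iff₀ hd,
    ← div_le_iff₀ hd]
  constructor <;> rintro ⟨h1, h2⟩ <;> constructor <;> linarith

lemma mem_lowerWedge {ϑ : ℝ} {r : ℤ} {Q : Finset (ℤ × ℤ)} {s : ℤ × ℤ} :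
    s ∈ lowerWedge ϑ r Q ↔ s ∈ Q ∧ lineNumber ϑ s ≤ r := by
  simp [lowerWedge, mem_digitalLine]

lemma mem_upperWedge {ϑ : ℝ} {r : ℤ} {Q : Finset (ℤ × ℤ)} {s : ℤ × ℤ} :
    s ∈ upperWedge ϑ r Q ↔ s ∈ Q ∧ r < lineNumber ϑ s := by
  simp [upperWedge, mem_digitalLine]

lemma lineNumber_le_iff {ϑ : ℝ} {r : ℤ} {s : ℤ × ℤ} :
    lineNumber ϑ s ≤ r ↔ lineHeight ϑ s ≤ (r + 1 / 2) * lineWidth ϑ := by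
  rw [lineNumber, Int.ceil_le, sub_le_iff_le_add, div_le_iff₀ (lineWidth_pos ϑ)]

lemma lowerWedge_subset (ϑ : ℝ) (r : ℤ) (Q : Finset (ℤ × ℤ)) : lowerWedge ϑ r Q ⊆ Q :=
  fun _ hs => (mem_lowerWedge.1 hs).1

lemma upperWedge_subset (ϑ : ℝ) (r : ℤ) (Q : Finset (ℤ × ℤ)) : upperWedge ϑ r Q ⊆ Q :=
  fun _ hs => (mem_upperWedge.1 hs).1

lemma disjoint_wedges (ϑ : ℝ) (r : ℤ) (Q : Finset (ℤ × ℤ)) :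
    Disjoint (lowerWedge ϑ r Q) (upperWedge ϑ r Q) :=
  Finset.disjoint_left.2 fun _ h1 h2 =>
    absurd (mem_lowerWedge.1 h1).2 (not_le.2 (mem_upperWedge.1 h2).2)

lemma mem_fragments {Θ : Set ℝ} {n : ℕ} {P : Finset (ℤ × ℤ)} :
    P ∈ fragments Θ n ↔ P ⊆ grid n ∧ (IsDyadicSquare n P ∨ ∃ Q : Finset (ℤ × ℤ),
      IsDyadicSquare n Q ∧ ∃ ϑ ∈ Θ, ∃ r : ℤ, Splits ϑ r Q ∧
        (P = lowerWedge ϑ r Q ∨ P = upperWedge ϑ r Q)) := by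
  simp [fragments]

lemma IsWedgePartition.subset_fragments {Θ : Set ℝ} {n : ℕ} {𝔓 : Finset (Finset (ℤ × ℤ))}
    (h : IsWedgePartition Θ n 𝔓) : 𝔓 ⊆ fragments Θ n := by
  obtain ⟨𝒬, σ, ⟨hsq, -, hcov⟩, hσ, rfl⟩ := h
  intro P hP
  obtain ⟨Q, hQ, hPQ⟩ := Finset.mem_biUnion.1 hP
  have hQg : Q ⊆ grid n := by
    rw [← hcov]; exact Finset.subset_biUnion_of_mem id hQ
  rcases hσ Q hQ with h1 | ⟨ϑ, hϑ, r, hr, h1⟩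
  · rw [h1, Finset.mem_singleton] at hPQ
    exact mem_fragments.2 ⟨hPQ ▸ hQg, Or.inl (hPQ ▸ hsq Q hQ)⟩
  · rw [h1, Finset.mem_insert, Finset.mem_singleton] at hPQ
    refine mem_fragments.2 ⟨?_, Or.inr ⟨Q, hsq Q hQ, ϑ, hϑ, r, hr, hPQ⟩⟩
    rcases hPQ with rfl | rfl
    · exact (lowerWedge_subset _ _ _).trans hQg
    · exact (upperWedge_subset _ _ _).trans hQg

lemma IsWedgePartition.pairwiseDisjoint {Θ : Set ℝ} {n : ℕ} {𝔓 : Finset (Finset (ℤ × ℤ))}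
    (h : IsWedgePartition Θ n 𝔓) : (𝔓 : Set (Finset (ℤ × ℤ))).PairwiseDisjoint id := by
  obtain ⟨𝒬, σ, ⟨-, hdis, -⟩, hσ, rfl⟩ := h
  have hsub : ∀ Q ∈ 𝒬, ∀ P ∈ σ Q, P ⊆ Q := by
    intro Q hQ P hP
    rcases hσ Q hQ with h1 | ⟨ϑ, -, r, -, h1⟩
    · rw [h1, Finset.mem_singleton] at hP; rw [hP]
    · rw [h1, Finset.mem_insert, Finset.mem_singleton] at hP
      rcases hP with rfl | rfl
      · exact lowerWedge_subset _ _ _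
      · exact upperWedge_subset _ _ _
  intro P hP P' hP' hne
  obtain ⟨Q, hQ, hPQ⟩ := Finset.mem_biUnion.1 (Finset.mem_coe.1 hP)
  obtain ⟨Q', hQ', hPQ'⟩ := Finset.mem_biUnion.1 (Finset.mem_coe.1 hP')
  by_cases hQQ : Q = Q'
  · subst hQQ
    rcases hσ Q hQ with h1 | ⟨ϑ, -, r, -, h1⟩
    · rw [h1, Finset.mem_singleton] at hPQ hPQ'
      exact absurd (hPQ.trans hPQ'.symm) hne
    · rw [h1, Finset.mem_insert, Finset.mem_singleton] at hPQ hPQ'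
      rcases hPQ with rfl | rfl <;> rcases hPQ' with rfl | rfl
      · exact absurd rfl hne
      · exact disjoint_wedges _ _ _
      · exact (disjoint_wedges _ _ _).symm
      · exact absurd rfl hne
  · exact (hdis hQ hQ' hQQ).mono (hsub Q hQ P hPQ) (hsub Q' hQ' P' hPQ')

lemma grid_nonempty {n : ℕ} (hn : 0 < n) : (grid n).Nonempty :=
  ⟨(1, 1), by simp [grid]; omega⟩

lemma two_pow_mem_dyadicLevels (p : ℕ) : 2 ^ p ∈ dyadicLevels := ⟨p, rfl⟩

lemma IsWedgePartition.nonempty {Θ : Set ℝ} {n : ℕ} {𝔓 : Finset (Finset (ℤ × ℤ))}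
    (h : IsWedgePartition Θ n 𝔓) (hn : 0 < n) : 𝔓.Nonempty := by
  obtain ⟨𝒬, σ, ⟨-, -, hcov⟩, hσ, rfl⟩ := h
  obtain ⟨s, hs⟩ := grid_nonempty hn
  rw [← hcov] at hs
  obtain ⟨Q, hQ, -⟩ := Finset.mem_biUnion.1 hs
  have : (σ Q).Nonempty := by
    rcases hσ Q hQ with h1 | ⟨ϑ, -, r, -, h1⟩ <;> rw [h1] <;> simp
  obtain ⟨P, hP⟩ := this
  exact ⟨P, Finset.mem_biUnion.2 ⟨Q, hQ, hP⟩⟩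

lemma eq_zero_of_mem_fragmentSpace {n : ℕ} {P : Finset (ℤ × ℤ)} {w : ℤ × ℤ → ℝ}
    (hw : w ∈ fragmentSpace n P) {s : ℤ × ℤ} (hs : s ∉ P) : w s = 0 := by
  rw [fragmentSpace] at hw
  induction hw using Submodule.span_induction with
  | mem x hx =>
    obtain ⟨g, -, rfl⟩ := hx
    exact Set.indicator_of_notMem (by simpa using hs) _
  | zero => rfl
  | add x y _ _ hx hy => simp [hx, hy]
  | smul a x _ hx => simp [hx]

instance finiteDimensional_fragmentSpace (n : ℕ) (P : Finset (ℤ × ℤ)) :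
    FiniteDimensional ℝ (fragmentSpace n P) := by
  have hle : fragmentSpace n P ≤
      LinearMap.range (Function.ExtendByZero.linearMap ℝ (Subtype.val : P → ℤ × ℤ)) := by
    intro w hw
    refine ⟨fun s => w s, ?_⟩
    funext s
    by_cases hs : s ∈ P
    · exact Subtype.val_injective.extend_apply (fun s : P => w s) 0 ⟨s, hs⟩
    · rw [eq_zero_of_mem_fragmentSpace hw hs]
      have hn : ¬∃ a : P, (a : ℤ × ℤ) = s := by rintro ⟨a, rfl⟩; exact hs a.2
      exact Function.extend_apply' (fun s : P => w s) (0 : ℤ × ℤ → ℝ) s hn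
  exact Submodule.finiteDimensional_of_le hle

lemma indicator_mem_fragmentSpace {n : ℕ} {P : Finset (ℤ × ℤ)} {g : ℝ × ℝ → ℝ}
    (hg : g ∈ affineFunctions) :
    (P : Set (ℤ × ℤ)).indicator (localMean n g) ∈ fragmentSpace n P :=
  Submodule.subset_span ⟨g, hg, rfl⟩

/-- Uniform control of a functional on the fragments controls it on a partition. -/
lemma gridDot_sq_le_of_fragments {n : ℕ} {𝔓 : Finset (Finset (ℤ × ℤ))}
    (hdis : (𝔓 : Set (Finset (ℤ × ℤ))).PairwiseDisjoint id) {x : ℤ × ℤ → ℝ} {X : ℝ}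
    (hX : ∀ P ∈ 𝔓, ∀ w ∈ fragmentSpace n P, gridDot n w x ^ 2 ≤ X * gridDot n w w)
    {w : ℤ × ℤ → ℝ} (hw : w ∈ partitionSpace n 𝔓) :
    gridDot n w x ^ 2 ≤ X * 𝔓.card * gridDot n w w := by
  classical
  obtain ⟨μ, rfl⟩ := (Submodule.mem_iSup_finset_iff_exists_sum _ _).1 hw
  -- Distinct fragments have disjoint supports, so the cross terms vanish.
  have hself : gridDot n (∑ P ∈ 𝔓, (μ P : ℤ × ℤ → ℝ)) (∑ P ∈ 𝔓, (μ P : ℤ × ℤ → ℝ))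
      = ∑ P ∈ 𝔓, gridDot n (μ P) (μ P) := by
    rw [gridDot_sum_left]
    refine Finset.sum_congr rfl fun P hP => ?_
    rw [gridDot_comm, gridDot_sum_left, Finset.sum_eq_single_of_mem P hP]
    intro P' hP' hne
    refine Finset.sum_eq_zero fun s _ => ?_
    by_cases hs : s ∈ P
    · have : s ∉ P' := Finset.disjoint_right.1 (hdis hP' hP hne) hs
      rw [eq_zero_of_mem_fragmentSpace (μ P').2 this, zero_mul]
    · rw [eq_zero_of_mem_fragmentSpace (μ P).2 hs, mul_zero]
  rw [hself, gridDot_sum_left]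
  -- Cauchy–Schwarz over the pieces costs the number of pieces, which is exactly what the penalty
  -- counts.
  calc _ ≤ (𝔓.card : ℝ) * ∑ P ∈ 𝔓, gridDot n (μ P) x ^ 2 := sq_sum_le_card_mul_sum_sq
    _ ≤ (𝔓.card : ℝ) * ∑ P ∈ 𝔓, X * gridDot n (μ P) (μ P) := by
        gcongr with P hP; exact hX P hP _ (μ P).2
    _ = _ := by rw [← Finset.mul_sum]; ring

/-! ### The oracle inequality -/

/-- Weighted inequality of arithmetic and geometric means; the weight `t` fixes how much of a noise
term is absorbed by the error and how much is left to the penalty. -/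
lemma two_mul_le_of_sq_le {u P Q t : ℝ} (hP : 0 ≤ P) (hQ : 0 ≤ Q) (ht : 0 < t)
    (h : u ^ 2 ≤ P * Q) : 2 * u ≤ t * P + Q / t := by
  have e : t * (Q / t) = Q := by field_simp
  refine le_of_abs_le (abs_le_of_sq_le_sq ?_ (by positivity))
  nlinarith [sq_nonneg (t * P - Q / t)]

/-- A minimal point of the penalised functional is almost as good as any competitor, once the noise
is controlled on the fragments and in one direction. -/
lemma oracle_inequality {Θ : Set ℝ} {n : ℕ} (hn : 0 < n) {γ X : ℝ} (hX : 0 ≤ X)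
    (hγ : 3 * X ≤ (n : ℝ) ^ 2 * γ) {g x : ℤ × ℤ → ℝ} {𝔓' 𝔓 : Finset (Finset (ℤ × ℤ))}
    {f' h a : ℤ × ℤ → ℝ} (hmin : IsMinimizer Θ n γ (fun s => g s + x s) (𝔓', f'))
    (hS : (𝔓, h) ∈ segmentations Θ n) (ha : a ∈ partitionSpace n 𝔓')
    (hort : ∀ w ∈ partitionSpace n 𝔓', gridDot n (g - a) w = 0)
    (hfrag : ∀ P ∈ fragments Θ n, ∀ w ∈ fragmentSpace n P,
      gridDot n w x ^ 2 ≤ 5 / 4 * X * gridDot n w w)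
    (hdir : gridDot n (a - h) x ^ 2 ≤ X * 𝔓'.card * gridDot n (a - h) (a - h)) :
    gridDot n (g - f') (g - f') ≤
      10 * ((n : ℝ) ^ 2 * γ * 𝔓.card) + 82 * gridDot n (g - h) (g - h) := by
  obtain ⟨⟨hwp, hf'⟩, hle⟩ := hmin
  have hle := hle _ hS
  have hwp : IsWedgePartition Θ n 𝔓' := hwp
  have hf' : f' ∈ partitionSpace n 𝔓' := hf'
  have hn' : (0 : ℝ) < (n : ℝ) ^ 2 := by positivity
  have key : ∀ w : ℤ × ℤ → ℝ, ∑ s ∈ grid n, (g s + x s - w s) ^ 2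
      = gridDot n (g - w) (g - w) + 2 * gridDot n (g - w) x + gridDot n x x := by
    intro w
    simp only [gridDot, Finset.mul_sum, ← Finset.sum_add_distrib, Pi.sub_apply]
    exact Finset.sum_congr rfl fun s _ => by ring
  simp only [potts, key] at hle
  have hle2 := mul_le_mul_of_nonneg_left hle hn'.le
  rw [mul_add, mul_add, mul_div_cancel₀ _ hn'.ne', mul_div_cancel₀ _ hn'.ne'] at hle2
  have hpyth : gridDot n (g - f') (g - f')
      = gridDot n (g - a) (g - a) + gridDot n (f' - a) (f' - a) := by
    have e : g - f' = (g - a) - (f' - a) := by abel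
    have h0 := hort _ (Submodule.sub_mem _ hf' ha)
    rw [e, gridDot_sub_left, gridDot_sub_right n (g - a) (g - a),
      gridDot_sub_right n (f' - a) (g - a), gridDot_comm n (f' - a) (g - a), h0]
    ring
  -- The weights are 1 + 1/8 and 1 + 8. After multiplication by 4/5 the coefficient of the squared
  -- norm of `g - a` is 9/10, so a tenth of it survives.
  have hH : gridDot n (a - h) (a - h)
      ≤ 9 / 8 * gridDot n (g - a) (g - a) + 9 * gridDot n (g - h) (g - h) := by
    simp only [gridDot, Finset.mul_sum, ← Finset.sum_add_distrib, Pi.sub_apply]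
    refine Finset.sum_le_sum fun s _ => ?_
    nlinarith [sq_nonneg ((g s - a s) + 8 * (g s - h s))]
  have hu := gridDot_sq_le_of_fragments hwp.pairwiseDisjoint
    (fun P hP => hfrag P (hwp.subset_fragments hP)) (Submodule.sub_mem _ hf' ha)
  have hk : (0 : ℝ) ≤ 𝔓'.card := Nat.cast_nonneg _
  have hF := gridDot_self_nonneg n (f' - a)
  have hE := gridDot_self_nonneg n (g - a)
  have hB := gridDot_self_nonneg n (g - h)
  have hHn := gridDot_self_nonneg n (a - h)
  have hXk : 0 ≤ X * 𝔓'.card := mul_nonneg hX hk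
  -- With t = 4/5 in both noise terms, their total cost is (25/16 + 5/4) X = 45/16 X per piece,
  -- within the 3X covered by the penalty. A tenth of the first error term and a fifth of the second
  -- remain on the left, against n²γ|𝔓| and 41/5 of the competitor's error; multiplying by 10 yields
  -- the constants 10 and 82.
  have hu2 := two_mul_le_of_sq_le (P := gridDot n (f' - a) (f' - a))
    (Q := 5 / 4 * (X * 𝔓'.card)) (t := 4 / 5) hF (by positivity) (by norm_num)
    (hu.trans_eq (by ring))
  have hv2 := two_mul_le_of_sq_le (P := gridDot n (a - h) (a - h))
    (Q := X * 𝔓'.card) (t := 4 / 5) hHn hXk (by norm_num) (hdir.trans_eq (by ring))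
  have hsplit : gridDot n (g - h) x - gridDot n (g - f') x
      = gridDot n (f' - a) x + gridDot n (a - h) x := by
    simp only [gridDot_sub_left]; ring
  have hγk := mul_le_mul_of_nonneg_right hγ hk
  linarith

/-! ### Control of the noise -/

/-- Taking c² = t⟨μ, μ⟩ makes the exponent independent of the scale of `μ`. A vector vanishing on
the grid needs its own argument: the tail estimate is void there, but the strict inequality makes
the event empty. -/
lemma TailEstimate.measureReal_lt_sq_le {Ω : Type*} [MeasurableSpace Ω] {ℙ : Measure Ω}
    [IsProbabilityMeasure ℙ] {β : ℝ} {ξ : ℕ → ℤ × ℤ → Ω → ℝ} (htail : TailEstimate ℙ β ξ) {n : ℕ}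
    (hn : n ∈ dyadicLevels) (μ : ℤ × ℤ → ℝ) {t : ℝ} (ht : 0 ≤ t) :
    ℙ.real {ω | t * gridDot n μ μ < gridDot n μ (fun s => ξ n s ω) ^ 2} ≤
      2 * Real.exp (-(t / β)) := by
  have hμ := gridDot_self_nonneg n μ
  rcases hμ.eq_or_lt with h0 | hpos
  · have : {ω | t * gridDot n μ μ < gridDot n μ (fun s => ξ n s ω) ^ 2} = ∅ := by
      ext ω
      have := gridDot_sq_le n μ (fun s => ξ n s ω)
      rw [← h0] at this ⊢
      simp only [Set.mem_ofPred_eq, Set.mem_empty_iff_false, iff_false, not_lt]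
      linarith
    rw [this]
    simp only [measureReal_empty]
    positivity
  · have h := htail n hn μ (Real.sqrt (t * gridDot n μ μ)) (Real.sqrt_nonneg _)
    refine (measureReal_mono ?_).trans (h.trans_eq ?_)
    · intro ω hω
      rw [Set.mem_ofPred_eq] at hω ⊢
      rw [← Real.sqrt_sq_eq_abs]
      exact Real.sqrt_le_sqrt hω.le
    · rw [Real.sq_sqrt (by positivity)]
      have : ∑ s ∈ grid n, μ s ^ 2 = gridDot n μ μ := by simp only [gridDot, sq]
      rw [this]
      congr 3
      field_simp

lemma fragments_nonempty {Θ : Set ℝ} {n : ℕ} (hn : n ∈ dyadicLevels) :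
    grid n ∈ fragments Θ n := by
  obtain ⟨p, rfl⟩ := hn
  refine mem_fragments.2 ⟨subset_rfl, Or.inl ⟨p, p, rfl, le_rfl, 1, 1, by simp, by simp, ?_⟩⟩
  simp [grid]

/-- Almost surely, at all fine resolutions, the noise is small on all fragments and in directions
depending on the sets of fragments. -/
theorem eventually_noise_control {Ω : Type*} [MeasurableSpace Ω] {ℙ : Measure Ω}
    [IsProbabilityMeasure ℙ] {β : ℝ} (hβ : 0 < β) {ξ : ℕ → ℤ × ℤ → Ω → ℝ}
    (htail : TailEstimate ℙ β ξ) {Θ : ℕ → Set ℝ} {κ : ℝ} (hκ : 0 < κ) {C : ℝ} (hC : 0 < C)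
    (hR : ∀ᶠ p : ℕ in atTop,
      C * ((2 ^ p : ℕ) : ℝ) ^ κ ≤ ((fragments (Θ (2 ^ p)) (2 ^ p)).card : ℝ))
    {D : ℕ} (hD : ∀ n ∈ dyadicLevels, ∀ P ∈ fragments (Θ n) n,
      Module.finrank ℝ (fragmentSpace n P) ≤ D)
    (X : ℕ → ℝ)
    (hX : ∀ n, X n = β * (κ + 1) / κ * Real.log ((fragments (Θ n) n).card : ℝ))
    (μ : ℕ → Finset (Finset (ℤ × ℤ)) → ℤ × ℤ → ℝ) :
    ∀ᵐ ω ∂ℙ, ∀ᶠ p : ℕ in atTop,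
      (∀ P ∈ fragments (Θ (2 ^ p)) (2 ^ p), ∀ w ∈ fragmentSpace (2 ^ p) P,
        gridDot (2 ^ p) w (fun s => ξ (2 ^ p) s ω) ^ 2 ≤
          5 / 4 * X (2 ^ p) * gridDot (2 ^ p) w w) ∧
      ∀ 𝔓 ⊆ fragments (Θ (2 ^ p)) (2 ^ p), 𝔓.Nonempty →
        gridDot (2 ^ p) (μ p 𝔓) (fun s => ξ (2 ^ p) s ω) ^ 2 ≤
          X (2 ^ p) * 𝔓.card * gridDot (2 ^ p) (μ p 𝔓) (μ p 𝔓) := by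
  classical
  obtain ⟨M, hM⟩ := exists_net D
  have hnet : ∀ n ∈ dyadicLevels, ∀ P : Finset (ℤ × ℤ), ∃ T : Finset (ℤ × ℤ → ℝ), T.card ≤ M ∧
      (P ∈ fragments (Θ n) n → ∀ (x : ℤ × ℤ → ℝ) (X : ℝ), 0 ≤ X →
      (∀ μ ∈ T, gridDot n μ x ^ 2 ≤ X * gridDot n μ μ) →
      ∀ w ∈ fragmentSpace n P, gridDot n w x ^ 2 ≤ 5 / 4 * X * gridDot n w w) := by
    intro n hn P
    by_cases hP : P ∈ fragments (Θ n) n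
    · obtain ⟨T, hT, h⟩ := hM n (fragmentSpace n P) (hD n hn P hP)
      exact ⟨T, hT, fun _ => h⟩
    · exact ⟨∅, by simp, fun h => absurd h hP⟩
  have hnet' : ∀ p : ℕ, ∀ P : Finset (ℤ × ℤ), _ := fun p => hnet (2 ^ p) (two_pow_mem_dyadicLevels p)
  choose T hTM hT using hnet'
  let R : ℕ → Finset (Finset (ℤ × ℤ)) := fun p => fragments (Θ (2 ^ p)) (2 ^ p)
  have hR1 : ∀ p, (1 : ℝ) ≤ (R p).card := fun p => by
    exact_mod_cast Finset.card_pos.2 ⟨_, fragments_nonempty (two_pow_mem_dyadicLevels p)⟩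
  have hX0 : ∀ p, 0 ≤ X (2 ^ p) := fun p => by
    rw [hX]; exact mul_nonneg (by positivity) (Real.log_nonneg (hR1 p))
  -- the events to be avoided
  let S : ℕ → (ℤ × ℤ → ℝ) → ℝ → Set Ω := fun p m t =>
    {ω | t * gridDot (2 ^ p) m m < gridDot (2 ^ p) m (fun s => ξ (2 ^ p) s ω) ^ 2}
  let B₁ : ℕ → Set Ω := fun p => ⋃ P ∈ R p, ⋃ m ∈ T p P, S p m (X (2 ^ p))
  let B₂ : ℕ → Set Ω := fun p => ⋃ 𝔓 ∈ (R p).powerset.erase ∅,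
    S p (μ p 𝔓) (X (2 ^ p) * 𝔓.card)
  let q : ℕ → ℝ := fun p => Real.exp (-(X (2 ^ p) / β))
  -- Here q = |R|^(-(κ+1)/κ). One power of |R| pays for the union bound, and the remaining exponent
  -- -1/κ turns |R| ≥ Cn^κ into O(1/n).
  have hqR : ∀ p, q p * (R p).card = ((R p).card : ℝ) ^ (-(1 / κ)) := by
    intro p
    have hpos : (0 : ℝ) < (R p).card := zero_lt_one.trans_le (hR1 p)
    have : q p = ((R p).card : ℝ) ^ (-((κ + 1) / κ)) := by
      rw [Real.rpow_def_of_pos hpos]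
      simp only [q, hX, R]
      congr 1
      field_simp
    rw [this]
    nth_rw 2 [← Real.rpow_one ((R p).card : ℝ)]
    rw [← Real.rpow_add hpos]
    congr 1
    field_simp
    ring
  have hq0 : ∀ p, 0 ≤ q p := fun p => (Real.exp_pos _).le
  have hqR1 : ∀ p, q p * (R p).card ≤ 1 := fun p => by
    rw [hqR]
    exact Real.rpow_le_one_of_one_le_of_nonpos (hR1 p) (by simp; positivity)
  have hB₁ : ∀ p, ℙ.real (B₁ p) ≤ 2 * M * (q p * (R p).card) := by
    intro p
    calc ℙ.real (B₁ p) ≤ ∑ P ∈ R p, ℙ.real (⋃ m ∈ T p P, S p m (X (2 ^ p))) :=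
          measureReal_biUnion_finset_le _ _
      _ ≤ ∑ P ∈ R p, ∑ m ∈ T p P, ℙ.real (S p m (X (2 ^ p))) := by
          gcongr; exact measureReal_biUnion_finset_le _ _
      _ ≤ ∑ P ∈ R p, ∑ m ∈ T p P, 2 * q p := by
          gcongr with P _ m _
          exact htail.measureReal_lt_sq_le (two_pow_mem_dyadicLevels p) m (hX0 p)
      _ ≤ ∑ P ∈ R p, M * (2 * q p) := by
          gcongr with P _
          rw [Finset.sum_const, nsmul_eq_mul]
          have := hq0 p
          gcongr
          exact_mod_cast hTM p P
      _ = _ := by rw [Finset.sum_const, nsmul_eq_mul]; ring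
  have hB₂ : ∀ p, ℙ.real (B₂ p) ≤ 4 * (q p * (R p).card) := by
    intro p
    have hexp : (1 + q p) ^ (R p).card ≤ 1 + 2 * (q p * (R p).card) := by
      calc (1 + q p) ^ (R p).card ≤ Real.exp (q p) ^ (R p).card := by
            have := hq0 p
            gcongr; linarith [Real.add_one_le_exp (q p)]
        _ = Real.exp (q p * (R p).card) := by rw [← Real.exp_nat_mul, mul_comm]
        _ ≤ _ := by
            have h0 : 0 ≤ q p * (R p).card := mul_nonneg (hq0 p) (by positivity)
            have := Real.abs_exp_sub_one_le (x := q p * (R p).card)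
              (by rw [abs_of_nonneg h0]; exact hqR1 p)
            rw [abs_of_nonneg h0] at this
            linarith [le_abs_self (Real.exp (q p * (R p).card) - 1)]
    calc ℙ.real (B₂ p) ≤ ∑ 𝔓 ∈ (R p).powerset.erase ∅,
          ℙ.real (S p (μ p 𝔓) (X (2 ^ p) * 𝔓.card)) := measureReal_biUnion_finset_le _ _
      _ ≤ ∑ 𝔓 ∈ (R p).powerset.erase ∅, 2 * q p ^ 𝔓.card := by
          gcongr with 𝔓 _
          refine (htail.measureReal_lt_sq_le (two_pow_mem_dyadicLevels p) _
            (mul_nonneg (hX0 p) (Nat.cast_nonneg _))).trans_eq ?_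
          simp only [q]
          rw [← Real.exp_nat_mul]
          congr 2
          ring
      -- The binomial theorem over all families of fragments, with the empty one removed. Admitting
      -- families that are not partitions makes it unnecessary to count partitions.
      _ = 2 * ((1 + q p) ^ (R p).card - 1) := by
          rw [← Finset.mul_sum, Finset.sum_erase_eq_sub (by simp)]
          have := Finset.sum_pow_mul_eq_add_pow (q p) 1 (R p)
          simp only [one_pow, mul_one] at this
          rw [this, add_comm (q p)]
          simp
      _ ≤ _ := by linarith
  -- summability of the probabilities
  obtain ⟨p₀, hp₀⟩ := eventually_atTop.1 hR
  have hbound : ∀ p, ℙ.real (B₁ (p₀ + p) ∪ B₂ (p₀ + p)) ≤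
      (2 * M + 4) * C ^ (-(1 / κ)) * (1 / 2) ^ p := by
    intro p
    have h1 : q (p₀ + p) * (R (p₀ + p)).card ≤ C ^ (-(1 / κ)) * (1 / 2) ^ p := by
      rw [hqR]
      have h2 := hp₀ (p₀ + p) (Nat.le_add_right _ _)
      have hpow : (0 : ℝ) < ((2 ^ (p₀ + p) : ℕ) : ℝ) := by positivity
      calc ((R (p₀ + p)).card : ℝ) ^ (-(1 / κ))
          ≤ (C * ((2 ^ (p₀ + p) : ℕ) : ℝ) ^ κ) ^ (-(1 / κ)) :=
            Real.rpow_le_rpow_of_nonpos (by positivity) h2 (by simp; positivity)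
        _ = C ^ (-(1 / κ)) * ((2 ^ (p₀ + p) : ℕ) : ℝ)⁻¹ := by
            rw [Real.mul_rpow hC.le (by positivity), ← Real.rpow_mul hpow.le]
            congr 1
            rw [show κ * (-(1 / κ)) = -1 by field_simp, Real.rpow_neg_one]
        _ ≤ C ^ (-(1 / κ)) * (1 / 2) ^ p := by
            gcongr
            rw [one_div, inv_pow]
            refine inv_anti₀ (by positivity) ?_
            push_cast
            exact pow_le_pow_right₀ (by norm_num) (Nat.le_add_left _ _)
    calc _ ≤ ℙ.real (B₁ (p₀ + p)) + ℙ.real (B₂ (p₀ + p)) := measureReal_union_le _ _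
      _ ≤ (2 * M + 4) * (q (p₀ + p) * (R (p₀ + p)).card) := by
          linarith [hB₁ (p₀ + p), hB₂ (p₀ + p)]
      _ ≤ (2 * M + 4) * (C ^ (-(1 / κ)) * (1 / 2) ^ p) := by gcongr
      _ = _ := by ring
  have hsum : (∑' p, ℙ (B₁ (p₀ + p) ∪ B₂ (p₀ + p))) ≠ ⊤ := by
    have hs : Summable fun p : ℕ => (2 * M + 4) * C ^ (-(1 / κ)) * (1 / 2 : ℝ) ^ p :=
      (summable_geometric_of_lt_one (by norm_num) (by norm_num)).mul_left _
    refine ne_top_of_le_ne_top hs.tsum_ofReal_ne_top (ENNReal.tsum_le_tsum fun p => ?_)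
    rw [← ofReal_measureReal]
    exact ENNReal.ofReal_le_ofReal (hbound p)
  -- Borel–Cantelli, for the events shifted by `p₀` so that the lower bound on |R| holds at every
  -- index.
  filter_upwards [ae_eventually_notMem hsum] with ω hω
  obtain ⟨p₁, hp₁⟩ := eventually_atTop.1 hω
  refine eventually_atTop.2 ⟨p₀ + p₁, fun p hp => ?_⟩
  have hnot := hp₁ (p - p₀) (by omega)
  rw [show p₀ + (p - p₀) = p by omega] at hnot
  simp only [Set.mem_union, not_or, B₁, B₂, S, Set.mem_iUnion, not_exists, Set.mem_ofPred_eq,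
    not_lt] at hnot
  refine ⟨fun P hP => hT p P hP _ _ (hX0 p) (fun m hm => hnot.1 P hP m hm), fun 𝔓 h𝔓 hne => ?_⟩
  exact hnot.2 𝔓 (by simp [hne.ne_empty]; exact h𝔓)

/-! ### Cells and local means -/

lemma measurableSet_cell (n : ℕ) (s : ℤ × ℤ) : MeasurableSet (cell n s) :=
  measurableSet_Ico.prod measurableSet_Ico

lemma mem_cell_iff {n : ℕ} (hn : 0 < n) {s : ℤ × ℤ} {u : ℝ × ℝ} :
    u ∈ cell n s ↔ s = (⌊n * u.1⌋ + 1, ⌊n * u.2⌋ + 1) := by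
  have hn' : (0 : ℝ) < n := by exact_mod_cast hn
  have key : ∀ (i : ℤ) (x : ℝ), x ∈ Set.Ico (((i : ℝ) - 1) / n) ((i : ℝ) / n) ↔ i = ⌊n * x⌋ + 1 := by
    intro i x
    rw [← sub_eq_iff_eq_add, eq_comm, Int.floor_eq_iff, Set.mem_Ico, div_le_iff₀ hn',
      lt_div_iff₀ hn', mul_comm x]
    push_cast
    rw [sub_add_cancel]
  rw [cell, Set.mem_prod, key, key, Prod.ext_iff]

lemma mem_grid {n : ℕ} {s : ℤ × ℤ} :
    s ∈ grid n ↔ (1 ≤ s.1 ∧ s.1 ≤ n) ∧ (1 ≤ s.2 ∧ s.2 ≤ n) := by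
  simp [grid]

lemma card_grid (n : ℕ) : (grid n).card = n ^ 2 := by
  simp [grid, sq]

lemma unitSquare_eq_biUnion {n : ℕ} (hn : 0 < n) : unitSquare = ⋃ s ∈ grid n, cell n s := by
  have hn' : (0 : ℝ) < n := by exact_mod_cast hn
  have key : ∀ x : ℝ, x ∈ Set.Ico (0 : ℝ) 1 ↔ 1 ≤ ⌊n * x⌋ + 1 ∧ ⌊n * x⌋ + 1 ≤ n := by
    intro x
    rw [Set.mem_Ico, Int.add_one_le_iff, Int.floor_lt, le_add_iff_nonneg_left, Int.floor_nonneg]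
    push_cast
    refine and_congr ⟨fun h => by positivity, fun h => nonneg_of_mul_nonneg_right h hn'⟩
      ⟨fun h => by nlinarith, fun h => by nlinarith⟩
  ext u
  simp only [Set.mem_iUnion, mem_cell_iff hn, exists_prop, exists_eq_right, mem_grid, ← key]
  rfl

lemma cell_subset_unitSquare {n : ℕ} (hn : 0 < n) {s : ℤ × ℤ} (hs : s ∈ grid n) :
    cell n s ⊆ unitSquare := by
  rw [unitSquare_eq_biUnion hn]; exact Set.subset_biUnion_of_mem (u := fun s => cell n s) hs

lemma pairwise_disjoint_cell {n : ℕ} (hn : 0 < n) : Pairwise (Function.onFun Disjoint (cell n)) :=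
  fun _ _ hne => Set.disjoint_left.2 fun _ h1 h2 =>
    hne (((mem_cell_iff hn).1 h1).trans ((mem_cell_iff hn).1 h2).symm)

lemma embed_of_mem_cell {n : ℕ} (hn : 0 < n) (z : ℤ × ℤ → ℝ) {s : ℤ × ℤ} (hs : s ∈ grid n)
    {u : ℝ × ℝ} (hu : u ∈ cell n s) : embed n z u = z s := by
  rw [embed, Finset.sum_eq_single_of_mem s hs, Set.indicator_of_mem hu]
  intro t _ hne
  exact Set.indicator_of_notMem
    (fun ht => Set.disjoint_left.1 (pairwise_disjoint_cell hn hne) ht hu) _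

lemma volume_cell {n : ℕ} (hn : 0 < n) (s : ℤ × ℤ) :
    volume (cell n s) = ENNReal.ofReal (1 / (n : ℝ) ^ 2) := by
  have hn' : (0 : ℝ) < n := by exact_mod_cast hn
  rw [cell, Measure.volume_eq_prod, Measure.prod_prod, Real.volume_Ico, Real.volume_Ico,
    ← ENNReal.ofReal_mul (by rw [← sub_div]; simp)]
  congr 1
  field_simp
  ring

lemma measureReal_cell {n : ℕ} (hn : 0 < n) (s : ℤ × ℤ) :
    volume.real (cell n s) = 1 / (n : ℝ) ^ 2 := by
  rw [Measure.real, volume_cell hn, ENNReal.toReal_ofReal (by positivity)]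

instance isFiniteMeasure_restrict_cell (n : ℕ) (s : ℤ × ℤ) :
    IsFiniteMeasure (volume.restrict (cell n s)) := by
  refine ⟨?_⟩
  rw [Measure.restrict_apply_univ, cell, Measure.volume_eq_prod, Measure.prod_prod,
    Real.volume_Ico, Real.volume_Ico]
  exact ENNReal.mul_lt_top ENNReal.ofReal_lt_top ENNReal.ofReal_lt_top

lemma localMean_const {n : ℕ} (hn : 0 < n) (c : ℝ) (s : ℤ × ℤ) :
    localMean n (fun _ => c) s = c := by
  have hn' : (0 : ℝ) < n := by exact_mod_cast hn
  rw [localMean, setIntegral_const, measureReal_cell hn, smul_eq_mul]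
  field_simp

lemma integral_Ico_id_cell {n : ℕ} (hn : 0 < n) (i : ℤ) :
    ∫ x in Set.Ico (((i : ℝ) - 1) / n) ((i : ℝ) / n), x = ((i : ℝ) - 1 / 2) / (n : ℝ) ^ 2 := by
  have hn' : (0 : ℝ) < n := by exact_mod_cast hn
  rw [integral_Ico_eq_integral_Ioc, ← intervalIntegral.integral_of_le (by gcongr; linarith),
    integral_id]
  field_simp
  ring

lemma integral_Ico_one_cell {n : ℕ} (hn : 0 < n) (i : ℤ) :
    ∫ _ in Set.Ico (((i : ℝ) - 1) / n) ((i : ℝ) / n), (1 : ℝ) = 1 / n := by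
  have hn' : (0 : ℝ) < n := by exact_mod_cast hn
  rw [integral_Ico_eq_integral_Ioc, ← intervalIntegral.integral_of_le (by gcongr; linarith),
    intervalIntegral.integral_const, smul_eq_mul]
  field_simp
  ring

lemma localMean_fst {n : ℕ} (hn : 0 < n) (s : ℤ × ℤ) :
    localMean n (fun u => u.1) s = ((s.1 : ℝ) - 1 / 2) / n := by
  have hn' : (0 : ℝ) < n := by exact_mod_cast hn
  have := setIntegral_prod_mul (μ := (volume : Measure ℝ)) (ν := (volume : Measure ℝ))
    (fun x : ℝ => x) (fun _ : ℝ => (1 : ℝ))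
    (Set.Ico (((s.1 : ℝ) - 1) / n) ((s.1 : ℝ) / n)) (Set.Ico (((s.2 : ℝ) - 1) / n) ((s.2 : ℝ) / n))
  simp only [mul_one] at this
  rw [localMean, cell, Measure.volume_eq_prod, this, integral_Ico_id_cell hn,
    integral_Ico_one_cell hn]
  field_simp

lemma localMean_snd {n : ℕ} (hn : 0 < n) (s : ℤ × ℤ) :
    localMean n (fun u => u.2) s = ((s.2 : ℝ) - 1 / 2) / n := by
  have hn' : (0 : ℝ) < n := by exact_mod_cast hn
  have := setIntegral_prod_mul (μ := (volume : Measure ℝ)) (ν := (volume : Measure ℝ))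
    (fun _ : ℝ => (1 : ℝ)) (fun x : ℝ => x)
    (Set.Ico (((s.1 : ℝ) - 1) / n) ((s.1 : ℝ) / n)) (Set.Ico (((s.2 : ℝ) - 1) / n) ((s.2 : ℝ) / n))
  simp only [one_mul] at this
  rw [localMean, cell, Measure.volume_eq_prod, this, integral_Ico_id_cell hn,
    integral_Ico_one_cell hn]
  field_simp

lemma const_mem_affineFunctions (c : ℝ) : (fun _ => c) ∈ affineFunctions := by
  have : (fun _ : ℝ × ℝ => c) = c • (fun _ => (1 : ℝ)) := by ext; simp
  rw [this]
  exact Submodule.smul_mem _ _ (Submodule.subset_span (by simp))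

lemma fst_mem_affineFunctions : (fun u : ℝ × ℝ => u.1) ∈ affineFunctions :=
  Submodule.subset_span (by simp)

lemma snd_mem_affineFunctions : (fun u : ℝ × ℝ => u.2) ∈ affineFunctions :=
  Submodule.subset_span (by simp)

/-- Three pixel centres of the grid of side two are not collinear, so the affine functions stay
independent. This forces `D ≥ 3`, the source of the factor 3 required by `oracle_inequality`. -/
lemma three_le_finrank_fragmentSpace_grid_two :
    3 ≤ Module.finrank ℝ (fragmentSpace 2 (grid 2)) := by
  let v : Fin 3 → fragmentSpace 2 (grid 2) :=
    ![⟨_, indicator_mem_fragmentSpace (const_mem_affineFunctions 1)⟩,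
      ⟨_, indicator_mem_fragmentSpace fst_mem_affineFunctions⟩,
      ⟨_, indicator_mem_fragmentSpace snd_mem_affineFunctions⟩]
  have hv : LinearIndependent ℝ v := by
    rw [Fintype.linearIndependent_iff]
    intro c hc
    have hval : ∀ s ∈ grid 2, c 0 + c 1 * (((s.1 : ℝ) - 1 / 2) / 2)
        + c 2 * (((s.2 : ℝ) - 1 / 2) / 2) = 0 := by
      intro s hs
      have h1 : ((∑ i, c i • v i : fragmentSpace 2 (grid 2)) : ℤ × ℤ → ℝ) s = 0 := by
        rw [hc]; rfl
      have hs' : s ∈ ((grid 2 : Finset (ℤ × ℤ)) : Set (ℤ × ℤ)) := hs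
      simpa [Fin.sum_univ_three, v, Set.indicator_of_mem hs', localMean_const, localMean_fst,
        localMean_snd] using h1
    have h11 := hval (1, 1) (by simp [mem_grid])
    have h21 := hval (2, 1) (by simp [mem_grid])
    have h12 := hval (1, 2) (by simp [mem_grid])
    push_cast at h11 h21 h12
    intro i
    fin_cases i <;> simp <;> linarith
  simpa using hv.fintype_card_le_finrank

/-- Closeness on a cell passes to the local means. -/
lemma abs_localMean_sub_le {n : ℕ} (hn : 0 < n) {f A : ℝ × ℝ → ℝ} {s : ℤ × ℤ} {ε : ℝ}
    (hf : IntegrableOn f (cell n s)) (hA : IntegrableOn A (cell n s))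
    (h : ∀ᵐ u ∂(volume.restrict (cell n s)), |f u - A u| ≤ ε) :
    |localMean n f s - localMean n A s| ≤ ε := by
  have hn' : (0 : ℝ) < n := by exact_mod_cast hn
  rw [localMean, localMean, ← mul_sub, ← integral_sub hf hA, abs_mul, abs_of_nonneg (by positivity)]
  have := norm_integral_le_of_norm_le_const (f := fun u => f u - A u) h
  rw [Real.norm_eq_abs, measureReal_restrict_apply_univ, measureReal_cell hn] at this
  calc _ ≤ (n : ℝ) ^ 2 * (ε * (1 / (n : ℝ) ^ 2)) := by gcongr
    _ = ε := by field_simp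

/-- Both `f` and its mean lie within `ε` of `c`, hence within `2ε` of each other, on a cell of area
1/n². -/
lemma setIntegral_cell_sq_le {n : ℕ} (hn : 0 < n) {f : ℝ × ℝ → ℝ} {s : ℤ × ℤ} {c ε : ℝ}
    (hf : IntegrableOn f (cell n s))
    (h : ∀ᵐ u ∂(volume.restrict (cell n s)), |f u - c| ≤ ε) :
    ∫ u in cell n s, (localMean n f s - f u) ^ 2 ≤ 4 * ε ^ 2 / (n : ℝ) ^ 2 := by
  have h1 := abs_localMean_sub_le hn hf (integrable_const c) h
  rw [localMean_const hn] at h1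
  have h2 : ∀ᵐ u ∂(volume.restrict (cell n s)), ‖(localMean n f s - f u) ^ 2‖ ≤ 4 * ε ^ 2 := by
    filter_upwards [h] with u hu
    rw [Real.norm_eq_abs, abs_of_nonneg (sq_nonneg _)]
    rw [abs_le] at h1 hu
    nlinarith [mul_self_nonneg (localMean n f s - f u)]
  have h3 := norm_integral_le_of_norm_le_const h2
  rw [measureReal_restrict_apply_univ, measureReal_cell hn] at h3
  refine (le_abs_self _).trans (h3.trans_eq (by ring))

/-- The error of a step function is bounded by its error on the pixels and the discretisation
error. -/
lemma sqDist_embed_le {n : ℕ} (hn : 0 < n) {f : ℝ × ℝ → ℝ}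
    (hf : MemLp f 2 (volume.restrict unitSquare)) (z : ℤ × ℤ → ℝ) :
    sqDist (embed n z) f ≤
      2 * (gridDot n (localMean n f - z) (localMean n f - z) / (n : ℝ) ^ 2) +
        2 * ∑ s ∈ grid n, ∫ u in cell n s, (localMean n f s - f u) ^ 2 := by
  have hint : ∀ s ∈ grid n, ∀ c : ℝ, IntegrableOn (fun u => (c - f u) ^ 2) (cell n s) := by
    intro s hs c
    have h1 : MemLp f 2 (volume.restrict (cell n s)) :=
      hf.mono_measure (Measure.restrict_mono (cell_subset_unitSquare hn hs) le_rfl)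
    exact ((memLp_const c).sub h1).integrable_sq
  have heq : ∀ s ∈ grid n, Set.EqOn (fun u => (embed n z u - f u) ^ 2)
      (fun u => (z s - f u) ^ 2) (cell n s) := fun s hs u hu => by
    simp only [embed_of_mem_cell hn z hs hu]
  have hsum : sqDist (embed n z) f = ∑ s ∈ grid n, ∫ u in cell n s, (z s - f u) ^ 2 := by
    rw [sqDist, unitSquare_eq_biUnion hn, integral_biUnion_finset _
      (fun s _ => measurableSet_cell n s) (fun s _ t _ hne => pairwise_disjoint_cell hn hne)]
    · exact Finset.sum_congr rfl fun s hs =>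
        setIntegral_congr_fun (measurableSet_cell n s) (heq s hs)
    · exact fun s hs => (hint s hs (z s)).congr_fun (heq s hs).symm (measurableSet_cell n s)
  rw [hsum, gridDot, Finset.sum_div, Finset.mul_sum, Finset.mul_sum, ← Finset.sum_add_distrib]
  refine Finset.sum_le_sum fun s hs => ?_
  calc ∫ u in cell n s, (z s - f u) ^ 2
      ≤ ∫ u in cell n s, (2 * (localMean n f s - z s) ^ 2 + 2 * (localMean n f s - f u) ^ 2) := by
        refine integral_mono (hint s hs _) ((integrable_const _).add ((hint s hs _).const_mul 2))
          fun u => ?_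
        dsimp only
        nlinarith [sq_nonneg ((localMean n f s - z s) + (localMean n f s - f u))]
    _ = _ := by
        rw [integral_add (integrable_const _) ((hint s hs _).const_mul 2), setIntegral_const,
          measureReal_cell hn, integral_const_mul, smul_eq_mul, Pi.sub_apply]
        ring

/-! ### Dyadic blocks and adaptive dyadic partitions -/

/-- The dyadic block of side `2 ^ q` with index `c`. -/
noncomputable def block (q : ℕ) (c : ℤ × ℤ) : Finset (ℤ × ℤ) :=
  Finset.Icc (c.1 * 2 ^ q + 1) ((c.1 + 1) * 2 ^ q) ×ˢ
    Finset.Icc (c.2 * 2 ^ q + 1) ((c.2 + 1) * 2 ^ q)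

/-- The index of the dyadic block of side `2 ^ q` through a pixel. -/
def blockIndex (q : ℕ) (s : ℤ × ℤ) : ℤ × ℤ := ((s.1 - 1) / 2 ^ q, (s.2 - 1) / 2 ^ q)

/-- The indices of the blocks of side `2 ^ q` in the grid of side `2 ^ p`. -/
noncomputable def blockIndices (p q : ℕ) : Finset (ℤ × ℤ) :=
  Finset.Ico (0 : ℤ) (2 ^ (p - q)) ×ˢ Finset.Ico (0 : ℤ) (2 ^ (p - q))

lemma mem_block {q : ℕ} {c s : ℤ × ℤ} : s ∈ block q c ↔ blockIndex q s = c := by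
  have key : ∀ i a : ℤ, (a * 2 ^ q + 1 ≤ i ∧ i ≤ (a + 1) * 2 ^ q) ↔ (i - 1) / 2 ^ q = a := by
    intro i a
    have hpos : (0 : ℤ) < 2 ^ q := by positivity
    rw [Int.ediv_eq_iff_of_pos hpos]
    constructor <;> rintro ⟨h1, h2⟩ <;> constructor <;> linarith
  rw [block, Finset.mem_product, Finset.mem_Icc, Finset.mem_Icc, key, key, blockIndex, Prod.ext_iff]

/-- Blocks are nested: iterated floor division shows that a fine index determines all coarser ones.
-/
lemma blockIndex_add (q k : ℕ) (s : ℤ × ℤ) :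
    blockIndex (q + k) s = ((blockIndex q s).1 / 2 ^ k, (blockIndex q s).2 / 2 ^ k) := by
  have hpos : (0 : ℤ) ≤ 2 ^ q := by positivity
  simp only [blockIndex, pow_add, Int.ediv_ediv_of_nonneg hpos]

lemma card_block (q : ℕ) (c : ℤ × ℤ) : (block q c).card = (2 ^ q) ^ 2 := by
  have h : ∀ a : ℤ, ((a + 1) * 2 ^ q + 1 - (a * 2 ^ q + 1)).toNat = 2 ^ q := by
    intro a
    have : (a + 1) * 2 ^ q + 1 - (a * 2 ^ q + 1) = ((2 ^ q : ℕ) : ℤ) := by push_cast; ring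
    rw [this, Int.toNat_natCast]
  simp only [block, Finset.card_product, Int.card_Icc, h, sq]

lemma blockIndex_mem {p q : ℕ} (hq : q ≤ p) {s : ℤ × ℤ} (hs : s ∈ grid (2 ^ p)) :
    blockIndex q s ∈ blockIndices p q := by
  have hpos : (0 : ℤ) < 2 ^ q := by positivity
  have e : (2 : ℤ) ^ p = 2 ^ (p - q) * 2 ^ q := by rw [← pow_add]; congr 1; omega
  obtain ⟨⟨h1, h2⟩, h3, h4⟩ := mem_grid.1 hs
  push_cast at h2 h4
  have key : ∀ i : ℤ, 1 ≤ i → i ≤ 2 ^ p → (i - 1) / 2 ^ q ∈ Finset.Ico (0 : ℤ) (2 ^ (p - q)) :=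
    fun i hi hi' => Finset.mem_Ico.2 ⟨Int.ediv_nonneg (by omega) hpos.le,
      (Int.ediv_lt_iff_lt_mul hpos).2 (by rw [← e]; omega)⟩
  exact Finset.mem_product.2 ⟨key _ h1 h2, key _ h3 h4⟩

lemma block_subset_grid {p q : ℕ} (hq : q ≤ p) {c : ℤ × ℤ} (hc : c ∈ blockIndices p q) :
    block q c ⊆ grid (2 ^ p) := by
  have e : (2 : ℤ) ^ p = 2 ^ (p - q) * 2 ^ q := by rw [← pow_add]; congr 1; omega
  have hpos : (0 : ℤ) < 2 ^ q := by positivity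
  intro s hs
  simp only [block, blockIndices, Finset.mem_product, Finset.mem_Icc, Finset.mem_Ico] at hs hc
  rw [mem_grid]
  push_cast
  rw [e]
  refine ⟨⟨?_, ?_⟩, ?_, ?_⟩ <;> nlinarith

lemma isDyadicSquare_block {p q : ℕ} (hq : q ≤ p) {c : ℤ × ℤ} (hc : c ∈ blockIndices p q) :
    IsDyadicSquare (2 ^ p) (block q c) := by
  simp only [blockIndices, Finset.mem_product, Finset.mem_Ico] at hc
  refine ⟨p, q, rfl, hq, c.1 + 1, c.2 + 1, ⟨by omega, by omega⟩, ⟨by omega, by omega⟩, ?_⟩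
  simp [block]

section Stopping

open Classical in
/-- The side exponent of the largest good block through a pixel, with exponents between `q₀` and
`q₁`; it is `q₀` if there is none. -/
noncomputable def stopLevel (bad : ℕ → ℤ × ℤ → Prop) (q₀ q₁ : ℕ) (s : ℤ × ℤ) : ℕ :=
  Nat.findGreatest (fun q => q ≤ q₀ ∨ ¬bad q (blockIndex q s)) q₁

/-- The largest good block through a pixel. -/
noncomputable def stopBlock (bad : ℕ → ℤ × ℤ → Prop) (q₀ q₁ : ℕ) (s : ℤ × ℤ) : Finset (ℤ × ℤ) :=
  block (stopLevel bad q₀ q₁ s) (blockIndex (stopLevel bad q₀ q₁ s) s)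

variable {bad : ℕ → ℤ × ℤ → Prop} {q₀ q₁ : ℕ}

lemma stopLevel_le (s : ℤ × ℤ) : stopLevel bad q₀ q₁ s ≤ q₁ := by
  classical exact Nat.findGreatest_le _

lemma le_stopLevel (h : q₀ ≤ q₁) (s : ℤ × ℤ) : q₀ ≤ stopLevel bad q₀ q₁ s :=
  by classical exact Nat.le_findGreatest h (Or.inl le_rfl)

lemma stopLevel_spec (h : q₀ ≤ q₁) (s : ℤ × ℤ) : stopLevel bad q₀ q₁ s = q₀ ∨
    ¬bad (stopLevel bad q₀ q₁ s) (blockIndex (stopLevel bad q₀ q₁ s) s) := by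
  classical
  have := Nat.findGreatest_spec (P := fun q => q ≤ q₀ ∨ ¬bad q (blockIndex q s)) h (Or.inl le_rfl)
  exact this.imp_left fun h' => le_antisymm h' (le_stopLevel h s)

/-- Since stopping takes the largest admissible level, every coarser block through the pixel is bad;
`bad` need not be monotone in the level. -/
lemma bad_of_stopLevel_lt {s : ℤ × ℤ} {q : ℕ} (h : stopLevel bad q₀ q₁ s < q) (hq : q ≤ q₁) :
    bad q (blockIndex q s) := by
  classical
  have := Nat.findGreatest_is_greatest h hq
  push Not at this
  exact this.2

lemma mem_stopBlock (s : ℤ × ℤ) : s ∈ stopBlock bad q₀ q₁ s := mem_block.2 rfl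

/-- Pixels of one block share all coarser blocks as well, and the stopping rule, read from the top
down, depends on nothing else. This makes the stopped blocks a partition. -/
lemma stopBlock_eq_of_mem (h : q₀ ≤ q₁) {s t : ℤ × ℤ} (ht : t ∈ stopBlock bad q₀ q₁ s) :
    stopBlock bad q₀ q₁ t = stopBlock bad q₀ q₁ s := by
  classical
  have hidx : ∀ q, stopLevel bad q₀ q₁ s ≤ q → blockIndex q t = blockIndex q s := by
    intro q hq
    obtain ⟨k, rfl⟩ := Nat.exists_eq_add_of_le hq
    rw [blockIndex_add, blockIndex_add, mem_block.1 ht]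
  have hlev : stopLevel bad q₀ q₁ t = stopLevel bad q₀ q₁ s := by
    have hge : stopLevel bad q₀ q₁ s ≤ stopLevel bad q₀ q₁ t := by
      refine Nat.le_findGreatest (stopLevel_le s) ?_
      rw [hidx _ le_rfl]
      exact (stopLevel_spec h s).imp_left le_of_eq
    refine le_antisymm (not_lt.1 fun hlt => ?_) hge
    have hb := bad_of_stopLevel_lt hlt (stopLevel_le t)
    rw [← hidx _ hge] at hb
    rcases stopLevel_spec (bad := bad) h t with h1 | h1
    · exact absurd (le_stopLevel (bad := bad) h s) (by omega)
    · exact h1 hb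
  rw [stopBlock, stopBlock, hlev, hidx _ le_rfl]

lemma isDyadicPartition_stopBlock {p : ℕ} (h : q₀ ≤ q₁) (hp : q₁ ≤ p) :
    IsDyadicPartition (2 ^ p) ((grid (2 ^ p)).image (stopBlock bad q₀ q₁)) := by
  have hmem : ∀ s ∈ grid (2 ^ p), blockIndex (stopLevel bad q₀ q₁ s) s ∈
      blockIndices p (stopLevel bad q₀ q₁ s) := fun s hs =>
    blockIndex_mem ((stopLevel_le s).trans hp) hs
  refine ⟨?_, ?_, ?_⟩
  · intro Q hQ
    obtain ⟨s, hs, rfl⟩ := Finset.mem_image.1 hQ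
    exact isDyadicSquare_block ((stopLevel_le s).trans hp) (hmem s hs)
  · intro Q hQ Q' hQ' hne
    obtain ⟨s, hs, rfl⟩ := Finset.mem_image.1 (Finset.mem_coe.1 hQ)
    obtain ⟨t, ht, rfl⟩ := Finset.mem_image.1 (Finset.mem_coe.1 hQ')
    refine Finset.disjoint_left.2 fun u hu hu' => hne ?_
    rw [← stopBlock_eq_of_mem h hu, ← stopBlock_eq_of_mem h hu']
  · ext s
    simp only [Finset.mem_biUnion, Finset.mem_image, id]
    constructor
    · rintro ⟨_, ⟨t, ht, rfl⟩, hs⟩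
      exact block_subset_grid ((stopLevel_le t).trans hp) (hmem t ht) hs
    · exact fun hs => ⟨_, ⟨s, hs, rfl⟩, mem_stopBlock s⟩

open Classical in
/-- The indices of the bad blocks of side `2 ^ q`. -/
noncomputable def badIndices (bad : ℕ → ℤ × ℤ → Prop) (p q : ℕ) : Finset (ℤ × ℤ) :=
  (blockIndices p q).filter (bad q)

lemma mem_badIndices {p q : ℕ} {c : ℤ × ℤ} :
    c ∈ badIndices bad p q ↔ c ∈ blockIndices p q ∧ bad q c := by
  simp [badIndices]

/-- A stopped block below the top level has a bad parent, and each parent has four children. The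
numbers of bad parents are bounded by a geometric series dominated by the finest level. -/
lemma card_image_stopBlock_le {p : ℕ} {K : ℝ} (hK : 0 ≤ K) (hp : q₁ ≤ p)
    (h : q₀ ≤ q₁)
    (hbad : ∀ q, q₀ ≤ q → q ≤ q₁ → ((badIndices bad p q).card : ℝ) ≤ K * 2 ^ (p - q)) :
    (((grid (2 ^ p)).image (stopBlock bad q₀ q₁)).card : ℝ) ≤
      4 ^ (p - q₁) + 4 * K * 2 ^ (p - q₀) := by
  classical
  let children : ℕ → Finset (Finset (ℤ × ℤ)) := fun q =>
    (badIndices bad p (q + 1) ×ˢ (({0, 1} : Finset ℤ) ×ˢ ({0, 1} : Finset ℤ))).image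
      fun x => block q (2 * x.1.1 + x.2.1, 2 * x.1.2 + x.2.2)
  have hsub : (grid (2 ^ p)).image (stopBlock bad q₀ q₁) ⊆
      (blockIndices p q₁).image (block q₁) ∪ (Finset.Ico q₀ q₁).biUnion children := by
    intro Q hQ
    obtain ⟨s, hs, rfl⟩ := Finset.mem_image.1 hQ
    rw [Finset.mem_union]
    rcases (stopLevel_le (bad := bad) (q₀ := q₀) (q₁ := q₁) s).eq_or_lt with heq | hlt
    · left
      refine Finset.mem_image.2 ⟨blockIndex q₁ s, blockIndex_mem hp hs, ?_⟩
      rw [stopBlock, heq]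
    · right
      set q := stopLevel bad q₀ q₁ s with hq
      refine Finset.mem_biUnion.2 ⟨q, Finset.mem_Ico.2 ⟨le_stopLevel h s, hlt⟩, ?_⟩
      have hb := bad_of_stopLevel_lt (bad := bad) (q₀ := q₀) (q₁ := q₁) (s := s) (q := q + 1)
        (Nat.lt_succ_self _) hlt
      have hidx := blockIndex_add q 1 s
      -- The residues of the index modulo 2 select the block among the four children of its parent.
      refine Finset.mem_image.2 ⟨(blockIndex (q + 1) s, ((blockIndex q s).1 % 2,
        (blockIndex q s).2 % 2)), ?_, ?_⟩
      · simp only [Finset.mem_product, Finset.mem_insert, Finset.mem_singleton, mem_badIndices]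
        refine ⟨⟨blockIndex_mem (by omega) hs, hb⟩, ?_, ?_⟩ <;> omega
      · rw [stopBlock, ← hq, hidx]
        simp only [pow_one]
        rw [Int.mul_ediv_add_emod, Int.mul_ediv_add_emod]
  have hchildren : ∀ q ∈ Finset.Ico q₀ q₁, ((children q).card : ℝ) ≤ 4 * K * 2 ^ (p - (q + 1)) := by
    intro q hq
    rw [Finset.mem_Ico] at hq
    have h1 : (children q).card ≤ (badIndices bad p (q + 1)).card * 4 := by
      refine Finset.card_image_le.trans_eq ?_
      rw [Finset.card_product, Finset.card_product]
      rfl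
    have h2 := hbad (q + 1) (by omega) (by omega)
    have h3 : ((children q).card : ℝ) ≤ (badIndices bad p (q + 1)).card * 4 := by exact_mod_cast h1
    linarith
  have hgeom : ∀ q, q₀ ≤ q → q ≤ q₁ →
      ∑ i ∈ Finset.Ico q₀ q, (2 : ℝ) ^ (p - (i + 1)) = 2 ^ (p - q₀) - 2 ^ (p - q) := by
    intro q hq
    induction q, hq using Nat.le_induction with
    | base => simp
    | succ q hq ih =>
      intro hq'
      rw [Finset.sum_Ico_succ_top hq, ih (by omega)]
      have : (2 : ℝ) ^ (p - q) = 2 * 2 ^ (p - (q + 1)) := by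
        rw [← pow_succ']; congr 1; omega
      rw [this]; ring
  have hcoarse : (((blockIndices p q₁).image (block q₁)).card : ℝ) ≤ 4 ^ (p - q₁) := by
    have : ((blockIndices p q₁).image (block q₁)).card ≤ 4 ^ (p - q₁) := by
      refine Finset.card_image_le.trans_eq ?_
      simp only [blockIndices, Finset.card_product, Int.card_Ico, sub_zero]
      have : ((2 : ℤ) ^ (p - q₁)).toNat = 2 ^ (p - q₁) := by
        have e : (2 : ℤ) ^ (p - q₁) = ((2 ^ (p - q₁) : ℕ) : ℤ) := by push_cast; rfl
        rw [e, Int.toNat_natCast]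
      rw [this, ← mul_pow]
      norm_num
    exact_mod_cast this
  calc (((grid (2 ^ p)).image (stopBlock bad q₀ q₁)).card : ℝ)
      ≤ ((blockIndices p q₁).image (block q₁)).card +
          ((Finset.Ico q₀ q₁).biUnion children).card := by
        exact_mod_cast (Finset.card_le_card hsub).trans (Finset.card_union_le _ _)
    _ ≤ 4 ^ (p - q₁) + ∑ q ∈ Finset.Ico q₀ q₁, ((children q).card : ℝ) := by
        refine add_le_add hcoarse ?_
        exact_mod_cast Finset.card_biUnion_le
    _ ≤ 4 ^ (p - q₁) + ∑ q ∈ Finset.Ico q₀ q₁, 4 * K * 2 ^ (p - (q + 1)) := by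
        gcongr with q hq; exact hchildren q hq
    _ ≤ _ := by
        rw [← Finset.mul_sum, hgeom q₁ h le_rfl]
        have : (0 : ℝ) ≤ 2 ^ (p - q₁) := by positivity
        gcongr
        linarith

end Stopping

/-! ### Approximation on adaptive partitions -/

/-- `σ` is either the trivial partition of `Q` or a wedge split of `Q`. -/
def IsSplitting (Θ : Set ℝ) (Q : Finset (ℤ × ℤ)) (σ : Finset (Finset (ℤ × ℤ))) : Prop :=
  σ = {Q} ∨ ∃ ϑ ∈ Θ, ∃ r : ℤ, Splits ϑ r Q ∧ σ = {lowerWedge ϑ r Q, upperWedge ϑ r Q}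

lemma IsSplitting.subset {Θ : Set ℝ} {Q : Finset (ℤ × ℤ)} {σ : Finset (Finset (ℤ × ℤ))}
    (h : IsSplitting Θ Q σ) {P : Finset (ℤ × ℤ)} (hP : P ∈ σ) : P ⊆ Q := by
  rcases h with rfl | ⟨ϑ, -, r, -, rfl⟩
  · rw [Finset.mem_singleton.1 hP]
  · rw [Finset.mem_insert, Finset.mem_singleton] at hP
    rcases hP with rfl | rfl
    · exact lowerWedge_subset _ _ _
    · exact upperWedge_subset _ _ _

lemma IsSplitting.card_le {Θ : Set ℝ} {Q : Finset (ℤ × ℤ)} {σ : Finset (Finset (ℤ × ℤ))}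
    (h : IsSplitting Θ Q σ) : σ.card ≤ 2 := by
  rcases h with rfl | ⟨ϑ, -, r, -, rfl⟩
  · simp
  · exact Finset.card_le_two

lemma partitionSpace_mono {n : ℕ} {𝔓 𝔓' : Finset (Finset (ℤ × ℤ))} (h : 𝔓 ⊆ 𝔓') :
    partitionSpace n 𝔓 ≤ partitionSpace n 𝔓' :=
  biSup_mono h

lemma fragmentSpace_le_partitionSpace {n : ℕ} {𝔓 : Finset (Finset (ℤ × ℤ))} {P : Finset (ℤ × ℤ)}
    (h : P ∈ 𝔓) : fragmentSpace n P ≤ partitionSpace n 𝔓 :=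
  le_biSup (fragmentSpace n) h

lemma eq_zero_of_mem_partitionSpace {n : ℕ} {𝔓 : Finset (Finset (ℤ × ℤ))} {w : ℤ × ℤ → ℝ}
    (hw : w ∈ partitionSpace n 𝔓) {s : ℤ × ℤ} (hs : ∀ P ∈ 𝔓, s ∉ P) : w s = 0 := by
  obtain ⟨μ, rfl⟩ := (Submodule.mem_iSup_finset_iff_exists_sum _ _).1 hw
  rw [Finset.sum_apply]
  exact Finset.sum_eq_zero fun P hP => eq_zero_of_mem_fragmentSpace (μ P).2 (hs P hP)

/-- Local approximations on the squares of a dyadic partition can be put together. -/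
lemma exists_segmentation_of_local {Θ : Set ℝ} {n : ℕ} {𝒬 : Finset (Finset (ℤ × ℤ))}
    (h𝒬 : IsDyadicPartition n 𝒬) (g : ℤ × ℤ → ℝ) (e : Finset (ℤ × ℤ) → ℝ)
    (hloc : ∀ Q ∈ 𝒬, ∃ σ, IsSplitting Θ Q σ ∧ ∃ w ∈ partitionSpace n σ,
      ∑ s ∈ Q, (g s - w s) ^ 2 ≤ e Q) :
    ∃ S ∈ segmentations Θ n, S.1.card ≤ 2 * 𝒬.card ∧
      gridDot n (g - S.2) (g - S.2) ≤ ∑ Q ∈ 𝒬, e Q := by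
  classical
  have hloc' : ∀ Q, ∃ σ w, Q ∈ 𝒬 → IsSplitting Θ Q σ ∧ w ∈ partitionSpace n σ ∧
      ∑ s ∈ Q, (g s - w s) ^ 2 ≤ e Q := by
    intro Q
    by_cases hQ : Q ∈ 𝒬
    · obtain ⟨σ, h1, w, h2, h3⟩ := hloc Q hQ
      exact ⟨σ, w, fun _ => ⟨h1, h2, h3⟩⟩
    · exact ⟨∅, 0, fun h => absurd h hQ⟩
  choose σ w h using hloc'
  refine ⟨(𝒬.biUnion σ, ∑ Q ∈ 𝒬, w Q), ⟨⟨𝒬, σ, h𝒬, fun Q hQ => (h Q hQ).1, rfl⟩, ?_⟩, ?_, ?_⟩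
  · exact Submodule.sum_mem _ fun Q hQ =>
      partitionSpace_mono (Finset.subset_biUnion_of_mem σ hQ) (h Q hQ).2.1
  · rw [mul_comm]
    exact Finset.card_biUnion_le_card_mul _ _ _ fun Q hQ => (h Q hQ).1.card_le
  · rw [gridDot, ← h𝒬.2.2, Finset.sum_biUnion h𝒬.2.1]
    refine Finset.sum_le_sum fun Q hQ => le_trans (le_of_eq ?_) (h Q hQ).2.2
    refine Finset.sum_congr rfl fun s hs => ?_
    have : (∑ Q ∈ 𝒬, w Q) s = w Q s := by
      rw [Finset.sum_apply]
      refine Finset.sum_eq_single_of_mem Q hQ fun Q' hQ' hne => ?_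
      refine eq_zero_of_mem_partitionSpace (h Q' hQ').2.1 fun P hP hsP => ?_
      exact Finset.disjoint_left.1 (h𝒬.2.1 hQ' hQ hne) ((h Q' hQ').1.subset hP hsP) hs
    simp only [Pi.sub_apply, this, sq]

/-- The approximation error on an adaptive dyadic partition, from uniform errors on the good blocks
and quadratic errors on the bad blocks of the finest scale. -/
lemma exists_segmentation {Θ : Set ℝ} {p q₀ q₁ : ℕ} (h : q₀ ≤ q₁) (hp : q₁ ≤ p)
    {bad : ℕ → ℤ × ℤ → Prop} {K ε E : ℝ} (hK : 0 ≤ K) (hE : 0 ≤ E)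
    (hbad : ∀ q, q₀ ≤ q → q ≤ q₁ → ((badIndices bad p q).card : ℝ) ≤ K * 2 ^ (p - q))
    (g : ℤ × ℤ → ℝ)
    (hgood : ∀ q c, q₀ ≤ q → q ≤ q₁ → c ∈ blockIndices p q → ¬bad q c →
      ∃ w ∈ fragmentSpace (2 ^ p) (block q c), ∀ s ∈ block q c, |g s - w s| ≤ ε)
    (hwedge : ∀ c ∈ blockIndices p q₀, bad q₀ c → ∃ σ, IsSplitting Θ (block q₀ c) σ ∧
      ∃ w ∈ partitionSpace (2 ^ p) σ, ∑ s ∈ block q₀ c, (g s - w s) ^ 2 ≤ E) :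
    ∃ S ∈ segmentations Θ (2 ^ p),
      (S.1.card : ℝ) ≤ 2 * (4 ^ (p - q₁) + 4 * K * 2 ^ (p - q₀)) ∧
      gridDot (2 ^ p) (g - S.2) (g - S.2) ≤ ((2 ^ p : ℕ) : ℝ) ^ 2 * ε ^ 2 + K * 2 ^ (p - q₀) * E := by
  classical
  set 𝒬 := (grid (2 ^ p)).image (stopBlock bad q₀ q₁) with h𝒬
  have hpart : IsDyadicPartition (2 ^ p) 𝒬 := isDyadicPartition_stopBlock h hp
  let B : Finset (Finset (ℤ × ℤ)) := (badIndices bad p q₀).image (block q₀)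
  obtain ⟨S, hS, hcard, herr⟩ := exists_segmentation_of_local (Θ := Θ) hpart g
    (fun Q => Q.card * ε ^ 2 + if Q ∈ B then E else 0) (by
      intro Q hQ
      obtain ⟨s, hs, rfl⟩ := Finset.mem_image.1 hQ
      set q := stopLevel bad q₀ q₁ s with hq
      have hqq : q₀ ≤ q := le_stopLevel h s
      have hqq' : q ≤ q₁ := stopLevel_le s
      have hmem : blockIndex q s ∈ blockIndices p q := blockIndex_mem (hqq'.trans hp) hs
      have hblk : stopBlock bad q₀ q₁ s = block q (blockIndex q s) := rfl
      by_cases hb : bad q (blockIndex q s)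
      · have hq0 : q = q₀ := (stopLevel_spec h s).resolve_right (not_not.2 hb)
        rw [hq0] at hb hmem hblk
        obtain ⟨σ, hσ, w, hw, hle⟩ := hwedge _ hmem hb
        rw [hblk]
        refine ⟨σ, hσ, w, hw, hle.trans ?_⟩
        rw [if_pos (Finset.mem_image_of_mem _ (mem_badIndices.2 ⟨hmem, hb⟩))]
        have : 0 ≤ ((block q₀ (blockIndex q₀ s)).card : ℝ) * ε ^ 2 := by positivity
        linarith
      · obtain ⟨w, hw, hle⟩ := hgood q _ hqq hqq' hmem hb
        rw [hblk]
        refine ⟨{block q (blockIndex q s)}, Or.inl rfl, w,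
          fragmentSpace_le_partitionSpace (Finset.mem_singleton_self _) hw, ?_⟩
        have h1 : ∑ t ∈ block q (blockIndex q s), (g t - w t) ^ 2 ≤
            (block q (blockIndex q s)).card * ε ^ 2 := by
          rw [← nsmul_eq_mul]
          refine Finset.sum_le_card_nsmul _ _ _ fun t ht => ?_
          rw [← sq_abs]
          exact pow_le_pow_left₀ (abs_nonneg _) (hle t ht) 2
        have h2 : 0 ≤ if block q (blockIndex q s) ∈ B then E else 0 := by split_ifs <;> simp [hE]
        linarith)
  refine ⟨S, hS, ?_, herr.trans ?_⟩
  · have h1 := card_image_stopBlock_le hK hp h hbad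
    have h2 : (S.1.card : ℝ) ≤ 2 * 𝒬.card := by exact_mod_cast hcard
    linarith
  · rw [Finset.sum_add_distrib]
    refine add_le_add (le_of_eq ?_) ?_
    · rw [← Finset.sum_mul]
      have : (∑ Q ∈ 𝒬, Q.card) = (2 ^ p) ^ 2 := by
        rw [← card_grid, ← hpart.2.2, Finset.card_biUnion hpart.2.1]
        rfl
      rw [← Nat.cast_sum, this]
      push_cast
      rfl
    · rw [← Finset.sum_filter, Finset.sum_const, nsmul_eq_mul]
      refine mul_le_mul_of_nonneg_right ?_ hE
      refine le_trans ?_ (hbad q₀ le_rfl h)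
      have h1 : (𝒬.filter (· ∈ B)).card ≤ (badIndices bad p q₀).card :=
        (Finset.card_le_card (fun Q hQ => (Finset.mem_filter.1 hQ).2)).trans Finset.card_image_le
      exact_mod_cast h1

/-! ### Horizon functions -/

/-- The mean value inequality, for `f` and for `f` minus its linearisation, on convex subsets
because `U` itself need not be convex. All large `C` are allowed so that one constant can serve the
boundary and both sides of it. -/
lemma HolderClass.exists_bounds {E : Type*} [NormedAddCommGroup E] [NormedSpace ℝ E] {α : ℝ}
    (hα : 1 < α) {U : Set E} {f : E → ℝ} (hf : HolderClass α U f) :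
    ∃ C₀ : ℝ, ∀ C, C₀ ≤ C → (∀ z ∈ U, |f z| ≤ C ∧ ‖fderivWithin ℝ f U z‖ ≤ C) ∧
      ∀ S ⊆ U, Convex ℝ S → ∀ z₀ ∈ S, ∀ r : ℝ, 0 < r → (∀ z ∈ S, ‖z - z₀‖ ≤ r) → ∀ z ∈ S,
        |f z - f z₀ - fderivWithin ℝ f U z₀ (z - z₀)| ≤ C * r ^ α ∧
        |f z - f z₀| ≤ C * ‖z - z₀‖ := by
  obtain ⟨hd, C₀, hC₀⟩ := hf
  refine ⟨max C₀ 0, fun C hC => ?_⟩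
  have hC0 : C₀ ≤ C := (le_max_left _ _).trans hC
  have hCn : 0 ≤ C := (le_max_right _ _).trans hC
  refine ⟨fun z hz => ⟨(hC₀ z hz).1.trans hC0, (hC₀ z hz).2.1.trans hC0⟩, ?_⟩
  intro S hSU hS z₀ hz₀ r hr hSr z hz
  have hderiv : ∀ x ∈ S, HasFDerivWithinAt f (fderivWithin ℝ f U x) S x := fun x hx =>
    ((hd x (hSU hx)).hasFDerivWithinAt).mono hSU
  constructor
  · have h1 : ∀ x ∈ S, ‖fderivWithin ℝ f U x - fderivWithin ℝ f U z₀‖ ≤ C * r ^ (α - 1) := by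
      intro x hx
      refine ((hC₀ x (hSU hx)).2.2 z₀ (hSU hz₀)).trans ?_
      have := Real.rpow_le_rpow (norm_nonneg _) (hSr x hx) (by linarith : 0 ≤ α - 1)
      have hn : 0 ≤ ‖x - z₀‖ ^ (α - 1) := by positivity
      calc C₀ * ‖x - z₀‖ ^ (α - 1) ≤ C * ‖x - z₀‖ ^ (α - 1) := by gcongr
        _ ≤ _ := by gcongr
    have h2 := hS.norm_image_sub_le_of_norm_hasFDerivWithin_le' hderiv h1 hz₀ hz
    refine h2.trans ?_
    have e : r ^ α = r ^ (α - 1) * r := by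
      rw [Real.rpow_sub_one hr.ne']; field_simp
    rw [e, ← mul_assoc]
    have : 0 ≤ C * r ^ (α - 1) := by positivity
    gcongr
    exact hSr z hz
  · exact hS.norm_image_sub_le_of_norm_hasFDerivWithin_le hderiv
      (fun x hx => (hC₀ x (hSU hx)).2.1.trans hC0) hz₀ hz

lemma affine_mem_affineFunctions (φ : ℝ × ℝ →L[ℝ] ℝ) (c : ℝ) (z₀ : ℝ × ℝ) :
    (fun z => c + φ (z - z₀)) ∈ affineFunctions := by
  have : (fun z => c + φ (z - z₀)) = (fun _ => c - φ z₀) + φ (1, 0) • (fun u : ℝ × ℝ => u.1)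
      + φ (0, 1) • (fun u : ℝ × ℝ => u.2) := by
    funext z
    have hz : z = z.1 • ((1 : ℝ), (0 : ℝ)) + z.2 • ((0 : ℝ), (1 : ℝ)) := by ext <;> simp
    have : φ z = z.1 * φ (1, 0) + z.2 * φ (0, 1) := by
      conv_lhs => rw [hz]
      rw [map_add, map_smul, map_smul, smul_eq_mul, smul_eq_mul]
    simp only [map_sub, Pi.add_apply, Pi.smul_apply, smul_eq_mul, this]
    ring
  rw [this]
  exact Submodule.add_mem _ (Submodule.add_mem _ (const_mem_affineFunctions _)
    (Submodule.smul_mem _ _ fst_mem_affineFunctions)) (Submodule.smul_mem _ _ snd_mem_affineFunctions)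

lemma continuous_of_mem_affineFunctions {A : ℝ × ℝ → ℝ} (hA : A ∈ affineFunctions) :
    Continuous A := by
  rw [affineFunctions] at hA
  induction hA using Submodule.span_induction with
  | mem x hx =>
    simp only [Set.mem_insert_iff, Set.mem_singleton_iff] at hx
    rcases hx with rfl | rfl | rfl <;> fun_prop
  | zero => exact continuous_zero
  | add x y _ _ hx hy => exact hx.add hy
  | smul a x _ hx => exact hx.const_smul a

lemma integrableOn_cell_of_mem_affineFunctions {A : ℝ × ℝ → ℝ} (hA : A ∈ affineFunctions) (n : ℕ)
    (s : ℤ × ℤ) : IntegrableOn A (cell n s) := by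
  refine ((continuous_of_mem_affineFunctions hA).continuousOn.integrableOn_compact
    (isCompact_Icc.prod isCompact_Icc)).mono_set
    (Set.prod_mono Set.Ico_subset_Icc_self Set.Ico_subset_Icc_self)

/-- Quantitative smoothness of a horizon function `f` with boundary `h` and slopes `m` of the
boundary, with a common constant. -/
structure HorizonBounds (α C : ℝ) (h m : ℝ → ℝ) (f : ℝ × ℝ → ℝ) : Prop where
  one_le : 1 ≤ C
  continuousOn_boundary : ContinuousOn h (Set.Icc 0 1)
  abs_slope_le : ∀ x ∈ Set.Icc (0 : ℝ) 1, |m x| ≤ C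
  abs_boundary_sub_le : ∀ x ∈ Set.Icc (0 : ℝ) 1, ∀ y ∈ Set.Icc (0 : ℝ) 1, |h y - h x| ≤ C * |y - x|
  boundary_taylor : ∀ x ∈ Set.Icc (0 : ℝ) 1, ∀ δ : ℝ, 0 < δ → ∀ y ∈ Set.Icc (0 : ℝ) 1,
    |y - x| ≤ δ → |h y - h x - m x * (y - x)| ≤ C * δ ^ α
  abs_value_le : ∀ u, u ∈ aboveGraph h ∨ u ∈ belowGraph h → |f u| ≤ C
  continuousOn_above : ContinuousOn f (aboveGraph h)
  continuousOn_below : ContinuousOn f (belowGraph h)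
  taylor : ∀ S : Set (ℝ × ℝ), Convex ℝ S → (S ⊆ aboveGraph h ∨ S ⊆ belowGraph h) → ∀ z₀ ∈ S,
    ∀ r : ℝ, 0 < r → (∀ z ∈ S, ‖z - z₀‖ ≤ r) → ∃ A ∈ affineFunctions, ∀ z ∈ S,
      |f z - A z| ≤ C * r ^ α ∧ |f z - f z₀| ≤ C * r

lemma IsHorizonFunction.exists_bounds {α : ℝ} (hα : 1 < α) {f : ℝ × ℝ → ℝ}
    (hf : IsHorizonFunction α f) : ∃ C h m, HorizonBounds α C h m f := by
  obtain ⟨h, hh, ha, hb⟩ := hf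
  obtain ⟨C₁, h₁⟩ := hh.exists_bounds hα
  obtain ⟨C₂, h₂⟩ := ha.exists_bounds hα
  obtain ⟨C₃, h₃⟩ := hb.exists_bounds hα
  set C := max (max C₁ C₂) (max C₃ 1)
  obtain ⟨b₁, t₁⟩ := h₁ C ((le_max_left _ _).trans (le_max_left _ _))
  obtain ⟨b₂, t₂⟩ := h₂ C ((le_max_right _ _).trans (le_max_left _ _))
  obtain ⟨b₃, t₃⟩ := h₃ C ((le_max_left _ _).trans (le_max_right _ _))
  have hC1 : 1 ≤ C := (le_max_right _ _).trans (le_max_right _ _)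
  refine ⟨C, h, fun x => fderivWithin ℝ h (Set.Icc 0 1) x 1, hC1, hh.1.continuousOn, ?_, ?_, ?_, ?_,
    ha.1.continuousOn, hb.1.continuousOn, ?_⟩
  · intro x hx
    refine ((fderivWithin ℝ h (Set.Icc 0 1) x).le_opNorm 1).trans ?_
    rw [norm_one, mul_one]
    exact (b₁ x hx).2
  · intro x hx y hy
    exact (t₁ _ subset_rfl (convex_Icc 0 1) x hx 1 one_pos (fun z hz => by
      rw [Real.norm_eq_abs, abs_le]; constructor <;> linarith [hz.1, hz.2, hx.1, hx.2]) y hy).2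
  · intro x hx δ hδ y hy hxy
    have := (t₁ (Set.Icc 0 1 ∩ Metric.closedBall x δ) Set.inter_subset_left
      ((convex_Icc 0 1).inter (convex_closedBall x δ)) x ⟨hx, Metric.mem_closedBall_self hδ.le⟩ δ hδ
      (fun z hz => by rw [← dist_eq_norm]; exact hz.2) y
      ⟨hy, by rw [Metric.mem_closedBall, Real.dist_eq]; exact hxy⟩).1
    have e : fderivWithin ℝ h (Set.Icc 0 1) x (y - x)
        = fderivWithin ℝ h (Set.Icc 0 1) x 1 * (y - x) := by
      conv_lhs => rw [← mul_one (y - x), ← smul_eq_mul, map_smul, smul_eq_mul, mul_comm]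
    rwa [e] at this
  · rintro u (hu | hu)
    · exact (b₂ u hu).1
    · exact (b₃ u hu).1
  · intro S hS hSU z₀ hz₀ r hr hSr
    have hfin : ∀ U : Set (ℝ × ℝ), (∀ z ∈ S,
        |f z - f z₀ - fderivWithin ℝ f U z₀ (z - z₀)| ≤ C * r ^ α ∧
        |f z - f z₀| ≤ C * ‖z - z₀‖) → ∃ A ∈ affineFunctions, ∀ z ∈ S,
      |f z - A z| ≤ C * r ^ α ∧ |f z - f z₀| ≤ C * r := by
      intro U hU
      refine ⟨_, affine_mem_affineFunctions (fderivWithin ℝ f U z₀) (f z₀) z₀, fun z hz => ⟨?_, ?_⟩⟩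
      · rw [← sub_sub]; exact (hU z hz).1
      · refine (hU z hz).2.trans ?_
        have := hSr z hz
        gcongr
    rcases hSU with hSU | hSU
    · exact hfin _ (t₂ S hSU hS z₀ hz₀ r hr hSr)
    · exact hfin _ (t₃ S hSU hS z₀ hz₀ r hr hSr)

lemma ae_fst_ne (a : ℝ) : ∀ᵐ u : ℝ × ℝ, u.1 ≠ a := by
  rw [ae_iff]
  have : {u : ℝ × ℝ | ¬u.1 ≠ a} = {a} ×ˢ Set.univ := by ext u; simp
  rw [this, Measure.volume_eq_prod, Measure.prod_prod]
  simp

lemma ae_snd_ne (a : ℝ) : ∀ᵐ u : ℝ × ℝ, u.2 ≠ a := by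
  rw [ae_iff]
  have : {u : ℝ × ℝ | ¬u.2 ≠ a} = Set.univ ×ˢ {a} := by ext u; simp
  rw [this, Measure.volume_eq_prod, Measure.prod_prod]
  simp

lemma exists_continuous_extension {h : ℝ → ℝ} (hh : ContinuousOn h (Set.Icc 0 1)) :
    ∃ k : ℝ → ℝ, Continuous k ∧ ∀ x ∈ Set.Icc (0 : ℝ) 1, k x = h x :=
  ⟨Set.IccExtend zero_le_one ((Set.Icc (0 : ℝ) 1).domRestrict h), hh.domRestrict.Icc_extend',
    fun _ hx => Set.IccExtend_of_mem _ _ hx⟩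

/-- Fubini: each vertical section of a graph is a single point. Extending `h` continuously to the
line makes the graph closed, hence measurable. -/
lemma ae_snd_ne_of_continuousOn {h : ℝ → ℝ} (hh : ContinuousOn h (Set.Icc 0 1)) :
    ∀ᵐ u : ℝ × ℝ, u.1 ∈ Set.Icc (0 : ℝ) 1 → u.2 ≠ h u.1 := by
  obtain ⟨k, hkc, hk⟩ := exists_continuous_extension hh
  have hnull : volume {u : ℝ × ℝ | u.2 = k u.1} = 0 := by
    have hms : MeasurableSet {u : ℝ × ℝ | u.2 = k u.1} :=
      (isClosed_eq continuous_snd (hkc.comp continuous_fst)).measurableSet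
    rw [Measure.volume_eq_prod, Measure.measure_prod_null hms]
    refine Eventually.of_forall fun x => ?_
    have : Prod.mk x ⁻¹' {u : ℝ × ℝ | u.2 = k u.1} = {k x} := by ext y; simp
    simp [this]
  filter_upwards [measure_eq_zero_iff_ae_notMem.1 hnull] with u hu hux he
  exact hu (he.trans (hk _ hux).symm)

namespace HorizonBounds

variable {α C : ℝ} {h m : ℝ → ℝ} {f : ℝ × ℝ → ℝ}

lemma ae_mem (H : HorizonBounds α C h m f) :
    ∀ᵐ u : ℝ × ℝ, u ∈ unitSquare → u ∈ aboveGraph h ∨ u ∈ belowGraph h := by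
  filter_upwards [ae_fst_ne 0, ae_snd_ne 0, ae_snd_ne_of_continuousOn H.continuousOn_boundary]
    with u h1 h2 h3 hu
  obtain ⟨⟨a1, a2⟩, b1, b2⟩ := hu
  have h1' := lt_of_le_of_ne a1 h1.symm
  have h2' := lt_of_le_of_ne b1 h2.symm
  rcases lt_or_gt_of_ne (h3 ⟨a1, a2.le⟩) with hlt | hgt
  · exact Or.inr ⟨⟨h1', a2⟩, ⟨h2', b2⟩, hlt⟩
  · exact Or.inl ⟨⟨h1', a2⟩, ⟨h2', b2⟩, hgt⟩

lemma ae_abs_le (H : HorizonBounds α C h m f) : ∀ᵐ u : ℝ × ℝ, u ∈ unitSquare → |f u| ≤ C := by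
  filter_upwards [H.ae_mem] with u hu hus
  exact H.abs_value_le u (hu hus)

lemma measurableSet_above (H : HorizonBounds α C h m f) : MeasurableSet (aboveGraph h) := by
  obtain ⟨k, hkc, hk⟩ := exists_continuous_extension H.continuousOn_boundary
  have : aboveGraph h = (Set.Ioo 0 1 ×ˢ Set.Ioo 0 1) ∩ {u | k u.1 < u.2} := by
    ext u
    simp only [aboveGraph, Set.mem_ofPred_eq, Set.mem_inter_iff, Set.mem_prod, Set.mem_Ioo,
      ← and_assoc]
    refine and_congr_right fun hu => ?_
    rw [hk _ ⟨hu.1.1.1.le, hu.1.1.2.le⟩]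
  rw [this]
  exact (measurableSet_Ioo.prod measurableSet_Ioo).inter
    (isOpen_lt (hkc.comp continuous_fst) continuous_snd).measurableSet

lemma measurableSet_below (H : HorizonBounds α C h m f) : MeasurableSet (belowGraph h) := by
  obtain ⟨k, hkc, hk⟩ := exists_continuous_extension H.continuousOn_boundary
  have : belowGraph h = (Set.Ioo 0 1 ×ˢ Set.Ioo 0 1) ∩ {u | u.2 < k u.1} := by
    ext u
    simp only [belowGraph, Set.mem_ofPred_eq, Set.mem_inter_iff, Set.mem_prod, Set.mem_Ioo,
      ← and_assoc]
    refine and_congr_right fun hu => ?_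
    rw [hk _ ⟨hu.1.1.1.le, hu.1.1.2.le⟩]
  rw [this]
  exact (measurableSet_Ioo.prod measurableSet_Ioo).inter
    (isOpen_lt continuous_snd (hkc.comp continuous_fst)).measurableSet

/-- Since `f` is arbitrary on the graph, it is measurable only up to a null set: it is continuous on
two measurable pieces that cover almost all of the square, and bounded there. -/
lemma memLp (H : HorizonBounds α C h m f) : MemLp f 2 (volume.restrict unitSquare) := by
  have hms : MeasurableSet unitSquare := measurableSet_Ico.prod measurableSet_Ico
  have hfin : IsFiniteMeasure (volume.restrict unitSquare) := by
    refine ⟨?_⟩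
    rw [Measure.restrict_apply_univ, unitSquare, Measure.volume_eq_prod, Measure.prod_prod]
    simp
  refine MemLp.of_bound ?_ C ((ae_restrict_iff' hms).2 H.ae_abs_le)
  have h1 : AEStronglyMeasurable f (volume.restrict (aboveGraph h ∪ belowGraph h)) :=
    aestronglyMeasurable_union_iff.2
      ⟨H.continuousOn_above.aestronglyMeasurable H.measurableSet_above,
        H.continuousOn_below.aestronglyMeasurable H.measurableSet_below⟩
  refine h1.mono_ac ?_
  refine Measure.AbsolutelyContinuous.mk fun s hs h0 => ?_
  rw [Measure.restrict_apply hs] at h0 ⊢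
  have := H.ae_mem
  rw [← nonpos_iff_eq_zero, ← h0]
  refine measure_mono_ae ?_
  filter_upwards [this] with u hu hus
  exact ⟨hus.1, hu hus.2⟩

lemma integrableOn_cell (H : HorizonBounds α C h m f) {n : ℕ} (hn : 0 < n) {s : ℤ × ℤ}
    (hs : s ∈ grid n) : IntegrableOn f (cell n s) :=
  (H.memLp.mono_measure (Measure.restrict_mono (cell_subset_unitSquare hn hs) le_rfl)).integrable
    (by norm_num)

end HorizonBounds

/-! ### Blocks and the horizon boundary -/

/-- Column by column: an interval of length `2ρ` contains at most `2ρ + 1` integers. This counts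
both the blocks near the boundary and the pixels in the strip around a tangent. -/
lemma card_le_of_abs_sub_le {S : Finset (ℤ × ℤ)} {I : Finset ℤ} {a : ℤ → ℝ} {ρ : ℝ} (hρ : 0 ≤ ρ)
    (h : ∀ s ∈ S, s.1 ∈ I ∧ |(s.2 : ℝ) - a s.1| ≤ ρ) : (S.card : ℝ) ≤ I.card * (2 * ρ + 1) := by
  rw [Finset.card_eq_sum_card_fiberwise (fun s hs => (h s hs).1), Nat.cast_sum, ← nsmul_eq_mul]
  refine Finset.sum_le_card_nsmul _ _ _ fun i _ => ?_
  have hsub : S.filter (fun s => s.1 = i) ⊆ (Finset.Icc ⌈a i - ρ⌉ ⌊a i + ρ⌋).image (Prod.mk i) := by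
    intro s hs
    obtain ⟨hsS, rfl⟩ := Finset.mem_filter.1 hs
    obtain ⟨h1, h2⟩ := abs_le.1 (h s hsS).2
    exact Finset.mem_image.2 ⟨s.2, Finset.mem_Icc.2 ⟨Int.ceil_le.2 (by linarith),
      Int.le_floor.2 (by linarith)⟩, rfl⟩
  have h1 := (Finset.card_le_card hsub).trans Finset.card_image_le
  rw [Int.card_Icc] at h1
  have h2 : ((S.filter fun s => s.1 = i).card : ℝ) ≤
      ((⌊a i + ρ⌋ + 1 - ⌈a i - ρ⌉).toNat : ℝ) := by exact_mod_cast h1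
  refine h2.trans ?_
  have h3 : ((⌊a i + ρ⌋ + 1 - ⌈a i - ρ⌉).toNat : ℝ) = ((max (⌊a i + ρ⌋ + 1 - ⌈a i - ρ⌉) 0 : ℤ) : ℝ) := by
    rw [← Int.toNat_eq_max]; norm_cast
  rw [h3, Int.cast_max]
  push_cast
  refine max_le ?_ (by positivity)
  linarith [Int.floor_le (a i + ρ), Int.le_ceil (a i - ρ)]

/-- The side length of the dyadic blocks of side `2 ^ q` at resolution `2 ^ p`. -/
noncomputable def side (p q : ℕ) : ℝ := 2 ^ q / 2 ^ p

lemma side_pos (p q : ℕ) : 0 < side p q := by rw [side]; positivity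

lemma pow_mul_side {p q : ℕ} (hq : q ≤ p) : (2 : ℝ) ^ (p - q) * side p q = 1 := by
  rw [side, mul_div_assoc', ← pow_add, Nat.sub_add_cancel hq, div_self (by positivity)]

lemma side_le_one {p q : ℕ} (hq : q ≤ p) : side p q ≤ 1 := by
  have h1 := pow_mul_side hq
  have h2 : (1 : ℝ) ≤ 2 ^ (p - q) := one_le_pow₀ (by norm_num)
  nlinarith [side_pos p q]

/-- The open square underlying a block. -/
def openBlock (p q : ℕ) (c : ℤ × ℤ) : Set (ℝ × ℝ) :=
  Set.Ioo (c.1 * side p q) ((c.1 + 1) * side p q) ×ˢ Set.Ioo (c.2 * side p q) ((c.2 + 1) * side p q)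

lemma convex_openBlock (p q : ℕ) (c : ℤ × ℤ) : Convex ℝ (openBlock p q c) :=
  (convex_Ioo _ _).prod (convex_Ioo _ _)

lemma corner_mem {p q : ℕ} (hq : q ≤ p) {c : ℤ × ℤ} (hc : c ∈ blockIndices p q) :
    (0 ≤ c.1 * side p q ∧ (c.1 + 1) * side p q ≤ 1) ∧
      (0 ≤ c.2 * side p q ∧ (c.2 + 1) * side p q ≤ 1) := by
  simp only [blockIndices, Finset.mem_product, Finset.mem_Ico] at hc
  have hs := side_pos p q
  have key : ∀ a : ℤ, 0 ≤ a → a < 2 ^ (p - q) → 0 ≤ a * side p q ∧ (a + 1) * side p q ≤ 1 := by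
    intro a h0 h1
    have h0' : (0 : ℝ) ≤ a := by exact_mod_cast h0
    have h1' : (a : ℝ) + 1 ≤ 2 ^ (p - q) := by exact_mod_cast h1
    refine ⟨by positivity, ?_⟩
    exact (mul_le_mul_of_nonneg_right h1' hs.le).trans_eq (pow_mul_side hq)
  exact ⟨key _ hc.1.1 hc.1.2, key _ hc.2.1 hc.2.2⟩

lemma cell_subset_block {p q : ℕ} {c s : ℤ × ℤ} (hs : s ∈ block q c) {u : ℝ × ℝ}
    (hu : u ∈ cell (2 ^ p) s) :
    (c.1 * side p q ≤ u.1 ∧ u.1 < (c.1 + 1) * side p q) ∧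
      (c.2 * side p q ≤ u.2 ∧ u.2 < (c.2 + 1) * side p q) := by
  simp only [block, Finset.mem_product, Finset.mem_Icc] at hs
  obtain ⟨⟨a1, a2⟩, b1, b2⟩ := hu
  have hpos : (0 : ℝ) < 2 ^ p := by positivity
  push_cast at a1 a2 b1 b2
  have key : ∀ (a i : ℤ) (x : ℝ), a * 2 ^ q + 1 ≤ i → i ≤ (a + 1) * 2 ^ q →
      ((i : ℝ) - 1) / 2 ^ p ≤ x → x < (i : ℝ) / 2 ^ p →
      a * side p q ≤ x ∧ x < (a + 1) * side p q := by
    intro a i x h1 h2 h3 h4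
    have h1' : (a : ℝ) * 2 ^ q + 1 ≤ i := by exact_mod_cast h1
    have h2' : (i : ℝ) ≤ (a + 1) * 2 ^ q := by exact_mod_cast h2
    rw [side, mul_div_assoc', mul_div_assoc']
    constructor
    · refine le_trans ?_ h3
      gcongr; linarith
    · refine lt_of_lt_of_le h4 ?_
      gcongr
  exact ⟨key _ _ _ hs.1.1 hs.1.2 a1 a2, key _ _ _ hs.2.1 hs.2.2 b1 b2⟩

lemma ae_mem_openBlock {p q : ℕ} {c s : ℤ × ℤ} (hs : s ∈ block q c) :
    ∀ᵐ u ∂(volume.restrict (cell (2 ^ p) s)), u ∈ openBlock p q c := by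
  rw [ae_restrict_iff' (measurableSet_cell _ _)]
  filter_upwards [ae_fst_ne (c.1 * side p q), ae_snd_ne (c.2 * side p q)] with u h1 h2 hu
  obtain ⟨⟨a1, a2⟩, b1, b2⟩ := cell_subset_block hs hu
  exact ⟨⟨lt_of_le_of_ne a1 h1.symm, a2⟩, lt_of_le_of_ne b1 h2.symm, b2⟩

/-- The blocks close to the horizon boundary. -/
def IsNear (C : ℝ) (h : ℝ → ℝ) (p q : ℕ) (c : ℤ × ℤ) : Prop :=
  |h (c.1 * side p q) - c.2 * side p q| ≤ (C + 1) * side p q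

namespace HorizonBounds

variable {α C : ℝ} {h m : ℝ → ℝ} {f : ℝ × ℝ → ℝ}

lemma C_pos (H : HorizonBounds α C h m f) : 0 < C := zero_lt_one.trans_le H.one_le

lemma card_badIndices_le (H : HorizonBounds α C h m f) (p q : ℕ) :
    ((badIndices (IsNear C h p) p q).card : ℝ) ≤ (2 * C + 3) * 2 ^ (p - q) := by
  have hs := side_pos p q
  have hC := H.C_pos
  have := card_le_of_abs_sub_le (S := badIndices (IsNear C h p) p q)
    (I := Finset.Ico (0 : ℤ) (2 ^ (p - q))) (a := fun i => h (i * side p q) / side p q) (ρ := C + 1)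
    (by linarith) (by
      intro c hc
      obtain ⟨hc, hb⟩ := mem_badIndices.1 hc
      refine ⟨(Finset.mem_product.1 hc).1, ?_⟩
      rw [IsNear, abs_sub_comm] at hb
      have e : (c.2 : ℝ) - h (c.1 * side p q) / side p q
          = (c.2 * side p q - h (c.1 * side p q)) / side p q := by field_simp
      rw [e, abs_div, abs_of_pos hs, div_le_iff₀ hs]
      exact hb)
  refine this.trans_eq ?_
  have e : ((2 : ℤ) ^ (p - q)).toNat = 2 ^ (p - q) := by
    have e : (2 : ℤ) ^ (p - q) = ((2 ^ (p - q) : ℕ) : ℤ) := by push_cast; rfl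
    rw [e, Int.toNat_natCast]
  rw [Int.card_Ico, sub_zero, e]
  push_cast
  ring

/-- Over a block `h` varies by at most C times the side and the second coordinate by at most the
side, which explains the constant `C + 1` in `IsNear`. -/
lemma openBlock_subset (H : HorizonBounds α C h m f) {p q : ℕ} (hq : q ≤ p) {c : ℤ × ℤ}
    (hc : c ∈ blockIndices p q) (hb : ¬IsNear C h p q c) :
    openBlock p q c ⊆ aboveGraph h ∨ openBlock p q c ⊆ belowGraph h := by
  have hs := side_pos p q
  have hC := H.C_pos
  obtain ⟨⟨x0, x1⟩, y0, y1⟩ := corner_mem hq hc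
  have hlip : ∀ u ∈ openBlock p q c, |h u.1 - h (c.1 * side p q)| ≤ C * side p q := by
    rintro u ⟨⟨a1, a2⟩, -⟩
    refine (H.abs_boundary_sub_le _ ⟨x0, by linarith⟩ _ ⟨by linarith, by linarith⟩).trans ?_
    rw [abs_of_nonneg (by linarith)]
    have : u.1 - c.1 * side p q ≤ side p q := by linarith
    gcongr
  rw [IsNear, not_le, lt_abs] at hb
  rcases hb with hb | hb
  · right
    intro u hu
    have h1 := (abs_le.1 (hlip u hu)).1
    obtain ⟨⟨a1, a2⟩, b1, b2⟩ := hu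
    exact ⟨⟨by linarith, by linarith⟩, ⟨by linarith, by linarith⟩, by linarith⟩
  · left
    intro u hu
    have h1 := (abs_le.1 (hlip u hu)).2
    obtain ⟨⟨a1, a2⟩, b1, b2⟩ := hu
    exact ⟨⟨by linarith, by linarith⟩, ⟨by linarith, by linarith⟩, by linarith⟩

lemma exists_affine_of_not_near (H : HorizonBounds α C h m f) {p q : ℕ} (hq : q ≤ p) {c : ℤ × ℤ}
    (hc : c ∈ blockIndices p q) (hb : ¬IsNear C h p q c) :
    ∃ A ∈ affineFunctions, ∃ b : ℝ, ∀ u ∈ openBlock p q c,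
      |f u - A u| ≤ C * side p q ^ α ∧ |f u - b| ≤ C * side p q := by
  have hs := side_pos p q
  set z₀ : ℝ × ℝ := ((c.1 + 1 / 2) * side p q, (c.2 + 1 / 2) * side p q) with hz
  have hz₀ : z₀ ∈ openBlock p q c := by
    refine ⟨⟨?_, ?_⟩, ?_, ?_⟩ <;> simp only [hz] <;> nlinarith
  obtain ⟨A, hA, h1⟩ := H.taylor _ (convex_openBlock p q c) (H.openBlock_subset hq hc hb) z₀ hz₀
    (side p q) hs (by
      rintro z ⟨⟨a1, a2⟩, b1, b2⟩
      rw [Prod.norm_def, sup_le_iff, Real.norm_eq_abs, Real.norm_eq_abs, abs_le, abs_le, hz,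
        Prod.fst_sub, Prod.snd_sub]
      constructor <;> constructor <;> dsimp only <;> linarith)
  exact ⟨A, hA, f z₀, h1⟩

lemma exists_approx_of_not_near (H : HorizonBounds α C h m f) {p q : ℕ} (hq : q ≤ p) {c : ℤ × ℤ}
    (hc : c ∈ blockIndices p q) (hb : ¬IsNear C h p q c) :
    ∃ w ∈ fragmentSpace (2 ^ p) (block q c), ∀ s ∈ block q c,
      |localMean (2 ^ p) f s - w s| ≤ C * side p q ^ α := by
  obtain ⟨A, hA, b, hAb⟩ := H.exists_affine_of_not_near hq hc hb
  refine ⟨_, indicator_mem_fragmentSpace hA, fun s hs => ?_⟩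
  rw [Set.indicator_of_mem (Finset.mem_coe.2 hs)]
  have hn : 0 < 2 ^ p := by positivity
  refine abs_localMean_sub_le hn (H.integrableOn_cell hn (block_subset_grid hq hc hs))
    (integrableOn_cell_of_mem_affineFunctions hA _ _) ?_
  filter_upwards [ae_mem_openBlock hs] with u hu
  exact (hAb u hu).1

lemma ae_abs_le_cell (H : HorizonBounds α C h m f) {n : ℕ} (hn : 0 < n) {s : ℤ × ℤ}
    (hs : s ∈ grid n) : ∀ᵐ u ∂(volume.restrict (cell n s)), |f u| ≤ C := by
  rw [ae_restrict_iff' (measurableSet_cell _ _)]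
  filter_upwards [H.ae_abs_le] with u hu hus
  exact hu (cell_subset_unitSquare hn hs hus)

/-- The discretisation error of a horizon function is of the order of the pixel size. -/
lemma sum_setIntegral_cell_le (H : HorizonBounds α C h m f) (p : ℕ) :
    ∑ s ∈ grid (2 ^ p), ∫ u in cell (2 ^ p) s, (localMean (2 ^ p) f s - f u) ^ 2 ≤
      4 * C ^ 2 * (2 * C + 4) / 2 ^ p := by
  classical
  have hn : 0 < 2 ^ p := by positivity
  have hC := H.C_pos
  have hside : side p 0 = 1 / 2 ^ p := by simp [side]
  -- A pixel is a block with exponent 0. Near the boundary `f` is only bounded, so the comparison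
  -- constant is 0 and ε = C; elsewhere the Lipschitz bound gives ε = C/n.
  have hcell : ∀ s ∈ grid (2 ^ p), ∫ u in cell (2 ^ p) s, (localMean (2 ^ p) f s - f u) ^ 2 ≤
      4 * C ^ 2 / (2 ^ p) ^ 4 +
        if IsNear C h p 0 (blockIndex 0 s) then 4 * C ^ 2 / (2 ^ p) ^ 2 else 0 := by
    intro s hs
    have hint := H.integrableOn_cell hn hs
    split_ifs with hb
    · have := setIntegral_cell_sq_le (c := 0) hn hint
        (by simpa using H.ae_abs_le_cell hn hs)
      push_cast at this
      have h0 : 0 ≤ 4 * C ^ 2 / ((2 : ℝ) ^ p) ^ 4 := by positivity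
      linarith
    · obtain ⟨A, hA, b, hAb⟩ := H.exists_affine_of_not_near (Nat.zero_le p)
        (blockIndex_mem (Nat.zero_le p) hs) hb
      have := setIntegral_cell_sq_le (c := b) (ε := C * side p 0) hn hint (by
        filter_upwards [ae_mem_openBlock (mem_block.2 rfl)] with u hu
        exact (hAb u hu).2)
      refine this.trans_eq ?_
      rw [hside]
      push_cast
      field_simp
      ring
  have hcard : (((grid (2 ^ p)).filter fun s => IsNear C h p 0 (blockIndex 0 s)).card : ℝ) ≤
      (2 * C + 3) * 2 ^ p := by
    refine le_trans ?_ (H.card_badIndices_le p 0)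
    have : ((grid (2 ^ p)).filter fun s => IsNear C h p 0 (blockIndex 0 s)).card ≤
        (badIndices (IsNear C h p) p 0).card := by
      refine Finset.card_le_card_of_injOn (blockIndex 0) ?_ ?_
      · intro s hs
        obtain ⟨hs, hb⟩ := Finset.mem_filter.1 (Finset.mem_coe.1 hs)
        exact mem_badIndices.2 ⟨blockIndex_mem (Nat.zero_le p) hs, hb⟩
      · intro s _ t _ hst
        simp only [blockIndex, pow_zero, Int.ediv_one, Prod.mk.injEq] at hst
        ext <;> omega
    exact_mod_cast this
  refine (Finset.sum_le_sum hcell).trans ?_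
  rw [Finset.sum_add_distrib, Finset.sum_const, card_grid, ← Finset.sum_filter, Finset.sum_const,
    nsmul_eq_mul, nsmul_eq_mul]
  push_cast
  have h1 : (1 : ℝ) ≤ 2 ^ p := one_le_pow₀ (by norm_num)
  have h2 : (0 : ℝ) < 2 ^ p := by positivity
  calc _ ≤ ((2 : ℝ) ^ p) ^ 2 * (4 * C ^ 2 / (2 ^ p) ^ 4) +
        (2 * C + 3) * 2 ^ p * (4 * C ^ 2 / (2 ^ p) ^ 2) := by gcongr
    _ = 4 * C ^ 2 / (2 ^ p) ^ 2 + 4 * C ^ 2 * (2 * C + 3) / 2 ^ p := by field_simp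
    _ ≤ 4 * C ^ 2 / 2 ^ p + 4 * C ^ 2 * (2 * C + 3) / 2 ^ p := by
        gcongr
        nlinarith
    _ = _ := by ring

end HorizonBounds

/-! ### Wedge splits of blocks -/

/-- Discrete intermediate value theorem: an integer function growing by at most one per step cannot
jump over `r + 1`. -/
lemma exists_crossing {φ : ℤ → ℤ} (hφ : ∀ i, φ (i + 1) ≤ φ i + 1) {r : ℤ} (k : ℕ) :
    ∀ i : ℤ, φ i ≤ r → r < φ (i + k) → ∃ l : ℤ, i ≤ l ∧ l + 1 ≤ i + k ∧ φ l = r ∧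
      φ (l + 1) = r + 1 := by
  induction k with
  | zero => intro i h1 h2; simp at h2; omega
  | succ k ih =>
    intro i h1 h2
    by_cases h3 : φ (i + 1) ≤ r
    · obtain ⟨l, a, b, c, d⟩ := ih (i + 1) h3 (by convert h2 using 2; push_cast; ring)
      exact ⟨l, by omega, by push_cast; omega, c, d⟩
    · have := hφ i
      exact ⟨i, le_rfl, by push_cast; omega, by omega, by omega⟩

lemma exists_crossing_Icc {φ : ℤ → ℤ} (hφ : ∀ i, φ (i + 1) ≤ φ i + 1) (hφ' : ∀ i, φ i ≤ φ (i + 1) + 1)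
    {r i j a b : ℤ} (hi : i ∈ Finset.Icc a b) (hj : j ∈ Finset.Icc a b) (h1 : φ i ≤ r)
    (h2 : r < φ j) : (∃ l ∈ Finset.Icc a b, φ l = r) ∧ ∃ l ∈ Finset.Icc a b, φ l = r + 1 := by
  rw [Finset.mem_Icc] at hi hj
  simp only [Finset.mem_Icc]
  rcases le_total i j with hij | hij
  · obtain ⟨k, hk⟩ := Int.eq_ofNat_of_zero_le (sub_nonneg.2 hij)
    obtain ⟨l, h3, h4, h5, h6⟩ := exists_crossing hφ k i h1 (by rwa [← hk, add_sub_cancel])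
    exact ⟨⟨l, by omega, h5⟩, l + 1, by omega, h6⟩
  · obtain ⟨k, hk⟩ := Int.eq_ofNat_of_zero_le (sub_nonneg.2 hij)
    obtain ⟨l, h3, h4, h5, h6⟩ := exists_crossing (φ := fun i => φ (-i)) (r := r)
      (fun i => by
        have := hφ' (-(i + 1))
        rwa [show -(i + 1) + 1 = -i by ring] at this) k (-i) (by simpa using h1)
      (by rw [← hk]; convert h2 using 2; ring)
    exact ⟨⟨-l, by omega, h5⟩, -(l + 1), by omega, h6⟩

/-- The sign relating the normal of the digital lines to the normal `(-sin ϑ, cos ϑ)`. -/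
lemma exists_sign_lineHeight (ϑ : ℝ) : ∃ τ : ℝ, (τ = 1 ∨ τ = -1) ∧ ∀ s : ℤ × ℤ,
    lineHeight ϑ s = τ * (-(s.1 : ℝ) * Real.sin ϑ + s.2 * Real.cos ϑ) := by
  by_cases h : |Real.sin ϑ| ≤ |Real.cos ϑ|
  · refine ⟨1, Or.inl rfl, fun s => ?_⟩
    rw [lineHeight, lineNormal, if_pos h]; ring
  · refine ⟨-1, Or.inr rfl, fun s => ?_⟩
    rw [lineHeight, lineNormal, if_neg h]; ring

lemma lineNumber_le_add_one {ϑ : ℝ} {s t : ℤ × ℤ}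
    (h : lineHeight ϑ s ≤ lineHeight ϑ t + lineWidth ϑ) : lineNumber ϑ s ≤ lineNumber ϑ t + 1 := by
  have hd := lineWidth_pos ϑ
  rw [lineNumber, lineNumber, ← Int.ceil_add_one]
  refine Int.ceil_le_ceil ?_
  have : lineHeight ϑ s / lineWidth ϑ ≤ lineHeight ϑ t / lineWidth ϑ + 1 := by
    rw [div_add_one hd.ne']; gcongr
  linarith

/-- A step to a neighbouring pixel changes the height by |sin ϑ| or |cos ϑ|, at most the width of a
line, so no line is skipped. -/
lemma lineNumber_adjacent (ϑ : ℝ) (s : ℤ × ℤ) :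
    (lineNumber ϑ (s.1 + 1, s.2) ≤ lineNumber ϑ s + 1 ∧
      lineNumber ϑ s ≤ lineNumber ϑ (s.1 + 1, s.2) + 1) ∧
    (lineNumber ϑ (s.1, s.2 + 1) ≤ lineNumber ϑ s + 1 ∧
      lineNumber ϑ s ≤ lineNumber ϑ (s.1, s.2 + 1) + 1) := by
  obtain ⟨τ, hτ, h⟩ := exists_sign_lineHeight ϑ
  have hc := abs_le.1 (le_max_left |Real.cos ϑ| |Real.sin ϑ|)
  have hs := abs_le.1 (le_max_right |Real.cos ϑ| |Real.sin ϑ|)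
  refine ⟨⟨?_, ?_⟩, ?_, ?_⟩ <;> refine lineNumber_le_add_one ?_ <;> rw [h, h, lineWidth] <;>
    push_cast <;> rcases hτ with rfl | rfl <;> linarith [hc.1, hc.2, hs.1, hs.2]

/-- If a digital line divides a block properly, then it splits the block. -/
lemma splits_block {ϑ : ℝ} {r : ℤ} {q : ℕ} {c s t : ℤ × ℤ} (hs : s ∈ lowerWedge ϑ r (block q c))
    (ht : t ∈ upperWedge ϑ r (block q c)) : Splits ϑ r (block q c) := by
  obtain ⟨hsQ, hsr⟩ := mem_lowerWedge.1 hs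
  obtain ⟨htQ, htr⟩ := mem_upperWedge.1 ht
  obtain ⟨hs1, hs2⟩ := Finset.mem_product.1 hsQ
  obtain ⟨ht1, ht2⟩ := Finset.mem_product.1 htQ
  simp only [Splits, mem_digitalLine]
  -- Walk from `s` along its row to the column of `t`, then along that column; the crossing happens
  -- on one of the two legs.
  by_cases hcase : r < lineNumber ϑ (t.1, s.2)
  · obtain ⟨⟨l, hl, hlr⟩, l', hl', hlr'⟩ := exists_crossing_Icc
      (φ := fun i => lineNumber ϑ (i, s.2)) (fun i => (lineNumber_adjacent ϑ (i, s.2)).1.1)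
      (fun i => (lineNumber_adjacent ϑ (i, s.2)).1.2) hs1 ht1 hsr hcase
    exact ⟨⟨(l, s.2), Finset.mem_product.2 ⟨hl, hs2⟩, hlr⟩, (l', s.2), Finset.mem_product.2 ⟨hl', hs2⟩, hlr'⟩
  · obtain ⟨⟨l, hl, hlr⟩, l', hl', hlr'⟩ := exists_crossing_Icc
      (φ := fun i => lineNumber ϑ (t.1, i)) (fun i => (lineNumber_adjacent ϑ (t.1, i)).2.1)
      (fun i => (lineNumber_adjacent ϑ (t.1, i)).2.2) hs2 ht2 (not_lt.1 hcase) htr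
    exact ⟨⟨(t.1, l), Finset.mem_product.2 ⟨ht1, hl⟩, hlr⟩,
      (t.1, l'), Finset.mem_product.2 ⟨ht1, hl'⟩, hlr'⟩

lemma fragmentSpace_empty (n : ℕ) : fragmentSpace n ∅ = ⊥ :=
  (Submodule.eq_bot_iff _).2 fun w hw => by
    funext s; exact eq_zero_of_mem_fragmentSpace hw (Finset.notMem_empty s)

lemma upperWedge_eq_sdiff (ϑ : ℝ) (r : ℤ) (Q : Finset (ℤ × ℤ)) :
    upperWedge ϑ r Q = Q \ lowerWedge ϑ r Q := by
  ext s
  rw [Finset.mem_sdiff, mem_upperWedge, mem_lowerWedge, ← not_le]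
  tauto

/-- If one wedge is empty, the lines may fail to split the block legally. The trivial partition then
serves: the other wedge is the whole block, and the space of the empty set is zero. -/
lemma exists_isSplitting_wedges {Θ : Set ℝ} {θ : ℝ} (hθ : θ ∈ Θ) (r : ℤ) (n q : ℕ) (c : ℤ × ℤ) :
    ∃ σ, IsSplitting Θ (block q c) σ ∧
      fragmentSpace n (lowerWedge θ r (block q c)) ≤ partitionSpace n σ ∧
      fragmentSpace n (upperWedge θ r (block q c)) ≤ partitionSpace n σ := by
  by_cases h : (lowerWedge θ r (block q c)).Nonempty ∧ (upperWedge θ r (block q c)).Nonempty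
  · obtain ⟨⟨s, hs⟩, t, ht⟩ := h
    exact ⟨_, Or.inr ⟨θ, hθ, r, splits_block hs ht, rfl⟩,
      fragmentSpace_le_partitionSpace (by simp), fragmentSpace_le_partitionSpace (by simp)⟩
  · refine ⟨{block q c}, Or.inl rfl, ?_⟩
    have hQ := fragmentSpace_le_partitionSpace (n := n) (Finset.mem_singleton_self (block q c))
    have hsd := upperWedge_eq_sdiff θ r (block q c)
    rw [not_and_or, Finset.not_nonempty_iff_eq_empty, Finset.not_nonempty_iff_eq_empty] at h
    rcases h with h | h
    · rw [h, Finset.sdiff_empty] at hsd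
      rw [h, hsd, fragmentSpace_empty]
      exact ⟨bot_le, hQ⟩
    · rw [h, eq_comm, Finset.sdiff_eq_empty_iff_subset] at hsd
      rw [h, (lowerWedge_subset _ _ _).antisymm hsd, fragmentSpace_empty]
      exact ⟨hQ, bot_le⟩

/-- The arctangent, turned by π when it is at most -π/4. The turn reverses the sign of the cosine,
so later arguments may use only its absolute value. -/
lemma exists_angle (m : ℝ) : ∃ ϑ ∈ Set.Ioc (-(Real.pi / 4)) (3 * Real.pi / 4),
    Real.sin ϑ = m * Real.cos ϑ := by
  have hpi := Real.pi_pos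
  have hcos := Real.cos_arctan_pos m
  have hsin : Real.sin (Real.arctan m) = m * Real.cos (Real.arctan m) := by
    have := Real.tan_arctan m
    rwa [Real.tan_eq_sin_div_cos, div_eq_iff hcos.ne'] at this
  by_cases h : -(Real.pi / 4) < Real.arctan m
  · exact ⟨_, ⟨h, by linarith [Real.arctan_lt_pi_div_two m]⟩, hsin⟩
  · refine ⟨Real.arctan m + Real.pi, ⟨by linarith [Real.neg_pi_div_two_lt_arctan m],
      by linarith⟩, ?_⟩
    rw [Real.sin_add_pi, Real.cos_add_pi, hsin]; ring

/-- From cos²(1 + m²) = 1: a bounded slope keeps the cosine away from zero, so distances normal to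
the line convert to vertical ones at the cost of a factor 1 + C. -/
lemma one_le_abs_cos_mul {m C ϑ : ℝ} (hm : |m| ≤ C) (h : Real.sin ϑ = m * Real.cos ϑ) :
    1 ≤ |Real.cos ϑ| * (1 + C) := by
  have h1 := Real.sin_sq_add_cos_sq ϑ
  rw [h] at h1
  have h0 : 0 ≤ C := (abs_nonneg m).trans hm
  have h2 : m ^ 2 ≤ C ^ 2 := by rw [← sq_abs]; gcongr
  refine le_of_sq_le_sq ?_ (by positivity)
  rw [mul_pow, sq_abs]
  nlinarith [mul_le_mul_of_nonneg_left h2 (sq_nonneg (Real.cos ϑ)), sq_nonneg (Real.cos ϑ)]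

/-- A line through a block can be replaced by an available digital line, up to an error of the order
of the pixel size. -/
lemma exists_wedges_of_line {Θ : Set ℝ} {p q : ℕ} (hq : q ≤ p) {c' C : ℝ} (hc' : 0 ≤ c')
    (hΘ : ∀ ϑ ∈ Set.Ioc (-(Real.pi / 4)) (3 * Real.pi / 4), ∃ θ ∈ Θ, |θ - ϑ| ≤ c' / 2 ^ p)
    {m y₀ : ℝ} (hm : |m| ≤ C) (c : ℤ × ℤ) (hy₀ : |y₀ - c.2 * side p q| ≤ (C + 1) * side p q) :
    ∃ σ, IsSplitting Θ (block q c) σ ∧ ∃ U : Finset (ℤ × ℤ),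
      fragmentSpace (2 ^ p) U ≤ partitionSpace (2 ^ p) σ ∧
      fragmentSpace (2 ^ p) (block q c \ U) ≤ partitionSpace (2 ^ p) σ ∧
      ∀ s ∈ block q c, ∀ u ∈ cell (2 ^ p) s,
        (s ∈ U → -((3 + (C + 3) * c') * (1 + C) / 2 ^ p) ≤ u.2 - y₀ - m * (u.1 - c.1 * side p q)) ∧
        (s ∉ U → u.2 - y₀ - m * (u.1 - c.1 * side p q) ≤ (3 + (C + 3) * c') * (1 + C) / 2 ^ p) := by
  obtain ⟨ϑ, hϑ, hsin⟩ := exists_angle m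
  obtain ⟨θ, hθ, hθϑ⟩ := hΘ ϑ hϑ
  obtain ⟨τ, hτ, hheight⟩ := exists_sign_lineHeight θ
  have hC : 0 ≤ C := (abs_nonneg m).trans hm
  have hcos := one_le_abs_cos_mul hm hsin
  have hN : (0 : ℝ) < 2 ^ p := by positivity
  have hd := lineWidth_pos θ
  have hd1 : lineWidth θ ≤ 1 := max_le (Real.abs_cos_le_one θ) (Real.abs_sin_le_one θ)
  have hside := side_pos p q
  have hside1 := side_le_one hq
  set x₀ : ℝ := c.1 * side p q with hx₀
  set P₀ : ℝ := -x₀ * Real.sin θ + y₀ * Real.cos θ with hP₀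
  -- In pixel units: 1 per coordinate for replacing a point of the cell by its pixel, c' and (C +
  -- 2)c' for turning `ϑ` into the available angle `θ`. Rounding to a digital line will add 1 more.
  set K₁ : ℝ := 2 + (C + 3) * c' with hK₁
  -- comparison of the digital height of a pixel with the height over the line
  have hcomp : ∀ s ∈ block q c, ∀ u ∈ cell (2 ^ p) s,
      |(-(s.1 : ℝ) * Real.sin θ + s.2 * Real.cos θ) - 2 ^ p * P₀ -
        2 ^ p * (Real.cos ϑ * (u.2 - y₀ - m * (u.1 - x₀)))| ≤ K₁ := by
    intro s hs u hu
    obtain ⟨⟨a1, a2⟩, b1, b2⟩ := cell_subset_block hs hu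
    obtain ⟨⟨a3, a4⟩, b3, b4⟩ := hu
    push_cast at a3 a4 b3 b4
    rw [div_le_iff₀ hN] at a3 b3
    rw [lt_div_iff₀ hN] at a4 b4
    have hsd : |Real.sin θ - Real.sin ϑ| ≤ c' / 2 ^ p :=
      (Real.abs_sin_sub_sin_le θ ϑ).trans hθϑ
    have hcd : |Real.cos θ - Real.cos ϑ| ≤ c' / 2 ^ p :=
      (Real.abs_cos_sub_cos_le θ ϑ).trans hθϑ
    have e : (-(s.1 : ℝ) * Real.sin θ + s.2 * Real.cos θ) - 2 ^ p * P₀ -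
        2 ^ p * (Real.cos ϑ * (u.2 - y₀ - m * (u.1 - x₀))) =
        -((s.1 : ℝ) - u.1 * 2 ^ p) * Real.sin θ + (s.2 - u.2 * 2 ^ p) * Real.cos θ +
        2 ^ p * (-(u.1 - x₀) * (Real.sin θ - Real.sin ϑ)) +
        2 ^ p * ((u.2 - y₀) * (Real.cos θ - Real.cos ϑ)) := by
      rw [hsin, hP₀]; ring
    have t1 : |-((s.1 : ℝ) - u.1 * 2 ^ p) * Real.sin θ| ≤ 1 := by
      rw [abs_mul, abs_neg]
      exact mul_le_one₀ (abs_le.2 ⟨by linarith, by linarith⟩) (abs_nonneg _) (Real.abs_sin_le_one θ)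
    have t2 : |((s.2 : ℝ) - u.2 * 2 ^ p) * Real.cos θ| ≤ 1 := by
      rw [abs_mul]
      exact mul_le_one₀ (abs_le.2 ⟨by linarith, by linarith⟩) (abs_nonneg _) (Real.abs_cos_le_one θ)
    have t3 : |2 ^ p * (-(u.1 - x₀) * (Real.sin θ - Real.sin ϑ))| ≤ c' := by
      rw [abs_mul, abs_mul, abs_neg, abs_of_pos hN]
      have : |u.1 - x₀| ≤ 1 := abs_le.2 ⟨by linarith, by linarith⟩
      calc _ ≤ 2 ^ p * (1 * (c' / 2 ^ p)) := by gcongr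
        _ = c' := by field_simp
    have t4 : |2 ^ p * ((u.2 - y₀) * (Real.cos θ - Real.cos ϑ))| ≤ (C + 2) * c' := by
      rw [abs_mul, abs_mul, abs_of_pos hN]
      have : |u.2 - y₀| ≤ C + 2 := by
        have h1 := abs_le.1 hy₀
        have h2 : (C + 1) * side p q ≤ C + 1 := mul_le_of_le_one_right (by linarith) hside1
        exact abs_le.2 ⟨by linarith, by linarith⟩
      calc _ ≤ 2 ^ p * ((C + 2) * (c' / 2 ^ p)) := by gcongr
        _ = (C + 2) * c' := by field_simp
    rw [e]
    refine (abs_add_le _ _).trans ?_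
    refine (add_le_add ((abs_add_le _ _).trans (add_le_add ((abs_add_le _ _).trans
      (add_le_add t1 t2)) t3)) t4).trans_eq ?_
    rw [hK₁]; ring
  -- the line number
  set r : ℤ := ⌊τ * (2 ^ p * P₀) / lineWidth θ⌋ with hr
  -- The wedges are separated half a line beyond the centre of line `r`, so together with the floor
  -- the threshold is off by at most half a line width, which is less than 1.
  have hr1 : ((r : ℝ) + 1 / 2) * lineWidth θ ≤ τ * (2 ^ p * P₀) + 1 := by
    have := Int.floor_le (τ * (2 ^ p * P₀) / lineWidth θ)
    rw [le_div_iff₀ hd] at this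
    nlinarith
  have hr2 : τ * (2 ^ p * P₀) - 1 ≤ ((r : ℝ) + 1 / 2) * lineWidth θ := by
    have := Int.lt_floor_add_one (τ * (2 ^ p * P₀) / lineWidth θ)
    rw [div_lt_iff₀ hd] at this
    nlinarith
  obtain ⟨σ, hσ, hlow, hup⟩ := exists_isSplitting_wedges hθ r (2 ^ p) q c
  refine ⟨σ, hσ, ?_⟩
  have hsd := upperWedge_eq_sdiff θ r (block q c)
  have hsd' : block q c \ upperWedge θ r (block q c) = lowerWedge θ r (block q c) := by
    rw [hsd, Finset.sdiff_sdiff_eq_self (lowerWedge_subset _ _ _)]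
  have hlower : ∀ s ∈ lowerWedge θ r (block q c), ∀ u ∈ cell (2 ^ p) s,
      2 ^ p * (τ * Real.cos ϑ * (u.2 - y₀ - m * (u.1 - x₀))) ≤ K₁ + 1 := by
    intro s hs u hu
    obtain ⟨hsQ, hsr⟩ := mem_lowerWedge.1 hs
    rw [lineNumber_le_iff, hheight] at hsr
    have := abs_le.1 (hcomp s hsQ u hu)
    rcases hτ with h | h <;> rw [h] at hsr hr1 ⊢ <;> linarith
  have hupper : ∀ s ∈ upperWedge θ r (block q c), ∀ u ∈ cell (2 ^ p) s,
      -(K₁ + 1) ≤ 2 ^ p * (τ * Real.cos ϑ * (u.2 - y₀ - m * (u.1 - x₀))) := by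
    intro s hs u hu
    obtain ⟨hsQ, hsr⟩ := mem_upperWedge.1 hs
    rw [← not_le, lineNumber_le_iff, hheight, not_le] at hsr
    have := abs_le.1 (hcomp s hsQ u hu)
    rcases hτ with h | h <;> rw [h] at hsr hr2 ⊢ <;> linarith
  have hK0 : 0 ≤ K₁ + 1 := by positivity
  have hKe : (3 + (C + 3) * c') = K₁ + 1 := by rw [hK₁]; ring
  rw [hKe]
  -- an upper bound for `|a|` times a slope bounded below gives a bound
  have hdiv : ∀ e T : ℝ, 1 ≤ e * (1 + C) → 2 ^ p * (e * T) ≤ K₁ + 1 →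
      T ≤ (K₁ + 1) * (1 + C) / 2 ^ p := by
    intro e T he h1
    rw [le_div_iff₀ hN]
    rcases le_total T 0 with hT | hT
    · nlinarith [mul_nonneg hK0 (by linarith : 0 ≤ 1 + C)]
    · calc T * 2 ^ p ≤ (e * (1 + C)) * (T * 2 ^ p) := le_mul_of_one_le_left (by positivity) he
        _ = (2 ^ p * (e * T)) * (1 + C) := by ring
        _ ≤ _ := by gcongr
  have habs : |τ * Real.cos ϑ| = |Real.cos ϑ| := by
    rcases hτ with h | h <;> rw [h] <;> simp
  -- The sign decides which wedge lies geometrically above the line; `U` is taken to be that one.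
  rcases le_total 0 (τ * Real.cos ϑ) with hpos | hneg
  · rw [← habs, abs_of_nonneg hpos] at hcos
    refine ⟨upperWedge θ r (block q c), hup, by rw [hsd']; exact hlow,
      fun s hs u hu => ⟨fun hsU => ?_, fun hsU => ?_⟩⟩
    · have := hdiv _ (-(u.2 - y₀ - m * (u.1 - x₀))) hcos (by linarith [hupper s hsU u hu])
      linarith
    · exact hdiv _ _ hcos (hlower s (hsd' ▸ Finset.mem_sdiff.2 ⟨hs, hsU⟩) u hu)
  · rw [← habs, abs_of_nonpos hneg] at hcos
    refine ⟨lowerWedge θ r (block q c), hlow, by rw [← hsd]; exact hup,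
      fun s hs u hu => ⟨fun hsU => ?_, fun hsU => ?_⟩⟩
    · have := hdiv _ (-(u.2 - y₀ - m * (u.1 - x₀))) hcos (by linarith [hlower s hsU u hu])
      linarith
    · exact hdiv _ _ hcos (by
        linarith [hupper s (hsd ▸ Finset.mem_sdiff.2 ⟨hs, hsU⟩) u hu])

/-! ### Approximation of horizon functions -/

namespace HorizonBounds

variable {α C : ℝ} {h m : ℝ → ℝ} {f : ℝ × ℝ → ℝ}

/-- On one side of a tangent of the boundary, up to a strip, a horizon function is almost constant
on a small block. -/
lemma exists_const (H : HorizonBounds α C h m f) {p q : ℕ} {c : ℤ × ℤ} {S : Set (ℝ × ℝ)}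
    (hS : Convex ℝ S) (hSb : S ⊆ openBlock p q c) (hSU : S ⊆ aboveGraph h ∨ S ⊆ belowGraph h) :
    ∃ b : ℝ, |b| ≤ C ∧ ∀ u ∈ S, |f u - b| ≤ C * side p q := by
  have hs := side_pos p q
  rcases S.eq_empty_or_nonempty with rfl | ⟨z₀, hz₀⟩
  · exact ⟨0, by simpa using H.C_pos.le, by simp⟩
  · refine ⟨f z₀, H.abs_value_le z₀ (hSU.imp (fun h => h hz₀) fun h => h hz₀), fun u hu => ?_⟩
    obtain ⟨A, -, h1⟩ := H.taylor S hS hSU z₀ hz₀ (side p q) hs (by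
      intro z hz
      obtain ⟨⟨a1, a2⟩, b1, b2⟩ := hSb hz
      obtain ⟨⟨a3, a4⟩, b3, b4⟩ := hSb hz₀
      rw [Prod.norm_def, sup_le_iff, Real.norm_eq_abs, Real.norm_eq_abs, abs_le, abs_le,
        Prod.fst_sub, Prod.snd_sub]
      constructor <;> constructor <;> linarith)
    exact (h1 u hu).2

/-- One constant per wedge is enough. Outside a strip of vertical half-width w + K/n about the
tangent, the wedge containing a pixel agrees with the side of the boundary, and `f` is within C
times the side of the constant. Inside, the error is at most 2C, and the pixels are counted by
columns. -/
lemma exists_approx_of_wedge (H : HorizonBounds α C h m f) {p q : ℕ} (hq : q ≤ p) {c : ℤ × ℤ}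
    (hc : c ∈ blockIndices p q) {K : ℝ} (hK : 0 ≤ K) {U : Finset (ℤ × ℤ)}
    (hU : ∀ s ∈ block q c, ∀ u ∈ cell (2 ^ p) s,
      (s ∈ U → -(K / 2 ^ p) ≤
        u.2 - h (c.1 * side p q) - m (c.1 * side p q) * (u.1 - c.1 * side p q)) ∧
      (s ∉ U → u.2 - h (c.1 * side p q) - m (c.1 * side p q) * (u.1 - c.1 * side p q) ≤
        K / 2 ^ p)) :
    ∃ w₁ ∈ fragmentSpace (2 ^ p) U, ∃ w₂ ∈ fragmentSpace (2 ^ p) (block q c \ U),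
      ∑ s ∈ block q c, (localMean (2 ^ p) f s - (w₁ + w₂) s) ^ 2 ≤
        (2 ^ q) ^ 2 * (C * side p q) ^ 2 +
          2 ^ q * (2 * (2 ^ p * (C * side p q ^ α) + K + C + 1) + 1) * (4 * C ^ 2) := by
  classical
  have hs := side_pos p q
  have hC := H.C_pos
  have hN : (0 : ℝ) < 2 ^ p := by positivity
  have hn : 0 < 2 ^ p := by positivity
  obtain ⟨⟨hx0, hx1⟩, hy0, hy1⟩ := corner_mem hq hc
  set x₀ : ℝ := c.1 * side p q with hx₀
  have hx0mem : x₀ ∈ Set.Icc (0 : ℝ) 1 := ⟨hx0, by linarith⟩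
  set T : ℝ × ℝ → ℝ := fun u => u.2 - h x₀ - m x₀ * (u.1 - x₀) with hT
  set w : ℝ := C * side p q ^ α with hw
  have hw0 : 0 ≤ w := by positivity
  have hlin : IsLinearMap ℝ fun u : ℝ × ℝ => u.2 - m x₀ * u.1 :=
    ⟨fun u v => by simp only [Prod.fst_add, Prod.snd_add]; ring,
      fun a u => by simp only [Prod.smul_fst, Prod.smul_snd, smul_eq_mul]; ring⟩
  have htaylor : ∀ u ∈ openBlock p q c, |h u.1 - h x₀ - m x₀ * (u.1 - x₀)| ≤ w := by
    rintro u ⟨⟨a1, a2⟩, -⟩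
    exact H.boundary_taylor x₀ hx0mem (side p q) hs u.1 ⟨by linarith, by linarith⟩
      (abs_le.2 ⟨by linarith, by linarith⟩)
  -- The part of the block above the graph need not be convex. Cutting along the tangent raised by
  -- its Taylor error `w` gives a convex set that lies above the graph, as the mean value inequality
  -- demands.
  obtain ⟨b₁, hb₁, hfb₁⟩ := H.exists_const (p := p) (q := q) (c := c)
    (S := openBlock p q c ∩ {u | w + h x₀ - m x₀ * x₀ < u.2 - m x₀ * u.1})
    ((convex_openBlock p q c).inter (convex_halfSpace_gt hlin _)) Set.inter_subset_left (by
      left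
      rintro u ⟨hu, hTu⟩
      have h1 := (abs_le.1 (htaylor u hu)).2
      rw [Set.mem_ofPred_eq] at hTu
      obtain ⟨⟨a1, a2⟩, b1, b2⟩ := hu
      exact ⟨⟨by linarith, by linarith⟩, ⟨by linarith, by linarith⟩, by linarith⟩)
  obtain ⟨b₂, hb₂, hfb₂⟩ := H.exists_const (p := p) (q := q) (c := c)
    (S := openBlock p q c ∩ {u | u.2 - m x₀ * u.1 < -w + h x₀ - m x₀ * x₀})
    ((convex_openBlock p q c).inter (convex_halfSpace_lt hlin _)) Set.inter_subset_left (by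
      right
      rintro u ⟨hu, hTu⟩
      have h1 := (abs_le.1 (htaylor u hu)).1
      rw [Set.mem_ofPred_eq] at hTu
      obtain ⟨⟨a1, a2⟩, b1, b2⟩ := hu
      exact ⟨⟨by linarith, by linarith⟩, ⟨by linarith, by linarith⟩, by linarith⟩)
  refine ⟨_, indicator_mem_fragmentSpace (const_mem_affineFunctions b₁), _,
    indicator_mem_fragmentSpace (const_mem_affineFunctions b₂), ?_⟩
  set W : ℤ × ℤ → ℝ := (U : Set (ℤ × ℤ)).indicator (localMean (2 ^ p) fun _ => b₁) +
    ((block q c \ U : Finset (ℤ × ℤ)) : Set (ℤ × ℤ)).indicator (localMean (2 ^ p) fun _ => b₂)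
    with hW
  have hW1 : ∀ s ∈ U, W s = b₁ := by
    intro s hsU
    rw [hW, Pi.add_apply, Set.indicator_of_mem (Finset.mem_coe.2 hsU),
      Set.indicator_of_notMem (by simp [hsU]), localMean_const hn, add_zero]
  have hW2 : ∀ s ∈ block q c, s ∉ U → W s = b₂ := by
    intro s hsQ hsU
    rw [hW, Pi.add_apply, Set.indicator_of_notMem (by simpa using hsU),
      Set.indicator_of_mem (by simp [hsQ, hsU]), localMean_const hn, zero_add]
  -- the pixels close to the boundary
  let B : Finset (ℤ × ℤ) := (block q c).filter fun s =>
    ∃ u ∈ cell (2 ^ p) s, |T u| ≤ w + K / 2 ^ p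
  have hB : (B.card : ℝ) ≤ 2 ^ q * (2 * (2 ^ p * w + K + C + 1) + 1) := by
    have := card_le_of_abs_sub_le (S := B)
      (I := Finset.Icc (c.1 * 2 ^ q + 1) ((c.1 + 1) * 2 ^ q))
      (a := fun i => 2 ^ p * (h x₀ + m x₀ * (i / 2 ^ p - x₀))) (ρ := 2 ^ p * w + K + C + 1)
      (by positivity) (by
        intro s hsB
        obtain ⟨hsQ, u, hu, hTu⟩ := Finset.mem_filter.1 hsB
        refine ⟨(Finset.mem_product.1 hsQ).1, ?_⟩
        obtain ⟨⟨a3, a4⟩, b3, b4⟩ := hu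
        push_cast at a3 a4 b3 b4
        rw [div_le_iff₀ hN] at a3 b3
        rw [lt_div_iff₀ hN] at a4 b4
        have e : (s.2 : ℝ) - 2 ^ p * (h x₀ + m x₀ * (s.1 / 2 ^ p - x₀)) =
            2 ^ p * T u + (s.2 - u.2 * 2 ^ p) + -(m x₀ * (s.1 - u.1 * 2 ^ p)) := by
          simp only [hT]; field_simp; ring
        have t1 : |2 ^ p * T u| ≤ 2 ^ p * w + K := by
          rw [abs_mul, abs_of_pos hN]
          calc _ ≤ 2 ^ p * (w + K / 2 ^ p) := by gcongr
            _ = _ := by field_simp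
        have t2 : |(s.2 : ℝ) - u.2 * 2 ^ p| ≤ 1 := abs_le.2 ⟨by linarith, by linarith⟩
        have t3 : |-(m x₀ * ((s.1 : ℝ) - u.1 * 2 ^ p))| ≤ C * 1 := by
          rw [abs_neg, abs_mul]
          have := H.abs_slope_le x₀ hx0mem
          have : |(s.1 : ℝ) - u.1 * 2 ^ p| ≤ 1 := abs_le.2 ⟨by linarith, by linarith⟩
          gcongr
        rw [e]
        refine (abs_add_le _ _).trans ((add_le_add ((abs_add_le _ _).trans (add_le_add t1 t2))
          t3).trans_eq (by ring)))
    refine this.trans_eq ?_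
    have e : ((c.1 + 1) * 2 ^ q + 1 - (c.1 * 2 ^ q + 1)).toNat = 2 ^ q := by
      have : (c.1 + 1) * 2 ^ q + 1 - (c.1 * 2 ^ q + 1) = ((2 ^ q : ℕ) : ℤ) := by push_cast; ring
      rw [this, Int.toNat_natCast]
    rw [Int.card_Icc, e]
    push_cast
    rfl
  have hpix : ∀ s ∈ block q c, (localMean (2 ^ p) f s - W s) ^ 2 ≤
      (C * side p q) ^ 2 + if s ∈ B then 4 * C ^ 2 else 0 := by
    intro s hsQ
    have hsg := block_subset_grid hq hc hsQ
    have hint := H.integrableOn_cell hn hsg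
    split_ifs with hsB
    · have h1 := abs_localMean_sub_le hn (A := fun _ => 0) hint (integrable_const 0)
        (by simpa using H.ae_abs_le_cell hn hsg)
      rw [localMean_const hn, sub_zero] at h1
      have h2 : |W s| ≤ C := by
        by_cases hsU : s ∈ U
        · rw [hW1 s hsU]; exact hb₁
        · rw [hW2 s hsQ hsU]; exact hb₂
      have h3 : |localMean (2 ^ p) f s - W s| ≤ 2 * C := (abs_sub _ _).trans (by linarith)
      have h4 : (localMean (2 ^ p) f s - W s) ^ 2 ≤ (2 * C) ^ 2 := by
        rw [← sq_abs]; exact pow_le_pow_left₀ (abs_nonneg _) h3 2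
      nlinarith [sq_nonneg (C * side p q)]
    · have hfar : ∀ u ∈ cell (2 ^ p) s, w + K / 2 ^ p < |T u| := by
        intro u hu
        by_contra hle
        exact hsB (Finset.mem_filter.2 ⟨hsQ, u, hu, not_lt.1 hle⟩)
      have hKN : 0 ≤ K / 2 ^ p := by positivity
      have h1 : |localMean (2 ^ p) f s - W s| ≤ C * side p q := by
        by_cases hsU : s ∈ U
        · rw [hW1 s hsU, ← localMean_const hn b₁ s]
          refine abs_localMean_sub_le hn hint (integrable_const b₁) ?_
          filter_upwards [ae_mem_openBlock hsQ, ae_restrict_mem (measurableSet_cell _ _)] with u hu hus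
          refine hfb₁ u ⟨hu, ?_⟩
          have h2 := (hU s hsQ u hus).1 hsU
          have h3 := hfar u hus
          rw [lt_abs] at h3
          simp only [hT] at h3
          rw [Set.mem_ofPred_eq]
          rcases h3 with h3 | h3 <;> linarith
        · rw [hW2 s hsQ hsU, ← localMean_const hn b₂ s]
          refine abs_localMean_sub_le hn hint (integrable_const b₂) ?_
          filter_upwards [ae_mem_openBlock hsQ, ae_restrict_mem (measurableSet_cell _ _)] with u hu hus
          refine hfb₂ u ⟨hu, ?_⟩
          have h2 := (hU s hsQ u hus).2 hsU
          have h3 := hfar u hus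
          rw [lt_abs] at h3
          simp only [hT] at h3
          rw [Set.mem_ofPred_eq]
          rcases h3 with h3 | h3 <;> linarith
      rw [add_zero, ← sq_abs]
      exact pow_le_pow_left₀ (abs_nonneg _) h1 2
  refine (Finset.sum_le_sum hpix).trans ?_
  rw [Finset.sum_add_distrib, Finset.sum_const, card_block, ← Finset.sum_filter, Finset.sum_const,
    nsmul_eq_mul, nsmul_eq_mul]
  push_cast
  have hBf : ((block q c).filter (· ∈ B)).card ≤ B.card :=
    Finset.card_le_card fun s hs => (Finset.mem_filter.1 hs).2
  have hBf' : (((block q c).filter (· ∈ B)).card : ℝ) ≤ B.card := by exact_mod_cast hBf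
  gcongr
  exact hBf'.trans hB

lemma exists_approx_of_near (H : HorizonBounds α C h m f) {Θ : Set ℝ} {p q : ℕ} (hq : q ≤ p)
    {c' : ℝ} (hc' : 0 ≤ c')
    (hΘ : ∀ ϑ ∈ Set.Ioc (-(Real.pi / 4)) (3 * Real.pi / 4), ∃ θ ∈ Θ, |θ - ϑ| ≤ c' / 2 ^ p)
    {c : ℤ × ℤ} (hc : c ∈ blockIndices p q) (hb : IsNear C h p q c) :
    ∃ σ, IsSplitting Θ (block q c) σ ∧ ∃ w ∈ partitionSpace (2 ^ p) σ,
      ∑ s ∈ block q c, (localMean (2 ^ p) f s - w s) ^ 2 ≤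
        (2 ^ q) ^ 2 * (C * side p q) ^ 2 +
          2 ^ q * (2 * (2 ^ p * (C * side p q ^ α) + (3 + (C + 3) * c') * (1 + C) + C + 1) + 1) *
            (4 * C ^ 2) := by
  have hC := H.C_pos
  have hs := side_pos p q
  obtain ⟨⟨hx0, hx1⟩, -, -⟩ := corner_mem hq hc
  obtain ⟨σ, hσ, U, h1, h2, hU⟩ := exists_wedges_of_line hq hc' hΘ
    (H.abs_slope_le (c.1 * side p q) ⟨hx0, by linarith⟩) c hb
  obtain ⟨w₁, hw₁, w₂, hw₂, hle⟩ := H.exists_approx_of_wedge hq hc (by positivity) hU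
  exact ⟨σ, hσ, _, Submodule.add_mem _ (h1 hw₁) (h2 hw₂), hle⟩

/-- Horizon functions are approximated by wedge segmentations with `O(4 ^ j)` pieces up to a squared
error of the order `(4 ^ j) ^ (-α)`, plus the pixel size. -/
theorem exists_segmentation (H : HorizonBounds α C h m f) (hα₁ : 1 < α) (hα₂ : α < 2) {c' : ℝ}
    (hc' : 0 ≤ c') : ∃ M : ℝ, 0 ≤ M ∧ ∀ (Θ : Set ℝ) (p j : ℕ), 2 * j ≤ p →
    (∀ ϑ ∈ Set.Ioc (-(Real.pi / 4)) (3 * Real.pi / 4), ∃ θ ∈ Θ, |θ - ϑ| ≤ c' / 2 ^ p) →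
    ∃ S ∈ segmentations Θ (2 ^ p), (S.1.card : ℝ) ≤ M * 4 ^ j ∧
      gridDot (2 ^ p) (localMean (2 ^ p) f - S.2) (localMean (2 ^ p) f - S.2) ≤
        (2 ^ p) ^ 2 * (M * (((4 : ℝ) ^ j) ^ (-α) + 1 / 2 ^ p)) := by
  have hC := H.C_pos
  set K : ℝ := (3 + (C + 3) * c') * (1 + C) with hK
  have hK0 : 0 ≤ K := by positivity
  set M₁ : ℝ := 2 * (1 + 4 * (2 * C + 3)) with hM₁
  set M₂ : ℝ := C ^ 2 + (2 * C + 3) * (C ^ 2 + 4 * C ^ 2 * (2 * C + (2 * K + 2 * C + 3))) with hM₂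
  have hM₁0 : 0 ≤ M₁ := by positivity
  have hM₂0 : 0 ≤ M₂ := by positivity
  refine ⟨M₁ + M₂, by positivity, fun Θ p j hj hΘ => ?_⟩
  have hN : (0 : ℝ) < 2 ^ p := by positivity
  set δ : ℝ := side p (p - 2 * j) with hδ
  have hδ0 : 0 < δ := side_pos _ _
  have hδ1 : δ ≤ 1 := side_le_one (by omega)
  have h4δ : (4 : ℝ) ^ j * δ = 1 := by
    have := pow_mul_side (p := p) (q := p - 2 * j) (by omega)
    rw [show p - (p - 2 * j) = 2 * j by omega, pow_mul] at this
    norm_num at this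
    exact this
  have hqδ : (2 : ℝ) ^ (p - 2 * j) = 2 ^ p * δ := by
    rw [hδ, side]; field_simp
  have hrα : ((4 : ℝ) ^ j) ^ (-α) = δ ^ α := by
    rw [Real.rpow_neg (by positivity), ← Real.inv_rpow (by positivity)]
    congr 1
    exact inv_eq_of_mul_eq_one_right h4δ
  -- The coarsest blocks have side 2^(-j) = √δ, where δ = 4^(-j) is the finest side. This range of
  -- scales makes the squared Taylor error on good blocks match the strip error δ^α.
  have hε : (C * side p (p - j) ^ α) ^ 2 = C ^ 2 * δ ^ α := by
    have e : δ = side p (p - j) ^ 2 := by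
      have h1 := pow_mul_side (p := p) (q := p - j) (by omega)
      rw [show p - (p - j) = j by omega] at h1
      have h2 : (4 : ℝ) ^ j = 2 ^ j * 2 ^ j := by rw [← mul_pow]; norm_num
      have h3 : (4 : ℝ) ^ j * side p (p - j) ^ 2 = 1 := by
        rw [h2, sq]
        calc _ = (2 ^ j * side p (p - j)) * (2 ^ j * side p (p - j)) := by ring
          _ = 1 := by rw [h1, one_mul]
      have h4 : (0 : ℝ) < 4 ^ j := by positivity
      exact mul_left_cancel₀ h4.ne' (h4δ.trans h3.symm)
    rw [mul_pow, e, ← Real.rpow_natCast (side p (p - j)) 2, ← Real.rpow_mul (side_pos _ _).le,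
      ← Real.rpow_natCast (side p (p - j) ^ α), ← Real.rpow_mul (side_pos _ _).le, mul_comm α]
  set E : ℝ := (2 ^ (p - 2 * j)) ^ 2 * (C * δ) ^ 2 +
    2 ^ (p - 2 * j) * (2 * (2 ^ p * (C * δ ^ α) + K + C + 1) + 1) * (4 * C ^ 2) with hE
  have hδα : 0 ≤ δ ^ α := by positivity
  obtain ⟨S, hS, hcard, herr⟩ := Wedgelet.exists_segmentation (Θ := Θ) (p := p) (q₀ := p - 2 * j)
    (q₁ := p - j) (by omega) (by omega) (bad := IsNear C h p) (K := 2 * C + 3)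
    (ε := C * side p (p - j) ^ α) (E := E) (by positivity) (by positivity)
    (fun q _ _ => H.card_badIndices_le p q) (localMean (2 ^ p) f)
    (by
      intro q c _ hq hc hb
      obtain ⟨w, hw, hle⟩ := H.exists_approx_of_not_near (hq.trans (Nat.sub_le _ _)) hc hb
      refine ⟨w, hw, fun s hs => (hle s hs).trans ?_⟩
      have h1 : side p q ≤ side p (p - j) := by
        rw [side, side]; gcongr; norm_num
      have h2 := side_pos p q
      gcongr)
    (fun c hc hb => H.exists_approx_of_near (Nat.sub_le _ _) hc' hΘ hc hb)
  refine ⟨S, hS, hcard.trans ?_, herr.trans ?_⟩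
  · rw [show p - (p - j) = j by omega, show p - (p - 2 * j) = 2 * j by omega, pow_mul]
    have h4 : (0 : ℝ) < 4 ^ j := by positivity
    norm_num
    nlinarith
  · rw [show p - (p - 2 * j) = 2 * j by omega, pow_mul, hε, hrα]
    push_cast
    -- Order 1/δ blocks of area δ² with squared error δ² contribute δ³, which is negligible; this is
    -- why constants on the wedges suffice.
    have hδ3 : δ ^ 3 ≤ δ ^ α := by
      rw [← Real.rpow_natCast]
      exact Real.rpow_le_rpow_of_exponent_ge hδ0 hδ1 (by push_cast; linarith)
    have h22 : ((2 : ℝ) ^ 2) ^ j = 4 ^ j := by norm_num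
    have e : (2 * C + 3) * (2 ^ 2) ^ j * E = (2 ^ p) ^ 2 * ((2 * C + 3) * (C ^ 2 * δ ^ 3 +
        4 * C ^ 2 * (2 * C * δ ^ α + (2 * K + 2 * C + 3) * (1 / 2 ^ p)))) := by
      have h5 : (4 : ℝ) ^ j = 1 / δ := by rw [eq_div_iff hδ0.ne', h4δ]
      rw [h22, h5, hE, hqδ]
      field_simp
      ring
    rw [e, ← mul_add]
    refine mul_le_mul_of_nonneg_left ?_ (by positivity)
    have hi : (0 : ℝ) ≤ 1 / 2 ^ p := by positivity
    have h6 : C ^ 2 * δ ^ α + (2 * C + 3) * (C ^ 2 * δ ^ 3 +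
        4 * C ^ 2 * (2 * C * δ ^ α + (2 * K + 2 * C + 3) * (1 / 2 ^ p))) ≤
        M₂ * (δ ^ α + 1 / 2 ^ p) := by
      have t1 : (2 * C + 3) * (C ^ 2 * δ ^ 3) ≤ (2 * C + 3) * (C ^ 2 * δ ^ α) := by gcongr
      have t2 : 0 ≤ (C ^ 2 + (2 * C + 3) * (C ^ 2 + 4 * C ^ 2 * (2 * C))) * (1 / 2 ^ p) := by
        positivity
      have t3 : 0 ≤ (2 * C + 3) * (4 * C ^ 2 * (2 * K + 2 * C + 3)) * δ ^ α := by positivity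
      rw [hM₂]
      nlinarith
    have h7 : 0 ≤ M₁ * (δ ^ α + 1 / 2 ^ p) := by positivity
    linarith

end HorizonBounds

/-! ### Rates of convergence -/

lemma levels_eq_map : levels = Filter.map (fun p : ℕ => 2 ^ p) atTop := by
  ext s
  rw [levels, mem_inf_principal, mem_map, mem_atTop_sets, mem_atTop_sets]
  constructor
  · rintro ⟨N, hN⟩
    exact ⟨N, fun p hp => hN (2 ^ p) (hp.trans Nat.lt_two_pow_self.le) (two_pow_mem_dyadicLevels p)⟩
  · rintro ⟨p₀, hp₀⟩
    refine ⟨2 ^ p₀, ?_⟩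
    rintro n hn ⟨p, rfl⟩
    exact hp₀ p ((Nat.pow_le_pow_iff_right (by norm_num)).1 hn)

/-- The choice of the number of pieces that balances the penalty and the approximation error. -/
lemma exists_scale {α : ℝ} (hα : 1 < α) (p : ℕ) {γ : ℝ} (hγ0 : 0 < γ) (hγ1 : γ ≤ 1) :
    ∃ j : ℕ, 2 * j ≤ p ∧ γ * 4 ^ j ≤ γ ^ (α / (α + 1)) ∧
      ((4 : ℝ) ^ j) ^ (-α) ≤ 4 ^ α * (γ ^ (α / (α + 1)) + ((2 : ℝ) ^ p) ^ (-(α / (α + 1)))) := by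
  have hα1 : 0 < α + 1 := by linarith
  have hn1 : (1 : ℝ) ≤ 2 ^ p := one_le_pow₀ (by norm_num)
  have hn0 : (0 : ℝ) < 2 ^ p := by positivity
  -- At `N₁` the penalty γN equals N^(-α). The cap `N₂ ≤ 2 ^ p` keeps the smallest blocks at least
  -- one pixel wide and produces the second term of the rate.
  set N₁ : ℝ := γ ^ (-(1 / (α + 1))) with hN₁
  set N₂ : ℝ := ((2 : ℝ) ^ p) ^ (1 / (α + 1)) with hN₂
  have h1 : 1 ≤ N₁ := Real.one_le_rpow_of_pos_of_le_one_of_nonpos hγ0 hγ1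
    (neg_nonpos.2 (by positivity))
  have h2 : 1 ≤ N₂ := Real.one_le_rpow hn1 (by positivity)
  -- A power of 4 within a factor 4 of the target; the rounding costs 4^α in the approximation
  -- error.
  obtain ⟨j, hj1, hj2⟩ := exists_nat_pow_near (le_min h1 h2) (by norm_num : (1 : ℝ) < 4)
  have hj4 : (0 : ℝ) < 4 ^ j := by positivity
  refine ⟨j, ?_, ?_, ?_⟩
  · have h3 : (4 : ℝ) ^ j ≤ 2 ^ p := by
      refine (hj1.trans (min_le_right _ _)).trans ?_
      conv_rhs => rw [← Real.rpow_one ((2 : ℝ) ^ p)]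
      refine Real.rpow_le_rpow_of_exponent_le hn1 ?_
      rw [div_le_one hα1]; linarith
    have h4 : (2 : ℝ) ^ (2 * j) ≤ 2 ^ p := by rw [pow_mul]; norm_num; exact h3
    exact (pow_le_pow_iff_right₀ (by norm_num)).1 h4
  · calc γ * 4 ^ j ≤ γ * N₁ := by gcongr; exact hj1.trans (min_le_left _ _)
      _ = γ ^ (1 : ℝ) * γ ^ (-(1 / (α + 1))) := by rw [Real.rpow_one]
      _ = γ ^ (α / (α + 1)) := by
          rw [← Real.rpow_add hγ0]; congr 1; field_simp; ring
  · have e1 : N₁ ^ (-α) = γ ^ (α / (α + 1)) := by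
      rw [hN₁, ← Real.rpow_mul hγ0.le]; congr 1; field_simp
    have e2 : N₂ ^ (-α) = ((2 : ℝ) ^ p) ^ (-(α / (α + 1))) := by
      rw [hN₂, ← Real.rpow_mul hn0.le]; congr 1; field_simp
    have key : ∀ N : ℝ, 1 ≤ N → N < 4 ^ (j + 1) → ((4 : ℝ) ^ j) ^ (-α) ≤ 4 ^ α * N ^ (-α) := by
      intro N hN hlt
      have h3 : N / 4 ≤ 4 ^ j := by rw [pow_succ] at hlt; linarith
      have h4 := Real.rpow_le_rpow_of_nonpos (z := -α) (by positivity) h3 (by linarith)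
      refine h4.trans_eq ?_
      rw [Real.div_rpow (by positivity) (by norm_num), Real.rpow_neg (by norm_num : (0 : ℝ) ≤ 4)]
      field_simp
    have p1 : 0 ≤ (4 : ℝ) ^ α * γ ^ (α / (α + 1)) := by positivity
    have p2 : 0 ≤ (4 : ℝ) ^ α * ((2 : ℝ) ^ p) ^ (-(α / (α + 1))) := by positivity
    rw [mul_add]
    rcases min_lt_iff.1 hj2 with h | h
    · have := key N₁ h1 h
      rw [e1] at this; linarith
    · have := key N₂ h2 h
      rw [e2] at this; linarith

/-- The factor `D` in the penalty bound is used only through `D ≥ 3`. -/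
lemma three_mul_noiseLevel_le {n D : ℕ} (hn : 0 < n) (hD : 3 ≤ D) {β κ γ R : ℝ} (hβ : 0 < β)
    (hκ : 0 < κ) (hR : 0 ≤ Real.log R)
    (h : β * D * (κ + 1) / κ * (Real.log R / (n : ℝ) ^ 2) < γ) :
    3 * (β * (κ + 1) / κ * Real.log R) ≤ (n : ℝ) ^ 2 * γ := by
  have hn' : (0 : ℝ) < (n : ℝ) ^ 2 := by positivity
  have hD' : (3 : ℝ) ≤ D := by exact_mod_cast hD
  have hX : 0 ≤ β * (κ + 1) / κ * Real.log R := by positivity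
  calc 3 * (β * (κ + 1) / κ * Real.log R) ≤ D * (β * (κ + 1) / κ * Real.log R) := by gcongr
    _ = (n : ℝ) ^ 2 * (β * D * (κ + 1) / κ * (Real.log R / (n : ℝ) ^ 2)) := by field_simp
    _ ≤ _ := by gcongr

end Wedgelet

theorem mainTheorem4
    {Ω : Type*} [MeasurableSpace Ω] (ℙ : MeasureTheory.Measure Ω)
    [MeasureTheory.IsProbabilityMeasure ℙ]
    -- the horizon function
    (α : ℝ) (hα₁ : 1 < α) (hα₂ : α < 2)
    (f : ℝ × ℝ → ℝ) (hf : Wedgelet.IsHorizonFunction α f)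
    -- the angles available at resolution `n`, with spacing of the order of a pixel
    (Θ : ℕ → Set ℝ)
    (hΘ : ∀ n ∈ Wedgelet.dyadicLevels, Θ n ⊆ Set.Ioc (-(Real.pi / 4)) (3 * Real.pi / 4))
    (hΘ_mesh : ∃ c : ℝ, ∀ n ∈ Wedgelet.dyadicLevels,
      ∀ ϑ ∈ Set.Ioc (-(Real.pi / 4)) (3 * Real.pi / 4), ∃ θ ∈ Θ n, |θ - ϑ| ≤ c / n)
    -- the noise
    (ξ : ℕ → ℤ × ℤ → Ω → ℝ)
    (hξ : ∀ n ∈ Wedgelet.dyadicLevels, ∀ s ∈ Wedgelet.grid n, Measurable (ξ n s))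
    (β : ℝ) (hβ : 0 < β) (htail : Wedgelet.TailEstimate ℙ β ξ)
    -- the growth exponent of the number of fragments and the bound of the local dimensions
    (κ : ℝ) (hκ : 0 < κ)
    (hR : ∃ C : ℝ, 0 < C ∧ ∀ᶠ n : ℕ in Wedgelet.levels,
      C * (n : ℝ) ^ κ ≤ ((Wedgelet.fragments (Θ n) n).card : ℝ))
    (D : ℕ)
    (hD : ∀ n ∈ Wedgelet.dyadicLevels, ∀ P ∈ Wedgelet.fragments (Θ n) n,
      Module.finrank ℝ (Wedgelet.fragmentSpace n P) ≤ D)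
    -- the penalty parameters
    (γ : ℕ → ℝ) (hγ_pos : ∀ n ∈ Wedgelet.dyadicLevels, 0 < γ n)
    (hγ_lim : Filter.Tendsto γ Wedgelet.levels (nhds 0))
    (hγ : ∀ᶠ n : ℕ in Wedgelet.levels,
      β * D * (κ + 1) / κ * (Real.log ((Wedgelet.fragments (Θ n) n).card : ℝ) / (n : ℝ) ^ 2) < γ n)
    -- the estimator: any choice of minimal points of the functional for the noisy data
    (partHat : ℕ → Ω → Finset (Finset (ℤ × ℤ))) (fHat : ℕ → Ω → ℤ × ℤ → ℝ)
    (hmin : ∀ n ∈ Wedgelet.dyadicLevels, ∀ ω : Ω,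
      Wedgelet.IsMinimizer (Θ n) n (γ n) (fun s => Wedgelet.localMean n f s + ξ n s ω)
        (partHat n ω, fHat n ω)) :
    MeasureTheory.MemLp f 2 (MeasureTheory.volume.restrict Wedgelet.unitSquare) ∧
    ∀ᵐ ω ∂ℙ,
      Asymptotics.IsBigO Wedgelet.levels
        (fun n : ℕ => Wedgelet.sqDist (Wedgelet.embed n (fHat n ω)) f)
        (fun n : ℕ => γ n ^ (α / (α + 1)) + (n : ℝ) ^ (-(α / (α + 1)))) := by
  open Wedgelet Filter in
  obtain ⟨C, h, m, H⟩ := hf.exists_bounds hα₁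
  refine ⟨H.memLp, ?_⟩
  have hC := H.C_pos
  rw [levels_eq_map] at hR hγ_lim hγ ⊢
  obtain ⟨CR, hCR, hR⟩ := hR
  rw [eventually_map] at hR hγ
  obtain ⟨c, hc⟩ := hΘ_mesh
  have hmesh : ∀ p : ℕ, ∀ ϑ ∈ Set.Ioc (-(Real.pi / 4)) (3 * Real.pi / 4),
      ∃ θ ∈ Θ (2 ^ p), |θ - ϑ| ≤ max c 0 / 2 ^ p := by
    intro p ϑ hϑ
    obtain ⟨θ, hθ, hle⟩ := hc (2 ^ p) (two_pow_mem_dyadicLevels p) ϑ hϑ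
    refine ⟨θ, hθ, hle.trans ?_⟩
    push_cast
    gcongr
    exact le_max_left _ _
  have hD3 : 3 ≤ D := three_le_finrank_fragmentSpace_grid_two.trans
    (hD 2 ⟨1, rfl⟩ _ (fragments_nonempty ⟨1, rfl⟩))
  obtain ⟨M, hM, happrox⟩ := H.exists_segmentation hα₁ hα₂ (le_max_right c 0)
  -- The competitors are fixed before the outcome, so that the directions handed to
  -- `eventually_noise_control` are deterministic. Where γ > 1 the values are fillers; such levels
  -- are eventually excluded.
  have hcomp : ∀ p : ℕ, ∃ (j : ℕ) (S : Finset (Finset (ℤ × ℤ)) × (ℤ × ℤ → ℝ)), γ (2 ^ p) ≤ 1 →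
      (γ (2 ^ p) * 4 ^ j ≤ γ (2 ^ p) ^ (α / (α + 1)) ∧ ((4 : ℝ) ^ j) ^ (-α) ≤
        4 ^ α * (γ (2 ^ p) ^ (α / (α + 1)) + ((2 : ℝ) ^ p) ^ (-(α / (α + 1))))) ∧
      S ∈ segmentations (Θ (2 ^ p)) (2 ^ p) ∧ (S.1.card : ℝ) ≤ M * 4 ^ j ∧
      gridDot (2 ^ p) (localMean (2 ^ p) f - S.2) (localMean (2 ^ p) f - S.2) ≤
        (2 ^ p) ^ 2 * (M * (((4 : ℝ) ^ j) ^ (-α) + 1 / 2 ^ p)) := by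
    intro p
    by_cases hle : γ (2 ^ p) ≤ 1
    · obtain ⟨j, hj, h1, h2⟩ := exists_scale hα₁ p (hγ_pos _ (two_pow_mem_dyadicLevels p)) hle
      obtain ⟨S, hS, h3, h4⟩ := happrox (Θ (2 ^ p)) p j hj (hmesh p)
      exact ⟨j, S, fun _ => ⟨⟨h1, h2⟩, hS, h3, h4⟩⟩
    · exact ⟨0, (∅, 0), fun h => absurd h hle⟩
  choose j S hS using hcomp
  -- A projection for every family of fragments; the random partition is substituted only after the
  -- noise event has been fixed.
  choose best hbest hort using fun (n : ℕ) (𝔓 : Finset (Finset (ℤ × ℤ))) =>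
    exists_best_approx n (partitionSpace n 𝔓) (localMean n f)
  have hnoise := eventually_noise_control hβ htail hκ hCR hR hD
    (fun n => β * (κ + 1) / κ * Real.log ((fragments (Θ n) n).card : ℝ)) (fun _ => rfl)
    (fun p 𝔓 => best (2 ^ p) 𝔓 - (S p).2)
  have hγ1 : ∀ᶠ p : ℕ in atTop, γ (2 ^ p) ≤ 1 :=
    (tendsto_map'_iff.1 hγ_lim).eventually (eventually_le_nhds zero_lt_one)
  filter_upwards [hnoise] with ω hω
  rw [Asymptotics.isBigO_map]
  -- Twice 10M + 82M(4^α + 1) from the oracle inequality, plus twice the discretisation constant.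
  refine Asymptotics.IsBigO.of_bound
    (20 * M + 164 * M * (4 ^ α + 1) + 2 * (4 * C ^ 2 * (2 * C + 4))) ?_
  filter_upwards [hω, hγ, hγ1] with p ⟨hfrag, hdir⟩ hγp hγ1p
  have hnp : 0 < 2 ^ p := by positivity
  have hN : (0 : ℝ) < 2 ^ p := by positivity
  have hlev := two_pow_mem_dyadicLevels p
  obtain ⟨⟨hj1, hj2⟩, hSeg, hcard, herr⟩ := hS p hγ1p
  have hγ0 := hγ_pos _ hlev
  have hlog : 0 ≤ Real.log ((fragments (Θ (2 ^ p)) (2 ^ p)).card : ℝ) := Real.log_natCast_nonneg _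
  have hX := three_mul_noiseLevel_le hnp hD3 hβ hκ hlog hγp
  have hpart : IsWedgePartition (Θ (2 ^ p)) (2 ^ p) (partHat (2 ^ p) ω) := (hmin _ hlev ω).1.1
  have horacle := oracle_inequality hnp (by positivity) hX (hmin _ hlev ω) hSeg
    (hbest (2 ^ p) _) (hort (2 ^ p) _) hfrag
    (hdir _ hpart.subset_fragments (hpart.nonempty hnp))
  have hsq := sqDist_embed_le hnp H.memLp (fHat (2 ^ p) ω)
  have hdisc := H.sum_setIntegral_cell_le p
  push_cast at horacle hsq ⊢
  set a : ℝ := γ (2 ^ p) ^ (α / (α + 1)) with ha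
  set b : ℝ := ((2 : ℝ) ^ p) ^ (-(α / (α + 1))) with hb
  have ha0 : 0 ≤ a := by positivity
  have hb0 : 0 ≤ b := by positivity
  -- Errors of the order of the pixel size are absorbed by the second term of the rate, as α/(α+1) <
  -- 1.
  have hinv : 1 / (2 : ℝ) ^ p ≤ b := by
    rw [hb, one_div, ← Real.rpow_neg_one]
    refine Real.rpow_le_rpow_of_exponent_le (one_le_pow₀ (by norm_num)) ?_
    rw [neg_le_neg_iff, div_le_one (by linarith)]
    linarith
  have h4α : (0 : ℝ) ≤ 4 ^ α := by positivity
  have hG : gridDot (2 ^ p) (localMean (2 ^ p) f - fHat (2 ^ p) ω)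
      (localMean (2 ^ p) f - fHat (2 ^ p) ω) / (2 ^ p) ^ 2 ≤
      10 * (M * a) + 82 * (M * ((4 ^ α + 1) * (a + b))) := by
    rw [div_le_iff₀ (by positivity)]
    refine horacle.trans ?_
    have h1 : (2 ^ p) ^ 2 * γ (2 ^ p) * ((S p).1.card : ℝ) ≤ (2 ^ p) ^ 2 * (M * a) := by
      calc _ ≤ (2 ^ p) ^ 2 * γ (2 ^ p) * (M * 4 ^ j p) := by gcongr
        _ = (2 ^ p) ^ 2 * (M * (γ (2 ^ p) * 4 ^ j p)) := by ring
        _ ≤ _ := by gcongr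
    have h2 : ((4 : ℝ) ^ j p) ^ (-α) + 1 / 2 ^ p ≤ (4 ^ α + 1) * (a + b) := by linarith
    have h3 : (2 ^ p) ^ 2 * (M * (((4 : ℝ) ^ j p) ^ (-α) + 1 / 2 ^ p)) ≤
        (2 ^ p) ^ 2 * (M * ((4 ^ α + 1) * (a + b))) := by gcongr
    linarith
  have hdisc' : ∑ s ∈ grid (2 ^ p), ∫ u in cell (2 ^ p) s, (localMean (2 ^ p) f s - f u) ^ 2 ≤
      4 * C ^ 2 * (2 * C + 4) * b := by
    refine hdisc.trans ?_
    rw [div_eq_mul_one_div]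
    gcongr
  have hpos : 0 ≤ sqDist (embed (2 ^ p) (fHat (2 ^ p) ω)) f :=
    MeasureTheory.integral_nonneg fun u => sq_nonneg _
  simp only [Function.comp_apply, Nat.cast_pow, Nat.cast_ofNat]
  rw [← ha, ← hb, Real.norm_of_nonneg hpos, Real.norm_of_nonneg (add_nonneg ha0 hb0)]
  have h5 : 0 ≤ M * b := by positivity
  have h6 : 0 ≤ 4 * C ^ 2 * (2 * C + 4) * a := by positivity
  linarith
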